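/- Let $G$ be a finitely generated group, let $H$ be a finite group, and let $i_1,i_2\colon H\to G$ be injective homomorphisms such that both images $i_1(H)$ and $i_2(H)$ are normal subgroups of $G$. Let $$G*_{i_1,i_2}=\big(G*\langle t\rangle\big)\big/\big\langle\big\langle\, i_1(h)^{-1}\,t\,i_2(h)\,t^{-1} : h\in H\,\big\rangle\big\rangle$$ be the corresponding HNN extension, where $\langle t\rangle$ is infinite cyclic. Let $\mathcal{C}$ be a class of groups, each equipped with a bi-invariant metric $d$. A group $\Gamma$ is called $\mathcal{C}$-stable if for every sequence of maps $\varphi_n\colon\Gamma\to \mathbf{C}_n$ with $\mathbf{C}_n\in\mathcal{C}$ such that $d(\varphi_n(a)\varphi_n(b),\varphi_n(ab))\to 0$ as $n\to\infty$ for all $a,b\in\Gamma$, there is a sequence of homomorphisms $\psi_n\colon\Gamma\to\mathbf{C}_n$ such that $d(\varphi_n(a),\psi_n(a))\to 0$ as $n\to\infty$ for all $a\in\Gamma$. Let $\mathcal{C}$ be either $\mathcal{C}_{HS}$, the class of the unitary groups $U(k)$ with the metric $d(A,B)=\big(\tfrac1k\operatorname{Tr}((A-B)^*(A-B))\big)^{1/2}$,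 or $\mathcal{C}_P$, the class of the symmetric groups $\operatorname{Sym}(k)$ with the normalized Hamming distance $d(\sigma,\tau)=\tfrac1k\#\{x:\sigma(x)\neq\tau(x)\}$. If $G$ is $\mathcal{C}$-stable, then $G*_{i_1,i_2}$ is $\mathcal{C}$-stable. -/

import Mathlib

open Filter Topology

/-- Stability of a group `G` with respect to a family `C` of groups, the member `C k` being
equipped with the distance `d k`: every sequence of maps from `G` to members of the family that
is asymptotically multiplicative (pointwise) is asymptotically close (pointwise) to a sequence
of homomorphisms to the same members. -/
def IsStable {ι : Type} (C : ι → Type) [∀ k, Group (C k)] (d : ∀ k, C k → C k → ℝ)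
    (G : Type*) [Group G] : Prop :=
  ∀ (k : ℕ → ι) (φ : ∀ n, G → C (k n)),
    (∀ a b : G,
      Tendsto (fun n => d (k n) (φ n a * φ n b) (φ n (a * b))) atTop (𝓝 0)) →
    ∃ ψ : ∀ n, G →* C (k n),
      ∀ a : G, Tendsto (fun n => d (k n) (φ n a) (ψ n a)) atTop (𝓝 0)

/-- The normalized Hilbert-Schmidt norm `tr (A* A) ^ (1/2)`, where `tr` is the normalized trace
`(1 / k) * Tr` on `k × k` complex matrices. -/
noncomputable def hsNorm (k : ℕ) (A : Matrix (Fin k) (Fin k) ℂ) : ℝ :=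
  Real.sqrt ((A.conjTranspose * A).trace.re / k)

/-- The metric on the unitary group `U(k)` given by the normalized Hilbert-Schmidt norm. -/
noncomputable def hsDist (k : ℕ) (U V : Matrix.unitaryGroup (Fin k) ℂ) : ℝ :=
  hsNorm k ((U : Matrix (Fin k) (Fin k) ℂ) - (V : Matrix (Fin k) (Fin k) ℂ))

/-- The normalized Hamming distance `(1 / k) * #{x | σ x ≠ τ x}` on the symmetric group on `k`
points. -/
noncomputable def permDist (k : ℕ) (σ τ : Equiv.Perm (Fin k)) : ℝ :=
  (hammingDist (⇑σ) (⇑τ) : ℝ) / k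

/-- Hilbert-Schmidt stability: stability with respect to the finite-dimensional unitary groups
with the normalized Hilbert-Schmidt metric. -/
def IsHSStable (G : Type*) [Group G] : Prop :=
  IsStable (fun k : ℕ => Matrix.unitaryGroup (Fin k) ℂ) hsDist G

/-- Stability in permutations: stability with respect to the finite symmetric groups with the
normalized Hamming distance. -/
def IsPStable (G : Type*) [Group G] : Prop :=
  IsStable (fun k : ℕ => Equiv.Perm (Fin k)) permDist G

/-- The HNN extension of `G` relative to two inclusions `i₁, i₂ : H → G`: the quotient of
`G * ⟨t⟩` by the relations `t * i₂ h * t⁻¹ = i₁ h` for `h` in `H`. -/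
abbrev HNNOfInclusions {G H : Type*} [Group G] [Group H] (i₁ i₂ : H →* G)
    (h₁ : Function.Injective i₁) (h₂ : Function.Injective i₂) : Type _ :=
  HNNExtension G i₂.range i₁.range
    ((MonoidHom.ofInjective h₂).symm.trans (MonoidHom.ofInjective h₁))

/-! A homomorphism from the HNN extension to `C k` is a pair: a homomorphism `ψ` on `G` and an
element `T` with `T * ψ (i₂ h) * T⁻¹ = ψ (i₁ h)`. Given an asymptotic homomorphism, stability of `G`
replaces its restriction to `G` by true homomorphisms `ψ`; the image `T` of the stable letter then
satisfies the relation only approximately, and the pair has to be corrected (`exists_conjugating`).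

The restrictions of `ψ` along `i₁` and `i₂` are nearly conjugate, so their multiplicity vectors
differ by o(k): the "defect" of `ψ` is small. If the defect vanishes, the restrictions are
conjugate, and `NearConj` allows the conjugating element to be taken near `T` (`exists_near_conj`).
The heart is therefore to kill the defect by a small change of `ψ` (`exists_defect_eq_zero`).

Normality enters here. The product `K` of the two images is a finite normal subgroup, so `ψ` splits
into `G`-invariant pure parts, one for each `G`-orbit of types of `K`. Up to conjugacy, the
restriction to `K` of a pure part is determined by its size, so its defect is proportional to its
size. Zero defect becomes a homogeneous integer linear system in the sizes, and a size vector with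
small defect dominates a nearby solution (`exists_solution_le`). Each pure part is then cut down to
the prescribed size and filled up with a trivial homomorphism: `exists_replacement` compresses to a
corner and uses the stability of `G` a second time to turn the compression into a homomorphism.

The argument runs in an abstract `BlockFamily` with an isotypic theory `Types`. Costs are point
counts or squared Hilbert-Schmidt norms, whence the factor 2 in `cost_triangle`. For permutations a
type is a `G`-conjugacy class of stabilizers in `K`; for unitaries it is a minimal idempotent of the
`G`-invariant part of the group algebra of `K`. -/

/-- A sequence of groups `C k` with unnormalised cost functions and block sums. -/
structure BlockFamily (C : ℕ → Type) [∀ k, Group (C k)] where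
  cost : ∀ {k : ℕ}, C k → C k → ℝ
  cost_nonneg : ∀ {k : ℕ} (x y : C k), 0 ≤ cost x y
  cost_self : ∀ {k : ℕ} (x : C k), cost x x = 0
  cost_comm : ∀ {k : ℕ} (x y : C k), cost x y = cost y x
  cost_triangle : ∀ {k : ℕ} (x y z : C k), cost x z ≤ 2 * (cost x y + cost y z)
  cost_mul_left : ∀ {k : ℕ} (z x y : C k), cost (z * x) (z * y) = cost x y
  cost_mul_right : ∀ {k : ℕ} (z x y : C k), cost (x * z) (y * z) = cost x y
  cost_le : ∀ {k : ℕ} (x y : C k), cost x y ≤ 4 * k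
  sum : ∀ {J : Type} [Fintype J] (a : J → ℕ) {k : ℕ}, ∑ j, a j = k → (∀ j, C (a j)) →* C k
  cost_sum : ∀ {J : Type} [Fintype J] (a : J → ℕ) {k : ℕ} (h : ∑ j, a j = k)
    (x y : ∀ j, C (a j)), cost (sum a h x) (sum a h y) = ∑ j, cost (x j) (y j)

/-- The homomorphism `g ↦ u * ψ g * u⁻¹`. -/
def conjHom {G M : Type*} [Group G] [Group M] (u : M) (ψ : G →* M) : G →* M :=
  (MulAut.conj u).toMonoidHom.comp ψ

@[simp]
theorem conjHom_apply {G M : Type*} [Group G] [Group M] (u : M) (ψ : G →* M) (g : G) :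
    conjHom u ψ g = u * ψ g * u⁻¹ := rfl

theorem conjHom_comp {G H M : Type*} [Group G] [Group H] [Group M] (u : M) (ψ : G →* M)
    (i : H →* G) : (conjHom u ψ).comp i = conjHom u (ψ.comp i) := rfl

/-! ### Block sums, normalised costs and isotypic theories. -/

namespace BlockFamily

variable {C : ℕ → Type} [∀ k, Group (C k)] (B : BlockFamily C)

/-- The block sum of a family of homomorphisms. -/
def sumHom {G : Type*} [Group G] {J : Type} [Fintype J] (a : J → ℕ) {k : ℕ}
    (h : ∑ j, a j = k) (ψ : ∀ j, G →* C (a j)) : G →* C k :=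
  (B.sum a h).comp (MonoidHom.pi ψ)

theorem sumHom_apply {G : Type*} [Group G] {J : Type} [Fintype J] (a : J → ℕ) {k : ℕ}
    (h : ∑ j, a j = k) (ψ : ∀ j, G →* C (a j)) (g : G) :
    B.sumHom a h ψ g = B.sum a h (fun j => ψ j g) := rfl

theorem sumHom_comp {G H : Type*} [Group G] [Group H] {J : Type} [Fintype J] (a : J → ℕ) {k : ℕ}
    (h : ∑ j, a j = k) (ψ : ∀ j, G →* C (a j)) (i : H →* G) :
    (B.sumHom a h ψ).comp i = B.sumHom a h (fun j => (ψ j).comp i) := rfl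

/-- The sizes of a sum of two blocks. -/
def pairSize (m n : ℕ) (b : Bool) : ℕ := cond b m n

theorem sum_pairSize {m n k : ℕ} (h : m + n = k) : ∑ b, pairSize m n b = k := by
  simpa [pairSize] using h

/-- A family indexed by the two blocks. -/
def pairFun {D : ℕ → Type*} {m n : ℕ} (x : D m) (y : D n) : ∀ b, D (pairSize m n b)
  | true => x
  | false => y

/-- The sum of two blocks. -/
def pair {m n k : ℕ} (h : m + n = k) (x : C m) (y : C n) : C k :=
  B.sum (pairSize m n) (sum_pairSize h) (pairFun x y)

/-- The sum of two homomorphisms. -/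
def pairHom {G : Type*} [Group G] {m n k : ℕ} (h : m + n = k) (ψ : G →* C m) (χ : G →* C n) :
    G →* C k :=
  B.sumHom (pairSize m n) (sum_pairSize h) (pairFun (D := fun n => G →* C n) ψ χ)

theorem pairHom_apply {G : Type*} [Group G] {m n k : ℕ} (h : m + n = k) (ψ : G →* C m)
    (χ : G →* C n) (g : G) : B.pairHom h ψ χ g = B.pair h (ψ g) (χ g) := by
  rw [pairHom, pair, sumHom_apply]
  congr 1
  funext b
  cases b <;> rfl

theorem pair_mul {m n k : ℕ} (h : m + n = k) (x x' : C m) (y y' : C n) :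
    B.pair h (x * x') (y * y') = B.pair h x y * B.pair h x' y' := by
  rw [pair, pair, pair, ← map_mul]
  congr 1
  funext b
  cases b <;> rfl

theorem pairHom_comp {G H : Type*} [Group G] [Group H] {m n k : ℕ} (h : m + n = k) (ψ : G →* C m)
    (χ : G →* C n) (i : H →* G) :
    (B.pairHom h ψ χ).comp i = B.pairHom h (ψ.comp i) (χ.comp i) := by
  ext g
  simp [pairHom_apply]

theorem cost_pair {m n k : ℕ} (h : m + n = k) (x x' : C m) (y y' : C n) :
    B.cost (B.pair h x y) (B.pair h x' y') = B.cost x x' + B.cost y y' := by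
  rw [pair, pair, cost_sum]
  simp [pairFun]
  rfl

theorem cost_conj {k : ℕ} (u x y : C k) : B.cost (u * x * u⁻¹) (u * y * u⁻¹) = B.cost x y := by
  rw [cost_mul_right, cost_mul_left]

theorem cost_mul_mul {k : ℕ} (x x' y y' : C k) :
    B.cost (x * y) (x' * y') ≤ 2 * (B.cost x x' + B.cost y y') := by
  simpa [cost_mul_left, cost_mul_right] using B.cost_triangle (x * y) (x' * y) (x' * y')

theorem cost_inv {k : ℕ} (x y : C k) : B.cost x⁻¹ y⁻¹ = B.cost x y := by
  rw [← B.cost_mul_left x, ← B.cost_mul_right y, B.cost_comm]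
  simp

/-- The normalised cost. -/
noncomputable def dist (k : ℕ) (x y : C k) : ℝ := B.cost x y / k

theorem dist_le_iff {k : ℕ} (x y : C k) {ε : ℝ} (hε : 0 ≤ ε) :
    B.dist k x y ≤ ε ↔ B.cost x y ≤ ε * k := by
  -- For `k = 0` the normalised cost is 0 by the convention on division, and `cost_le` gives the
  -- same bound for the cost itself.
  rcases Nat.eq_zero_or_pos k with rfl | hk
  · have := B.cost_le x y
    simp only [dist, Nat.cast_zero, div_zero, mul_zero] at *
    exact iff_of_true hε this
  · rw [dist, div_le_iff₀ (by positivity)]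

theorem dist_nonneg {k : ℕ} (x y : C k) : 0 ≤ B.dist k x y :=
  div_nonneg (B.cost_nonneg x y) (Nat.cast_nonneg k)

/-- Every element is close to a block sum with an identity block, with an error controlled by
the size of this identity block. -/
def Approximable : Prop :=
  ∃ c : ℝ, 0 < c ∧ ∀ {m n k : ℕ} (h : m + n = k) (x : C k),
    ∃ y : C m, B.cost x (B.pair h y 1) ≤ c * (n + 1)

/-- Conjugate homomorphisms that are close to each other are conjugate by an element which is
close to the identity. -/
def NearConj (H : Type*) [Group H] : Prop :=
  ∀ ε : ℝ, 0 < ε → ∃ δ : ℝ, 0 < δ ∧ ∀ {k : ℕ} (ρ : H →* C k) (u : C k),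
    (∀ h, B.cost (ρ h) (conjHom u ρ h) ≤ δ * k) →
      ∃ v : C k, conjHom v ρ = conjHom u ρ ∧ B.cost v 1 ≤ ε * k

/-- An isotypic theory for the homomorphisms from `G` to a block family, relative to a subgroup
`K`. -/
structure Types (G : Type*) [Group G] (K : Subgroup G) where
  num : ℕ
  dim : ∀ {k : ℕ}, (G →* C k) → Fin num → ℕ
  sum_dim : ∀ {k : ℕ} (ψ : G →* C k), ∑ j, dim ψ j = k
  dim_sumHom : ∀ {J : Type} [Fintype J] (a : J → ℕ) {k : ℕ} (h : ∑ i, a i = k)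
    (ψ : ∀ i, G →* C (a i)) (j : Fin num), dim (B.sumHom a h ψ) j = ∑ i, dim (ψ i) j
  dim_conjHom : ∀ {k : ℕ} (u : C k) (ψ : G →* C k), dim (conjHom u ψ) = dim ψ
  -- The coarsening `f` serves twice: `id` splits into pure parts, and a Boolean `f` isolates a
  -- single type.
  decomp : ∀ {J : Type} [Fintype J] [DecidableEq J] (f : Fin num → J) {k : ℕ} (ψ : G →* C k),
    ∃ (a : J → ℕ) (h : ∑ b, a b = k) (χ : ∀ b, G →* C (a b)) (u : C k),
      ψ = conjHom u (B.sumHom a h χ) ∧ ∀ b i, dim (χ b) i = if f i = b then dim ψ i else 0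
  -- Only the restriction to `K` is controlled; on all of `G` pure homomorphisms of equal size need
  -- not be conjugate.
  conj_of_pure : ∀ {k : ℕ} (j : Fin num) (ψ χ : G →* C k), dim ψ j = k → dim χ j = k →
    ∃ u : C k, ∀ x ∈ K, χ x = conjHom u ψ x
  lipschitz : ∀ ε : ℝ, 0 < ε → ∃ δ : ℝ, 0 < δ ∧ ∀ {k : ℕ} (ψ χ : G →* C k),
    (∀ x ∈ K, B.cost (ψ x) (χ x) ≤ δ * k) → ∀ j, |(dim ψ j : ℝ) - dim χ j| ≤ ε * k

/-- If every δ = 1/(n+1) failed, the counterexamples would form a sequence contradicting the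
sequential definition. The multiplicativity error is assumed small uniformly in `a` and `b`, which
is more than pointwise smallness but is what a compression of a homomorphism provides. -/
theorem exists_uniform_of_isStable {G : Type*} [Group G] (hs : IsStable C B.dist G)
    (F : Finset G) {ε : ℝ} (hε : 0 < ε) :
    ∃ δ : ℝ, 0 < δ ∧ ∀ {k : ℕ} (φ : G → C k),
      (∀ a b, B.cost (φ a * φ b) (φ (a * b)) ≤ δ * k) →
        ∃ ψ : G →* C k, ∀ g ∈ F, B.cost (φ g) (ψ g) ≤ ε * k := by
  by_contra! hcon
  choose k φ hφ hψ using fun n : ℕ => hcon (1 / ((n : ℝ) + 1)) (by positivity)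
  obtain ⟨ψ, hclose⟩ := hs k φ (fun a b =>
    squeeze_zero (fun n => B.dist_nonneg _ _)
      (fun n => (B.dist_le_iff _ _ (by positivity)).2 (hφ n a b))
      tendsto_one_div_add_atTop_nhds_zero_nat)
  have hev : ∀ᶠ n in atTop, ∀ g ∈ F, B.dist (k n) (φ n g) (ψ n g) ≤ ε :=
    (F.eventually_all).2 fun g _ => ((hclose g).eventually_lt_const hε).mono fun _ h => h.le
  obtain ⟨n, hn⟩ := hev.exists
  obtain ⟨g, hg, hlt⟩ := hψ n (ψ n)
  exact absurd ((B.dist_le_iff _ _ hε.le).1 (hn g hg)) (not_le.2 hlt)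

end BlockFamily

/-! ### Arithmetic of size vectors. -/

theorem sum_sub_add_sum {X : Type*} [Fintype X] {a b : X → ℕ} (hab : a ≤ b) :
    ∑ x, (b - a) x + ∑ x, a x = ∑ x, b x := by
  rw [← Finset.sum_add_distrib]
  exact Finset.sum_congr rfl fun x _ => Nat.sub_add_cancel (hab x)

/-- A vector of natural numbers dominates a solution of a homogeneous linear system with integer
coefficients, up to an error which is linear in the defect. -/
theorem exists_solution_le {J I : Type*} [Fintype J] [Fintype I] (c : J → I → ℤ) :
    ∃ D : ℕ, ∀ q : J → ℕ, ∃ q' : J → ℕ, q' ≤ q ∧ (∀ i, ∑ j, (q' j : ℤ) * c j i = 0) ∧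
      ((∑ j, (q j - q' j) : ℕ) : ℤ) ≤ D * ∑ i, |∑ j, (q j : ℤ) * c j i| := by
  classical
  -- The right-hand side is a difference of two vectors of naturals, so `S` consists of vectors of
  -- naturals. By Dickson's lemma it has finitely many minimal elements; `D` bounds the sizes of
  -- their first components.
  let S : Set ((J → ℕ) × (I → ℕ) × (I → ℕ)) :=
    {x | x ≠ 0 ∧ ∀ i, ∑ j, (x.1 j : ℤ) * c j i = x.2.1 i - x.2.2 i}
  have hfin : {x | Minimal (· ∈ S) x}.Finite := by
    refine (setOfPred_minimal_antichain (· ∈ S)).finite_of_partiallyWellOrderedOn ?_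
    have : WellQuasiOrderedLE ((J → ℕ) × (I → ℕ) × (I → ℕ)) := inferInstance
    exact Set.isPWO_of_wellQuasiOrderedLE _
  obtain ⟨D, hD⟩ : ∃ D : ℕ, ∀ x, Minimal (· ∈ S) x → ∑ j, x.1 j ≤ D := by
    obtain ⟨D, hD⟩ := (hfin.image fun x => ∑ j, x.1 j).bddAbove
    exact ⟨D, fun x hx => hD ⟨x, hx, rfl⟩⟩
  have key : ∀ (n : ℕ) (f : J → ℕ) (p m : I → ℕ), ∑ j, f j + ∑ i, p i + ∑ i, m i = n →
      (∀ i, ∑ j, (f j : ℤ) * c j i = p i - m i) →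
      ∃ f' : J → ℕ, f' ≤ f ∧ (∀ i, ∑ j, (f' j : ℤ) * c j i = 0) ∧
        ∑ j, (f j - f' j) ≤ D * (∑ i, p i + ∑ i, m i) := by
    intro n
    induction n using Nat.strong_induction_on with
    | _ n ih =>
      intro f p m hn hf
      by_cases h0 : (f, p, m) = (0 : (J → ℕ) × (I → ℕ) × (I → ℕ))
      · obtain ⟨rfl, rfl, rfl⟩ : f = 0 ∧ p = 0 ∧ m = 0 := by simpa [Prod.ext_iff] using h0
        exact ⟨0, le_rfl, by simp, by simp⟩
      obtain ⟨⟨f₀, p₀, m₀⟩, hle, hmin⟩ :=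
        exists_minimal_le_of_wellFoundedLT (· ∈ S) (f, p, m) ⟨h0, hf⟩
      obtain ⟨hlf, hlp, hlm⟩ : f₀ ≤ f ∧ p₀ ≤ p ∧ m₀ ≤ m := by simpa [Prod.le_def] using hle
      have hS := hmin.prop
      have hS := hmin.prop
      have hpos : 0 < ∑ j, f₀ j + ∑ i, p₀ i + ∑ i, m₀ i := by
        rw [Nat.pos_iff_ne_zero]
        intro hz
        refine hS.1 ?_
        simp only [Nat.add_eq_zero_iff, Finset.sum_eq_zero_iff, Finset.mem_univ, true_imp_iff]
          at hz
        exact Prod.ext (funext hz.1.1) (Prod.ext (funext hz.1.2) (funext hz.2))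
      have e1 := sum_sub_add_sum hlf
      have e2 := sum_sub_add_sum hlp
      have e3 := sum_sub_add_sum hlm
      have hf₀ : ∀ i, ∑ j, (f₀ j : ℤ) * c j i = p₀ i - m₀ i := hS.2
      obtain ⟨f', hf'le, hf'0, hf'⟩ := ih (∑ j, (f - f₀) j + ∑ i, (p - p₀) i + ∑ i, (m - m₀) i)
        (by omega) (f - f₀) (p - p₀) (m - m₀) rfl (fun i => by
          have h1 : ∀ j, (((f - f₀) j : ℕ) : ℤ) = f j - f₀ j := fun j => Nat.cast_sub (hlf j)
          have h2 : (((p - p₀) i : ℕ) : ℤ) = p i - p₀ i := Nat.cast_sub (hlp i)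
          have h3 : (((m - m₀) i : ℕ) : ℤ) = m i - m₀ i := Nat.cast_sub (hlm i)
          simp only [h1, h2, h3, sub_mul, Finset.sum_sub_distrib, hf, hf₀]
          ring)
      have hDf : ∑ j, f₀ j ≤ D := hD _ hmin
      have e4 := sum_sub_add_sum hf'le
      -- A minimal solution with zero right-hand side is kept in the answer. Any other one is
      -- discarded: this costs at most `D` and uses up at least one unit of `∑ p + ∑ m`, so the
      -- total loss is at most `D` times that sum.
      by_cases hz : ∑ i, p₀ i + ∑ i, m₀ i = 0
      · refine ⟨f' + f₀, fun j => ?_, fun i => ?_, ?_⟩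
        · have h1 := hf'le j
          have h2 := hlf j
          simp only [Pi.sub_apply, Pi.add_apply] at *
          omega
        · have h1 : p₀ i = 0 := by
            have := (Nat.add_eq_zero_iff.1 hz).1
            exact Finset.sum_eq_zero_iff.1 this i (Finset.mem_univ i)
          have h2 : m₀ i = 0 := by
            have := (Nat.add_eq_zero_iff.1 hz).2
            exact Finset.sum_eq_zero_iff.1 this i (Finset.mem_univ i)
          simp [add_mul, Finset.sum_add_distrib, hf'0, hf₀, h1, h2]
        · have h1 : ∑ i, (p - p₀) i + ∑ i, (m - m₀) i = ∑ i, p i + ∑ i, m i := by omega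
          rw [h1] at hf'
          refine le_trans (le_of_eq (Finset.sum_congr rfl fun j _ => ?_)) hf'
          simp only [Pi.sub_apply, Pi.add_apply]
          omega
      · refine ⟨f', hf'le.trans tsub_le_self, hf'0, ?_⟩
        have h1 : ∑ j, (f j - f' j) = ∑ j, ((f - f₀) j - f' j) + ∑ j, f₀ j := by
          rw [← Finset.sum_add_distrib]
          refine Finset.sum_congr rfl fun j _ => ?_
          have h1 := hf'le j
          have h2 := hlf j
          simp only [Pi.sub_apply] at *
          omega
        have h2 : ∑ i, (p - p₀) i + ∑ i, (m - m₀) i + 1 ≤ ∑ i, p i + ∑ i, m i := by omega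
        calc ∑ j, (f j - f' j) ≤ D * (∑ i, (p - p₀) i + ∑ i, (m - m₀) i) + D := by omega
          _ = D * (∑ i, (p - p₀) i + ∑ i, (m - m₀) i + 1) := by ring
          _ ≤ _ := Nat.mul_le_mul_left D h2
  refine ⟨D, fun q => ?_⟩
  -- The right-hand side is split into positive and negative parts, whose sizes add up to the sum of
  -- absolute values.
  obtain ⟨q', h1, h2, h3⟩ := key _ q (fun i => (∑ j, (q j : ℤ) * c j i).toNat)
    (fun i => (-∑ j, (q j : ℤ) * c j i).toNat) rfl (fun i => by omega)
  refine ⟨q', h1, h2, ?_⟩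
  calc ((∑ j, (q j - q' j) : ℕ) : ℤ) ≤ _ := Int.ofNat_le.2 h3
    _ = _ := by
      push_cast
      rw [← Finset.sum_add_distrib]
      congr 1
      refine Finset.sum_congr rfl fun i _ => ?_
      rcases abs_cases (∑ j, (q j : ℤ) * c j i) with h | h <;> omega

/-- A submonoid of the natural numbers has a period modulo which every element has a bounded
opposite. -/
theorem exists_period (E : AddSubmonoid ℕ) :
    ∃ L B : ℕ, 0 < L ∧ (L ∈ E ∨ ∀ e ∈ E, e = 0) ∧ ∀ a ∈ E, ∃ b ∈ E, b ≤ B ∧ L ∣ a + b := by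
  by_cases hE : ∀ e ∈ E, e = 0
  · exact ⟨1, 0, one_pos, Or.inr hE, fun a _ => ⟨0, E.zero_mem, le_rfl, one_dvd _⟩⟩
  push Not at hE
  obtain ⟨L, hL, hL0⟩ := hE
  have hLpos : 0 < L := Nat.pos_of_ne_zero hL0
  -- `f r` represents the residue `r` in `E`; then `(L - 1) * f r` is an opposite of `r` modulo `L`
  -- that is again in `E`.
  choose! f hf using fun (r : ℕ) (h : ∃ a ∈ E, a % L = r) => h
  refine ⟨L, ∑ r ∈ Finset.range L, (L - 1) * f r, hLpos, Or.inl hL, fun a ha => ?_⟩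
  obtain ⟨h1, h2⟩ := hf (a % L) ⟨a, ha, rfl⟩
  refine ⟨(L - 1) * f (a % L), by simpa using E.nsmul_mem h1 (L - 1), ?_, ?_⟩
  · exact Finset.single_le_sum (f := fun r => (L - 1) * f r) (fun _ _ => Nat.zero_le _)
      (Finset.mem_range.2 (Nat.mod_lt _ hLpos))
  · have h3 : a + (L - 1) * f (a % L) ≡ f (a % L) + (L - 1) * f (a % L) [MOD L] :=
      Nat.ModEq.add_right _ h2.symm
    have h4 : f (a % L) + (L - 1) * f (a % L) = L * f (a % L) := by
      obtain ⟨m, rfl⟩ : ∃ m, L = m + 1 := ⟨L - 1, by omega⟩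
      simp
      ring
    rw [h4] at h3
    exact (Nat.modEq_zero_iff_dvd.1 (h3.trans (Nat.modEq_zero_iff_dvd.2 (dvd_mul_right _ _))))

/-! ### Dimension vectors, pure sizes and the defect. -/

namespace BlockFamily

variable {C : ℕ → Type} [∀ k, Group (C k)] {B : BlockFamily C}

namespace Types

section Dim

variable {G : Type*} [Group G] {K : Subgroup G} (t : B.Types G K)

theorem dim_le {k : ℕ} (ψ : G →* C k) (j : Fin t.num) : t.dim ψ j ≤ k :=
  (Finset.single_le_sum (fun _ _ => Nat.zero_le _) (Finset.mem_univ j)).trans (t.sum_dim ψ).le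

theorem dim_pairHom {m n k : ℕ} (h : m + n = k) (ψ : G →* C m) (χ : G →* C n) (j : Fin t.num) :
    t.dim (B.pairHom h ψ χ) j = t.dim ψ j + t.dim χ j := by
  rw [pairHom, dim_sumHom, Fintype.sum_bool]
  rfl

/-- The trivial homomorphism of size `k` is a sum of `k` trivial ones of size 1, so whether it has a
part of type `j` is decided in size 1. -/
theorem dim_one (k : ℕ) (j : Fin t.num) :
    t.dim (1 : G →* C k) j = k * t.dim (1 : G →* C 1) j := by
  have h : ∑ _i : Fin k, 1 = k := by simp
  have h1 : (1 : G →* C k) = B.sumHom (fun _ : Fin k => 1) h (fun _ => 1) := by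
    ext g
    rw [sumHom_apply]
    exact (map_one (B.sum _ h)).symm
  rw [h1, dim_sumHom]
  simp

/-- The sizes of the homomorphisms which are pure of type `j`. -/
def pureSizes (j : Fin t.num) : AddSubmonoid ℕ where
  carrier := {d | ∃ ψ : G →* C d, t.dim ψ j = d}
  zero_mem' := ⟨1, Nat.le_zero.1 (t.dim_le _ _)⟩
  add_mem' := by
    rintro m n ⟨ψ, hψ⟩ ⟨χ, hχ⟩
    exact ⟨B.pairHom rfl ψ χ, by rw [dim_pairHom, hψ, hχ]⟩

end Dim

section Defect

variable {G H : Type*} [Group G] [Group H] {K : Subgroup G} {K' : Subgroup H}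
variable (t : B.Types G K) (s : B.Types H K') (i₁ i₂ : H →* G)

/-- The difference of the dimension vectors of the two restrictions of a homomorphism. -/
def defect {k : ℕ} (ψ : G →* C k) (i : Fin s.num) : ℤ :=
  s.dim (ψ.comp i₁) i - s.dim (ψ.comp i₂) i

theorem defect_conjHom {k : ℕ} (u : C k) (ψ : G →* C k) :
    s.defect i₁ i₂ (conjHom u ψ) = s.defect i₁ i₂ ψ := by
  funext i
  simp [defect, conjHom_comp, dim_conjHom]

theorem defect_sumHom {J : Type} [Fintype J] (a : J → ℕ) {k : ℕ} (h : ∑ i, a i = k)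
    (ψ : ∀ i, G →* C (a i)) (i : Fin s.num) :
    s.defect i₁ i₂ (B.sumHom a h ψ) i = ∑ j, s.defect i₁ i₂ (ψ j) i := by
  simp [defect, sumHom_comp, dim_sumHom]

theorem defect_pairHom {m n k : ℕ} (h : m + n = k) (ψ : G →* C m) (χ : G →* C n)
    (i : Fin s.num) :
    s.defect i₁ i₂ (B.pairHom h ψ χ) i = s.defect i₁ i₂ ψ i + s.defect i₁ i₂ χ i := by
  simp only [defect, pairHom_comp, dim_pairHom]
  push_cast
  ring

theorem defect_one {k : ℕ} (i : Fin s.num) : s.defect i₁ i₂ (1 : G →* C k) i = 0 := by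
  simp [defect]

theorem defect_congr (h₁ : i₁.range ≤ K) (h₂ : i₂.range ≤ K) {k : ℕ} {ψ χ : G →* C k} (u : C k)
    (h : ∀ x ∈ K, χ x = conjHom u ψ x) : s.defect i₁ i₂ χ = s.defect i₁ i₂ ψ := by
  rw [← s.defect_conjHom i₁ i₂ u ψ]
  have e₁ : χ.comp i₁ = (conjHom u ψ).comp i₁ := MonoidHom.ext fun x => h _ (h₁ ⟨x, rfl⟩)
  have e₂ : χ.comp i₂ = (conjHom u ψ).comp i₂ := MonoidHom.ext fun x => h _ (h₂ ⟨x, rfl⟩)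
  unfold defect
  rw [e₁, e₂]

-- The defect only sees the restriction to `K` up to conjugacy, and for a pure homomorphism this is
-- determined by the size.
include t in
theorem defect_eq_of_pure (h₁ : i₁.range ≤ K) (h₂ : i₂.range ≤ K) {k : ℕ} (j : Fin t.num)
    {ψ χ : G →* C k} (hψ : t.dim ψ j = k) (hχ : t.dim χ j = k) :
    s.defect i₁ i₂ χ = s.defect i₁ i₂ ψ := by
  obtain ⟨u, hu⟩ := t.conj_of_pure j ψ χ hψ hχ
  exact s.defect_congr i₁ i₂ h₁ h₂ u hu

theorem exists_copies {d : ℕ} (j : Fin t.num) (ψ : G →* C d) (hψ : t.dim ψ j = d) (n : ℕ) :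
    ∃ χ : G →* C (n * d), t.dim χ j = n * d ∧
      ∀ i, s.defect i₁ i₂ χ i = n * s.defect i₁ i₂ ψ i := by
  refine ⟨B.sumHom (fun _ : Fin n => d) (by simp) (fun _ => ψ), ?_, fun i => ?_⟩
  · simp [dim_sumHom, hψ]
  · simp [defect_sumHom]

/-- `L` copies of `ψ` and `d` copies of a reference homomorphism of size `L` are pure of the same
size, so their defects agree; the slope `c` is the defect of the reference. If 0 is the only pure
size, `c = 0` will do. -/
theorem exists_slope (h₁ : i₁.range ≤ K) (h₂ : i₂.range ≤ K) (j : Fin t.num) {L : ℕ}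
    (hL : L ∈ t.pureSizes j ∨ ∀ e ∈ t.pureSizes j, e = 0) :
    ∃ c : Fin s.num → ℤ, ∀ {d : ℕ} (ψ : G →* C d), t.dim ψ j = d →
      ∀ i, L * s.defect i₁ i₂ ψ i = d * c i := by
  rcases hL with ⟨ψ₀, h₀⟩ | hE
  · refine ⟨s.defect i₁ i₂ ψ₀, fun {d} ψ hψ i => ?_⟩
    obtain ⟨χ, hχ, hχ'⟩ := exists_copies t s i₁ i₂ j ψ hψ L
    obtain ⟨θ, hθ, hθ'⟩ := exists_copies t s i₁ i₂ j ψ₀ h₀ d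
    rw [← hχ', ← hθ']
    have : ∀ {m n : ℕ} (e : m = n) (χ : G →* C m) (θ : G →* C n), t.dim χ j = m →
        t.dim θ j = n → s.defect i₁ i₂ χ i = s.defect i₁ i₂ θ i := by
      rintro m _ rfl χ θ hχ hθ
      rw [defect_eq_of_pure t s i₁ i₂ h₁ h₂ j hθ hχ]
    exact this (Nat.mul_comm L d) χ θ hχ hθ
  · refine ⟨0, fun {d} ψ hψ i => ?_⟩
    obtain rfl := hE d ⟨ψ, hψ⟩
    have e₁ := s.dim_le (ψ.comp i₁) i
    have e₂ := s.dim_le (ψ.comp i₂) i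
    simp only [defect, Pi.zero_apply, mul_zero, mul_eq_zero]
    right
    omega

/-- In a pure homomorphism of a stable group, one can replace a small part by a trivial
homomorphism so that the remaining part is pure of a prescribed size. -/
theorem exists_replacement (hB : B.Approximable) (hs : IsStable C B.dist G)
    (hK : (K : Set G).Finite) (h₁ : i₁.range ≤ K) (h₂ : i₂.range ≤ K) (j : Fin t.num) {L b₀ : ℕ}
    (hL : L ∈ t.pureSizes j ∨ ∀ e ∈ t.pureSizes j, e = 0)
    (hb : ∀ a ∈ t.pureSizes j, ∃ b ∈ t.pureSizes j, b ≤ b₀ ∧ L ∣ a + b) {c : Fin s.num → ℤ}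
    (hc : ∀ {d : ℕ} (ψ : G →* C d), t.dim ψ j = d → ∀ i, L * s.defect i₁ i₂ ψ i = d * c i)
    (F : Finset G) {ε : ℝ} (hε : 0 < ε) :
    ∃ δ : ℝ, 0 < δ ∧ ∀ {k d d' : ℕ} (ψ : G →* C d), t.dim ψ j = d → d ≤ k → d' ≤ d → L ∣ d' →
      (d : ℝ) - d' ≤ δ * k → 1 ≤ δ * k →
      ∃ χ : G →* C d, (∀ g ∈ F, B.cost (ψ g) (χ g) ≤ ε * k) ∧
        ∀ i, L * s.defect i₁ i₂ χ i = d' * c i := by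
  classical
  have hmul : ∀ {d d' : ℕ}, d ∈ t.pureSizes j → d' ≤ d → L ∣ d' → d' ∈ t.pureSizes j := by
    rintro d d' hd hle ⟨x, rfl⟩
    rcases hL with hL | hE
    · simpa [mul_comm] using (t.pureSizes j).nsmul_mem hL x
    · rw [Nat.le_zero.1 (hle.trans (hE d hd).le)]
      exact zero_mem _
  rcases Nat.lt_or_ge 0 (t.dim (1 : G →* C 1) j) with htriv | htriv
  -- If the trivial homomorphism is pure of type `j`, all pure homomorphisms of this type have its
  -- defect, namely 0, and `ψ` need not be changed.
  · have h1 : ∀ k, t.dim (1 : G →* C k) j = k := fun k => by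
      have := t.dim_le (1 : G →* C 1) j
      rw [dim_one, show t.dim (1 : G →* C 1) j = 1 by omega, mul_one]
    have h0 : ∀ {d : ℕ} (ψ : G →* C d), t.dim ψ j = d → ∀ i, s.defect i₁ i₂ ψ i = 0 :=
      fun ψ hψ i => by
        rw [defect_eq_of_pure t s i₁ i₂ h₁ h₂ j (h1 _) hψ, defect_one]
    refine ⟨1, one_pos, fun {k d d'} ψ hψ _ hd' hLd' _ _ => ⟨ψ, fun g _ => ?_, fun i => ?_⟩⟩
    · rw [cost_self]
      positivity
    · obtain ⟨θ, hθ⟩ := hmul ⟨ψ, hψ⟩ hd' hLd'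
      rw [← hc θ hθ, h0 θ hθ, h0 ψ hψ]
  have hone : ∀ k, t.dim (1 : G →* C k) j = 0 := fun k => by
    rw [dim_one, Nat.le_zero.1 htriv, mul_zero]
  obtain ⟨c₀, hc₀, happ⟩ := hB
  obtain ⟨δ₁, hδ₁, hlip⟩ := t.lipschitz (ε / 32) (by positivity)
  set m : ℝ := min (ε / 16) (δ₁ * ε / 16) with hm
  have hmpos : 0 < m := by positivity
  have hm1 : m ≤ ε / 16 := min_le_left _ _
  have hm2 : m ≤ δ₁ * ε / 16 := min_le_right _ _
  obtain ⟨δ₃, hδ₃, hstab⟩ := B.exists_uniform_of_isStable hs (F ∪ hK.toFinset) hmpos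
  set κ : ℝ := c₀ * (2 + b₀) with hκ
  have hκpos : 0 < κ := by positivity
  -- `κ * δ * k` will bound the cost of compressing. The second condition keeps the corner of size
  -- at least `ε * k / 8`. In the third, 80 is 10 times 8: the compression is multiplicative up to
  -- `10 * κ * δ * k`, to be compared with the size of the corner.
  obtain ⟨δ, hδ, hδm, hδb, hδs⟩ : ∃ δ : ℝ, 0 < δ ∧ κ * δ ≤ m ∧ (1 + b₀) * δ ≤ ε / 8 ∧
      80 * κ * δ ≤ δ₃ * ε := by
    refine ⟨min (m / κ) (min (ε / 8 / (1 + b₀)) (δ₃ * ε / (80 * κ))), by positivity, ?_, ?_, ?_⟩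
    · rw [← le_div_iff₀' hκpos]
      exact min_le_left _ _
    · rw [← le_div_iff₀' (by positivity)]
      exact (min_le_right _ _).trans (min_le_left _ _)
    · rw [← le_div_iff₀' (by positivity)]
      exact (min_le_right _ _).trans (min_le_right _ _)
  refine ⟨δ, hδ, fun {k d d'} ψ hψ hdk hd' hLd' hcut hk => ?_⟩
  have hdk' : (d : ℝ) ≤ k := Nat.cast_le.2 hdk
  -- If `d` is at most `ε / 4 * k`, the whole homomorphism can be replaced, since costs are at most
  -- `4 * d`.
  rcases le_or_gt (d : ℝ) (ε / 4 * k) with hsmall | hlarge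
  · obtain ⟨θ, hθ⟩ := hmul ⟨ψ, hψ⟩ hd' hLd'
    refine ⟨B.pairHom (Nat.add_sub_cancel' hd') θ 1, fun g _ => ?_, fun i => ?_⟩
    · have := B.cost_le (ψ g) (B.pairHom (Nat.add_sub_cancel' hd') θ 1 g)
      linarith
    · rw [defect_pairHom, defect_one, add_zero, hc θ hθ]
  have hkpos : (0 : ℝ) < k := by
    rcases Nat.eq_zero_or_pos k with rfl | h
    · simp at hk
      linarith
    · exact_mod_cast h
  have hbδ : (b₀ : ℝ) ≤ b₀ * (δ * k) := le_mul_of_one_le_right (Nat.cast_nonneg _) hk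
  have hcut' : (d : ℝ) - d' + b₀ ≤ (1 + b₀) * δ * k := by linarith
  have hcut8 : (d : ℝ) - d' + b₀ ≤ ε / 8 * k := hcut'.trans (by gcongr)
  have hbd' : b₀ ≤ d' := by
    have : (b₀ : ℝ) ≤ d' := by linarith [mul_pos hε hkpos]
    exact_mod_cast this
  -- The corner has size `d' - b₀`: the `b₀` units held back leave room for the block that corrects
  -- the size modulo `L`.
  obtain ⟨u, rfl⟩ : ∃ u, d' = u + b₀ := ⟨d' - b₀, by omega⟩
  obtain ⟨n, rfl⟩ : ∃ n, d = u + n := ⟨d - u, by omega⟩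
  push_cast at hcut hcut' hcut8 hlarge hdk'
  have hku : ε * k ≤ 8 * u := by linarith
  have hn : c₀ * ((n : ℝ) + 1) ≤ κ * δ * k := by
    calc c₀ * ((n : ℝ) + 1) ≤ c₀ * ((2 + b₀) * δ * k) := by
          gcongr
          linarith
      _ = κ * δ * k := by rw [hκ]; ring
  choose y hy using fun g => happ (rfl : u + n = u + n) (ψ g)
  have hy' : ∀ g, B.cost (ψ g) (B.pair rfl (y g) 1) ≤ κ * δ * k := fun g => (hy g).trans hn
  have hyd : ∀ a b, B.cost (y a * y b) (y (a * b)) ≤ δ₃ * u := by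
    intro a b
    have e1 : B.cost (y a * y b) (y (a * b)) =
        B.cost (B.pair (rfl : u + n = u + n) (y a) 1 * B.pair rfl (y b) 1)
          (B.pair rfl (y (a * b)) 1) := by
      rw [← pair_mul, mul_one, cost_pair, cost_self, add_zero]
    have e2 := B.cost_mul_mul (B.pair (rfl : u + n = u + n) (y a) 1) (ψ a) (B.pair rfl (y b) 1)
      (ψ b)
    rw [← map_mul, B.cost_comm _ (ψ a), B.cost_comm _ (ψ b)] at e2
    have e3 := B.cost_triangle (B.pair (rfl : u + n = u + n) (y a) 1 * B.pair rfl (y b) 1)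
      (ψ (a * b)) (B.pair rfl (y (a * b)) 1)
    have e4 : 80 * κ * δ * k ≤ δ₃ * (8 * u) := by
      calc 80 * κ * δ * k ≤ δ₃ * ε * k := by gcongr
        _ = δ₃ * (ε * k) := by ring
        _ ≤ _ := by gcongr
    rw [e1]
    linarith [hy' a, hy' b, hy' (a * b)]
  -- The compression to the corner is almost multiplicative; stability of `G` makes it a
  -- homomorphism, controlled on `F` and on `K`. It need no longer be pure.
  obtain ⟨ψ', hψ'⟩ := hstab y hyd
  set ω : G →* C (u + n) := B.pairHom rfl ψ' 1 with hω
  have hωψ : ∀ g ∈ F ∪ hK.toFinset, B.cost (ψ g) (ω g) ≤ 4 * m * k := by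
    intro g hg
    have e1 := B.cost_triangle (ψ g) (B.pair rfl (y g) 1) (ω g)
    have e2 : B.cost (B.pair rfl (y g) 1) (ω g) ≤ m * u := by
      rw [hω, pairHom_apply, MonoidHom.one_apply, cost_pair, cost_self, add_zero]
      exact hψ' g hg
    have e3 : m * u ≤ m * k := by gcongr; linarith
    have e4 : κ * δ * k ≤ m * k := by gcongr
    linarith [hy' g]
  have hdim := hlip ψ ω (fun x hx => by
    refine (hωψ x (by simp [hx])).trans ?_
    have : δ₁ * (ε / 4 * k) ≤ δ₁ * (u + n) := by gcongr
    have : m * k ≤ δ₁ * ε / 16 * k := by gcongr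
    push_cast
    linarith) j
  rw [hψ] at hdim
  -- The trivial block has no part of type `j`, so the part of type `j` fits in the corner; the
  -- Lipschitz estimate above shows that it nearly fills `ω`.
  have hdimω : t.dim ω j ≤ u := by
    rw [hω, dim_pairHom, hone, add_zero]
    exact t.dim_le _ _
  obtain ⟨a, ha, χ, w, hωχ, hχ⟩ := t.decomp (fun i => decide (i = j)) ω
  have ha1 : a true = t.dim ω j := by
    rw [← t.sum_dim (χ true)]
    simp [hχ]
  have hpure : t.dim (χ true) j = a true := by simp [hχ, ha1]
  have ha2 : a true + a false = u + n := by rw [← ha, Fintype.sum_bool]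
  -- As `a true + b ≤ u + b₀` and both sides are divisible by `L`, the missing size `u + b₀ - a
  -- true` is `b` plus a multiple of `L`, hence a pure size.
  obtain ⟨b, hbE, hbb, hbL⟩ := hb (a true) ⟨_, hpure⟩
  have hx : L ∣ u + b₀ - (a true + b) := Nat.dvd_sub hLd' hbL
  obtain ⟨θ, hθ⟩ : u + b₀ - a true ∈ t.pureSizes j := by
    have := (t.pureSizes j).add_mem hbE (hmul ⟨ψ, hψ⟩ ((Nat.sub_le _ _).trans hd') hx)
    rwa [show b + (u + b₀ - (a true + b)) = u + b₀ - a true by omega] at this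
  have hsz : (u + b₀ - a true) + (u + n - (u + b₀)) = a false := by omega
  -- Everything in `ω` outside type `j` is replaced by `θ` and a trivial block. This complement has
  -- size at most `ε / 32 * k`, so the replacement is cheap.
  let χ' : ∀ x, G →* C (a x) := fun x => match x with
    | true => χ true
    | false => B.pairHom hsz θ 1
  refine ⟨conjHom w (B.sumHom a ha χ'), fun g hg => ?_, fun i => ?_⟩
  · have e1 := B.cost_triangle (ψ g) (ω g) (conjHom w (B.sumHom a ha χ') g)
    have e2 := hωψ g (by simp [hg])
    have e3 : B.cost (ω g) (conjHom w (B.sumHom a ha χ') g) ≤ 4 * (a false) := by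
      rw [hωχ, conjHom_apply, conjHom_apply, cost_conj, sumHom_apply, sumHom_apply, cost_sum,
        Fintype.sum_bool]
      have : B.cost (χ true g) (χ' true g) = 0 := B.cost_self _
      rw [this, zero_add]
      exact B.cost_le _ _
    have e4 : (a false : ℝ) ≤ ε / 32 * k := by
      have h1 := le_of_abs_le hdim
      have h2 : (a true : ℝ) + a false = u + n := by exact_mod_cast ha2
      rw [ha1] at h2
      push_cast at h1
      have : ε / 32 * ((u : ℝ) + n) ≤ ε / 32 * k := by gcongr
      linarith
    have e5 : m * k ≤ ε / 16 * k := by gcongr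
    linarith
  · rw [defect_conjHom, defect_sumHom, Fintype.sum_bool, mul_add]
    have e1 : L * s.defect i₁ i₂ (χ' true) i = (a true : ℕ) * c i := hc _ hpure i
    have e2 : L * s.defect i₁ i₂ (χ' false) i = (u + b₀ - a true : ℕ) * c i := by
      show L * s.defect i₁ i₂ (B.pairHom hsz θ 1) i = _
      rw [defect_pairHom, defect_one, add_zero, hc θ hθ]
    rw [e1, e2, ← add_mul, ← Nat.cast_add]
    congr 2
    omega

end Defect

end Types

end BlockFamily

/-! ### Killing the defect and correcting the stable letter. -/

namespace BlockFamily

variable {C : ℕ → Type} [∀ k, Group (C k)] {B : BlockFamily C}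

namespace Types

/-- The theory is relative to the whole group, so pure parts of equal size are conjugate as
homomorphisms of `H`; the conjugators are assembled blockwise. -/
theorem exists_conj_of_dim_eq {H : Type*} [Group H] (s : B.Types H ⊤) {k : ℕ} {ρ σ : H →* C k}
    (h : s.dim ρ = s.dim σ) : ∃ u : C k, σ = conjHom u ρ := by
  obtain ⟨a, ha, χ, w, hρ, hχ⟩ := s.decomp id ρ
  obtain ⟨a', ha', χ', w', hσ, hχ'⟩ := s.decomp id σ
  have e : a = s.dim ρ := by
    funext j
    rw [← s.sum_dim (χ j)]
    simp [hχ]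
  have e' : a' = s.dim ρ := by
    funext j
    rw [← s.sum_dim (χ' j)]
    simp [hχ', h]
  subst e
  subst e'
  choose v hv using fun j => s.conj_of_pure j (χ j) (χ' j) (by simp [hχ]) (by simp [hχ', h])
  refine ⟨w' * B.sum _ ha v * w⁻¹, MonoidHom.ext fun x => ?_⟩
  have e1 : B.sumHom _ ha χ' x = B.sum _ ha v * B.sumHom _ ha χ x * (B.sum _ ha v)⁻¹ := by
    rw [sumHom_apply, sumHom_apply, ← map_inv, ← map_mul, ← map_mul]
    congr 1
    funext j
    exact hv j x trivial
  have e2 : ρ x = w * B.sumHom _ ha χ x * w⁻¹ := DFunLike.congr_fun hρ x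
  rw [hσ, conjHom_apply, conjHom_apply, e1, e2]
  group

variable {G H : Type*} [Group G] [Group H] {K : Subgroup G}
variable (t : B.Types G K) (s : B.Types H ⊤) (i₁ i₂ : H →* G)

/-- With zero defect, some `u` conjugates `ψ.comp i₁` to `conjHom T (ψ.comp i₂)`, but it may be far
from 1. The two homomorphisms being close, `NearConj` replaces `u` by some `v` near 1, and `v⁻¹ * T`
is the corrected element. -/
theorem exists_near_conj (hnear : B.NearConj H) {ε : ℝ} (hε : 0 < ε) :
    ∃ δ : ℝ, 0 < δ ∧ ∀ {k : ℕ} (ψ : G →* C k) (T : C k), s.defect i₁ i₂ ψ = 0 →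
      (∀ h, B.cost (ψ (i₁ h)) (T * ψ (i₂ h) * T⁻¹) ≤ δ * k) →
        ∃ T' : C k, (∀ h, ψ (i₁ h) = T' * ψ (i₂ h) * T'⁻¹) ∧ B.cost T T' ≤ ε * k := by
  obtain ⟨δ, hδ, hn⟩ := hnear ε hε
  refine ⟨δ, hδ, fun {k} ψ T h0 hT => ?_⟩
  have hdim : s.dim (ψ.comp i₁) = s.dim (conjHom T (ψ.comp i₂)) := by
    rw [dim_conjHom]
    funext i
    have := congrFun h0 i
    simp only [defect, Pi.zero_apply] at this
    omega
  obtain ⟨u, hu⟩ := s.exists_conj_of_dim_eq hdim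
  obtain ⟨v, hv, hv1⟩ := hn (ψ.comp i₁) u (fun h => by
    rw [← hu]
    exact hT h)
  refine ⟨v⁻¹ * T, fun h => ?_, ?_⟩
  · have := DFunLike.congr_fun (hv.trans hu.symm) h
    simp only [conjHom_apply, MonoidHom.comp_apply] at this
    calc ψ (i₁ h) = v⁻¹ * (v * ψ (i₁ h) * v⁻¹) * v := by group
      _ = _ := by rw [this]; group
  · have := B.cost_mul_right T 1 v⁻¹
    rw [one_mul] at this
    rw [this, ← B.cost_inv, inv_one, inv_inv, B.cost_comm]
    exact hv1

-- The integer lemma is applied to the quotients `q j = a j / L j`. Forgetting the remainders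
-- perturbs the linear system by at most a constant `M`. A nonzero defect is integral, so its total
-- `S` is at least 1 and absorbs all such constants: every pure part loses at most `A * S`, a small
-- multiple of `k`.
include t in
theorem exists_defect_eq_zero (hB : B.Approximable) (hs : IsStable C B.dist G)
    (hK : (K : Set G).Finite) (h₁ : i₁.range ≤ K) (h₂ : i₂.range ≤ K)
    (F : Finset G) {ε : ℝ} (hε : 0 < ε) :
    ∃ δ : ℝ, 0 < δ ∧ ∀ {k : ℕ} (ψ : G →* C k), (∀ i, |(s.defect i₁ i₂ ψ i : ℝ)| ≤ δ * k) →
      ∃ χ : G →* C k, s.defect i₁ i₂ χ = 0 ∧ ∀ g ∈ F, B.cost (ψ g) (χ g) ≤ ε * k := by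
  choose L b₀ hLpos hL hb using fun j => exists_period (t.pureSizes j)
  choose c hc using fun j => exists_slope t s i₁ i₂ h₁ h₂ j (hL j)
  obtain ⟨D, hD⟩ := exists_solution_le c
  choose δ hδ hrep using fun j => exists_replacement t s i₁ i₂ hB hs hK h₁ h₂ j (hL j) (hb j)
    (hc j) F (show 0 < ε / (t.num + 1) by positivity)
  obtain ⟨δ₀, hδ₀, hδ₀le⟩ : ∃ δ₀ : ℝ, 0 < δ₀ ∧ ∀ j, δ₀ ≤ δ j := by
    obtain ⟨δ₀, h⟩ := (eventually_all.2 fun j => Ioc_mem_nhdsGT (hδ j)).and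
      (self_mem_nhdsWithin (a := (0 : ℝ)) (s := Set.Ioi 0)) |>.exists
    exact ⟨δ₀, h.2, fun j => (h.1 j).2⟩
  set M : ℕ := ∑ i, ∑ j, (c j i).natAbs with hM
  -- `D * (1 + M) + 1` times `S` bounds the drop from `q j` to `q' j` plus one unit for the
  -- remainder; the first factor converts quotients into sizes.
  set A : ℕ := (∑ j, L j + 1) * (D * (1 + M) + 1) with hA
  refine ⟨δ₀ / (A * (s.num + 1)), by positivity, fun {k} ψ hψ => ?_⟩
  by_cases h0 : s.defect i₁ i₂ ψ = 0
  · refine ⟨ψ, h0, fun g _ => ?_⟩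
    rw [cost_self]
    positivity
  set S : ℤ := ∑ i, |s.defect i₁ i₂ ψ i| with hS
  have hS1 : 1 ≤ S := by
    obtain ⟨i, hi⟩ := Function.ne_iff.1 h0
    have e1 : |s.defect i₁ i₂ ψ i| ≤ S :=
      Finset.single_le_sum (f := fun i => |s.defect i₁ i₂ ψ i|) (fun _ _ => abs_nonneg _)
        (Finset.mem_univ i)
    exact (Int.one_le_abs hi).trans e1
  have hSk : (A : ℝ) * S ≤ δ₀ * k := by
    have e1 : (S : ℝ) ≤ s.num * (δ₀ / (A * (s.num + 1)) * k) := by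
      rw [hS]
      push_cast
      refine (Finset.sum_le_sum fun i _ => hψ i).trans ?_
      simp
    have e2 : (s.num : ℝ) * (δ₀ / (A * (s.num + 1)) * k)
        ≤ (s.num + 1) * (δ₀ / (A * (s.num + 1)) * k) := by
      gcongr
      linarith
    have e3 : (A : ℝ) * ((s.num + 1) * (δ₀ / (A * (s.num + 1)) * k)) = δ₀ * k := by
      have : (A : ℝ) ≠ 0 := by positivity
      field_simp
    rw [← e3]
    gcongr
    exact e1.trans e2
  have hA1 : 1 ≤ A := by rw [hA]; exact Nat.succ_le_of_lt (by positivity)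
  obtain ⟨a, ha, χ, u, hψχ, hχ⟩ := t.decomp id ψ
  have hdim : ∀ j, t.dim (χ j) j = a j := fun j => by
    conv_rhs => rw [← t.sum_dim (χ j)]
    simp [hχ]
  set q : Fin t.num → ℕ := fun j => a j / L j with hq
  obtain ⟨q', hq'le, hq'0, hq'D⟩ := hD q
  have hrem : ∀ j, a j = L j * q j + a j % L j := fun j => (Nat.div_add_mod (a j) (L j)).symm
  have hmod : ∀ j, a j % L j < L j := fun j => Nat.mod_lt _ (hLpos j)
  -- `L * defect = a * c` and `a = L * q + r` with `r < L`: rounding changes the defect by at most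
  -- `|c|`.
  have hqc : ∀ j i, |(q j : ℤ) * c j i - s.defect i₁ i₂ (χ j) i| ≤ (c j i).natAbs := by
    intro j i
    have e1 := hc j (χ j) (hdim j) i
    have e2 : (L j : ℤ) * ((q j : ℤ) * c j i - s.defect i₁ i₂ (χ j) i)
        = -((a j % L j : ℕ) * c j i) := by
      rw [mul_sub, e1]
      have : (a j : ℤ) = L j * q j + (a j % L j : ℕ) := by exact_mod_cast hrem j
      rw [this]
      ring
    have e3 : (L j : ℤ) * |(q j : ℤ) * c j i - s.defect i₁ i₂ (χ j) i| ≤ L j * |c j i| := by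
      have : |(L j : ℤ) * ((q j : ℤ) * c j i - s.defect i₁ i₂ (χ j) i)|
          = (a j % L j : ℕ) * |c j i| := by
        rw [e2, abs_neg, abs_mul, Nat.abs_cast]
      rw [abs_mul, Nat.abs_cast] at this
      rw [this]
      have := hmod j
      gcongr
    rw [Int.natCast_natAbs]
    exact le_of_mul_le_mul_left e3 (by exact_mod_cast hLpos j)
  have hdef : ∀ i, ∑ j, s.defect i₁ i₂ (χ j) i = s.defect i₁ i₂ ψ i := fun i => by
    rw [hψχ, defect_conjHom, defect_sumHom]
  have hsum : ∑ i, |∑ j, (q j : ℤ) * c j i| ≤ S + M := by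
    rw [hS, hM]
    push_cast
    rw [← Finset.sum_add_distrib]
    refine Finset.sum_le_sum fun i _ => ?_
    have e1 : ∑ j, (q j : ℤ) * c j i = s.defect i₁ i₂ ψ i +
        ∑ j, ((q j : ℤ) * c j i - s.defect i₁ i₂ (χ j) i) := by
      rw [Finset.sum_sub_distrib, hdef]
      ring
    rw [e1]
    refine (abs_add_le _ _).trans (add_le_add_right ?_ _)
    refine (Finset.abs_sum_le_sum_abs _ _).trans (Finset.sum_le_sum fun j _ => ?_)
    simpa using hqc j i
  have hgap : ∀ j, (a j : ℤ) - (L j * q' j : ℕ) ≤ A * S := by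
    intro j
    have e1 : ((q j - q' j : ℕ) : ℤ) ≤ D * (S + M) := by
      have : q j - q' j ≤ ∑ j, (q j - q' j) :=
        Finset.single_le_sum (f := fun j => q j - q' j) (fun _ _ => Nat.zero_le _)
          (Finset.mem_univ j)
      calc ((q j - q' j : ℕ) : ℤ) ≤ (∑ j, (q j - q' j) : ℕ) := by exact_mod_cast this
        _ ≤ D * ∑ i, |∑ j, (q j : ℤ) * c j i| := hq'D
        _ ≤ _ := by gcongr
    rw [Nat.cast_sub (hq'le j)] at e1
    have e2 : (a j : ℤ) - (L j * q' j : ℕ) ≤ L j * ((q j : ℤ) - q' j + 1) := by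
      have h1 : (a j : ℤ) = L j * q j + (a j % L j : ℕ) := by exact_mod_cast hrem j
      have h2 : ((a j % L j : ℕ) : ℤ) ≤ L j := by exact_mod_cast (hmod j).le
      push_cast at *
      linarith
    have e3 : (S + M : ℤ) ≤ (1 + M) * S := by nlinarith [Int.natCast_nonneg M]
    have e4 : (q j : ℤ) - q' j + 1 ≤ (D * (1 + M) + 1) * S := by
      calc (q j : ℤ) - q' j + 1 ≤ D * (S + M) + S := by linarith
        _ ≤ D * ((1 + M) * S) + S := by gcongr
        _ = _ := by ring
    have e5 : (L j : ℤ) ≤ ∑ j, L j + 1 := by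
      have : L j ≤ ∑ j, L j :=
        Finset.single_le_sum (f := L) (fun _ _ => Nat.zero_le _) (Finset.mem_univ j)
      have : (L j : ℤ) ≤ (∑ j, L j : ℕ) := by exact_mod_cast this
      linarith
    calc _ ≤ (L j : ℤ) * ((q j : ℤ) - q' j + 1) := e2
      _ ≤ L j * ((D * (1 + M) + 1) * S) := by gcongr
      _ ≤ (∑ j, L j + 1) * ((D * (1 + M) + 1) * S) := by gcongr
      _ = A * S := by rw [hA]; push_cast; ring
  have hak : ∀ j, a j ≤ k := fun j =>
    (Finset.single_le_sum (fun _ _ => Nat.zero_le _) (Finset.mem_univ j)).trans ha.le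
  choose θ hθ hθ' using fun j => hrep j (d' := L j * q' j) (χ j) (hdim j) (hak j)
    ((Nat.mul_le_mul_left _ (hq'le j)).trans (Nat.mul_div_le _ _)) (dvd_mul_right _ _)
    (by
      have e1 : ((a j : ℝ) - (L j * q' j : ℕ)) ≤ A * S := by exact_mod_cast hgap j
      exact e1.trans (hSk.trans (by gcongr; exact hδ₀le j)))
    (by
      have e1 : (1 : ℝ) ≤ A * S := by
        have : (1 : ℤ) ≤ A * S := by nlinarith [(by exact_mod_cast hA1 : (1 : ℤ) ≤ A)]
        exact_mod_cast this
      exact e1.trans (hSk.trans (by gcongr; exact hδ₀le j)))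
  refine ⟨conjHom u (B.sumHom a ha θ), ?_, fun g hg => ?_⟩
  · funext i
    rw [defect_conjHom, defect_sumHom, Pi.zero_apply, ← hq'0 i]
    refine Finset.sum_congr rfl fun j _ => ?_
    have e1 := hθ' j i
    have e2 : (L j : ℤ) ≠ 0 := by exact_mod_cast (hLpos j).ne'
    apply mul_left_cancel₀ e2
    rw [e1]
    push_cast
    ring
  · rw [hψχ, conjHom_apply, conjHom_apply, cost_conj, sumHom_apply, sumHom_apply, cost_sum]
    refine (Finset.sum_le_sum fun j _ => hθ j g hg).trans ?_
    rw [Finset.sum_const, Finset.card_univ, Fintype.card_fin, nsmul_eq_mul]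
    have : (t.num : ℝ) * (ε / (t.num + 1) * k) ≤ (t.num + 1) * (ε / (t.num + 1) * k) := by
      gcongr
      linarith
    refine this.trans (le_of_eq ?_)
    field_simp

-- The approximate relation makes the dimension vectors of the two restrictions close, so the defect
-- is small and can be killed. The new homomorphism is close to the old one on `K` too, hence the
-- approximate relation survives with the same `T`, which is then moved slightly to make it exact.
include t s in
theorem exists_conjugating (hB : B.Approximable) (hs : IsStable C B.dist G)
    (hnear : B.NearConj H) [Finite H]
    (hK : (K : Set G).Finite) (h₁ : i₁.range ≤ K) (h₂ : i₂.range ≤ K)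
    (F : Finset G) {ε : ℝ} (hε : 0 < ε) :
    ∃ δ : ℝ, 0 < δ ∧ ∀ {k : ℕ} (ψ : G →* C k) (T : C k),
      (∀ h, B.cost (ψ (i₁ h)) (T * ψ (i₂ h) * T⁻¹) ≤ δ * k) →
        ∃ (χ : G →* C k) (T' : C k), (∀ h, χ (i₁ h) = T' * χ (i₂ h) * T'⁻¹) ∧
          (∀ g ∈ F, B.cost (ψ g) (χ g) ≤ ε * k) ∧ B.cost T T' ≤ ε * k := by
  classical
  have := Fintype.ofFinite H
  obtain ⟨δ₁, hδ₁, hn⟩ := s.exists_near_conj i₁ i₂ hnear hε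
  obtain ⟨δ₂, hδ₂, hz⟩ := exists_defect_eq_zero t s i₁ i₂ hB hs hK h₁ h₂ (F ∪ hK.toFinset)
    (show 0 < min ε (δ₁ / 16) by positivity)
  obtain ⟨δ₃, hδ₃, hl⟩ := s.lipschitz δ₂ hδ₂
  refine ⟨min δ₃ (δ₁ / 16), by positivity, fun {k} ψ T hT => ?_⟩
  have hT1 : ∀ h, B.cost (ψ (i₁ h)) (T * ψ (i₂ h) * T⁻¹) ≤ δ₃ * k := fun h =>
    (hT h).trans (by gcongr; exact min_le_left _ _)
  have hT2 : ∀ h, B.cost (ψ (i₁ h)) (T * ψ (i₂ h) * T⁻¹) ≤ δ₁ / 16 * k := fun h =>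
    (hT h).trans (by gcongr; exact min_le_right _ _)
  obtain ⟨χ, hχ0, hχ⟩ := hz ψ (fun i => by
    have := hl (ψ.comp i₁) (conjHom T (ψ.comp i₂)) (fun h _ => hT1 h) i
    rw [dim_conjHom] at this
    simpa [defect] using this)
  have hχ1 : ∀ x ∈ K, B.cost (ψ x) (χ x) ≤ δ₁ / 16 * k := fun x hx =>
    (hχ x (by simp [hx])).trans (by gcongr; exact min_le_right _ _)
  obtain ⟨T', hT', hTT'⟩ := hn χ T hχ0 (fun h => by
    have e1 := hχ1 _ (h₁ ⟨h, rfl⟩)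
    have e2 := hχ1 _ (h₂ ⟨h, rfl⟩)
    have e3 := B.cost_triangle (χ (i₁ h)) (ψ (i₁ h)) (T * χ (i₂ h) * T⁻¹)
    have e4 := B.cost_triangle (ψ (i₁ h)) (T * ψ (i₂ h) * T⁻¹) (T * χ (i₂ h) * T⁻¹)
    rw [cost_conj] at e4
    rw [B.cost_comm (χ (i₁ h)) (ψ (i₁ h))] at e3
    linarith [hT2 h, mul_nonneg hδ₁.le (Nat.cast_nonneg (α := ℝ) k)])
  exact ⟨χ, T', hT', fun g hg => (hχ g (by simp [hg])).trans (by gcongr; exact min_le_left _ _),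
    hTT'⟩

end Types

end BlockFamily

/-! ### From the quantitative correction to stability. -/

namespace BlockFamily

variable {C : ℕ → Type} [∀ k, Group (C k)] {B : BlockFamily C}

theorem dist_triangle {k : ℕ} (x y z : C k) :
    B.dist k x z ≤ 2 * (B.dist k x y + B.dist k y z) := by
  rw [dist, dist, dist, ← add_div, mul_div_assoc']
  exact div_le_div_of_nonneg_right (B.cost_triangle x y z) (Nat.cast_nonneg k)

theorem dist_mul_mul {k : ℕ} (x x' y y' : C k) :
    B.dist k (x * y) (x' * y') ≤ 2 * (B.dist k x x' + B.dist k y y') := by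
  rw [dist, dist, dist, ← add_div, mul_div_assoc']
  exact div_le_div_of_nonneg_right (B.cost_mul_mul x x' y y') (Nat.cast_nonneg k)

theorem dist_comm {k : ℕ} (x y : C k) : B.dist k x y = B.dist k y x := by
  rw [dist, dist, B.cost_comm]

theorem dist_mul_left {k : ℕ} (z x y : C k) : B.dist k (z * x) (z * y) = B.dist k x y := by
  rw [dist, dist, B.cost_mul_left]

theorem dist_inv {k : ℕ} (x y : C k) : B.dist k x⁻¹ y⁻¹ = B.dist k x y := by
  rw [dist, dist, B.cost_inv]

/-- Two sequences of elements are asymptotically equal. -/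
def Near (B : BlockFamily C) {k : ℕ → ℕ} (x y : ∀ n, C (k n)) : Prop :=
  Tendsto (fun n => B.dist (k n) (x n) (y n)) atTop (𝓝 0)

namespace Near

variable {k : ℕ → ℕ} {x x' y y' z : ∀ n, C (k n)}

theorem symm (h : B.Near x y) : B.Near y x := by
  unfold Near
  simp_rw [fun n => B.dist_comm (y n) (x n)]
  exact h

theorem refl (x : ∀ n, C (k n)) : B.Near x x := by
  simp [Near, dist, cost_self]

theorem trans (h : B.Near x y) (h' : B.Near y z) : B.Near x z :=
  squeeze_zero (fun _ => B.dist_nonneg _ _) (fun n => B.dist_triangle (x n) (y n) (z n))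
    (by simpa using (h.add h').const_mul 2)

theorem mul (h : B.Near x x') (h' : B.Near y y') :
    B.Near (fun n => x n * y n) (fun n => x' n * y' n) :=
  squeeze_zero (fun _ => B.dist_nonneg _ _) (fun n => B.dist_mul_mul (x n) (x' n) (y n) (y' n))
    (by simpa using (h.add h').const_mul 2)

theorem inv (h : B.Near x y) : B.Near (fun n => (x n)⁻¹) (fun n => (y n)⁻¹) := by
  unfold Near
  simp_rw [dist_inv]
  exact h

end Near

section AlmostHom

variable {Γ : Type*} [Group Γ] {k : ℕ → ℕ} {φ : ∀ n, Γ → C (k n)}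

theorem near_one (hφ : ∀ a b, B.Near (fun n => φ n a * φ n b) (fun n => φ n (a * b))) :
    B.Near (fun n => φ n 1) (fun _ => 1) := by
  have := hφ 1 1
  simp only [Near, mul_one] at this ⊢
  simpa [← B.dist_mul_left (φ _ 1) (φ _ 1) 1] using this

theorem near_inv (hφ : ∀ a b, B.Near (fun n => φ n a * φ n b) (fun n => φ n (a * b))) (a : Γ) :
    B.Near (fun n => φ n a⁻¹) (fun n => (φ n a)⁻¹) := by
  have h := hφ a a⁻¹
  rw [mul_inv_cancel] at h
  have h1 := (Near.refl (fun n => (φ n a)⁻¹)).mul (h.trans (near_one hφ))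
  simpa using h1

/-- The set of elements where an asymptotic homomorphism is close to a sequence of homomorphisms
is a subgroup. -/
def nearSubgroup (hφ : ∀ a b, B.Near (fun n => φ n a * φ n b) (fun n => φ n (a * b)))
    (ψ : ∀ n, Γ →* C (k n)) : Subgroup Γ where
  carrier := {a | B.Near (fun n => φ n a) (fun n => ψ n a)}
  one_mem' := by simpa using near_one hφ
  mul_mem' := by
    intro a b ha hb
    have := (hφ a b).symm.trans (ha.mul hb)
    simpa using this
  inv_mem' := by
    intro a ha
    have := (near_inv hφ a).trans ha.inv
    simpa using this

end AlmostHom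

/-- One can minimise asymptotically a sequence of functions which are bounded below. -/
theorem exists_seq_tendsto_zero {X : ℕ → Type*} [∀ n, Nonempty (X n)] (v : ∀ n, X n → ℝ)
    (h0 : ∀ n x, 0 ≤ v n x) (h : ∀ ε : ℝ, 0 < ε → ∀ᶠ n in atTop, ∃ x, v n x ≤ ε) :
    ∃ x : ∀ n, X n, Tendsto (fun n => v n (x n)) atTop (𝓝 0) := by
  have hlt : ∀ n, ⨅ x, v n x < (⨅ x, v n x) + 1 / ((n : ℝ) + 1) := fun n => by
    have : (0 : ℝ) < 1 / ((n : ℝ) + 1) := by positivity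
    linarith
  -- A near-minimiser with slack 1/(n+1) is chosen for each `n`, which avoids a diagonal argument
  -- over ε.
  choose x hx using fun n => exists_lt_of_ciInf_lt (hlt n)
  have hinf : Tendsto (fun n => ⨅ x, v n x) atTop (𝓝 0) := by
    refine tendsto_order.2 ⟨fun a ha => Eventually.of_forall fun n => ha.trans_le
      (le_ciInf (h0 n)), fun a ha => (h (a / 2) (by positivity)).mono ?_⟩
    rintro n ⟨y, hy⟩
    have : ⨅ x, v n x ≤ v n y := ciInf_le ⟨0, by rintro _ ⟨y, rfl⟩; exact h0 n y⟩ y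
    linarith
  refine ⟨x, squeeze_zero (fun n => h0 n _) (fun n => (hx n).le) ?_⟩
  simpa using hinf.add tendsto_one_div_add_atTop_nhds_zero_nat

theorem isStable_hnnOfInclusions (hB : B.Approximable) {G H : Type*} [Group G] [Group.FG G]
    [Group H] [Finite H] (i₁ i₂ : H →* G) (h₁ : Function.Injective i₁)
    (h₂ : Function.Injective i₂) {K : Subgroup G} (hK : (K : Set G).Finite)
    (hK₁ : i₁.range ≤ K) (hK₂ : i₂.range ≤ K) (t : B.Types G K) (s : B.Types H ⊤)
    (hnear : B.NearConj H) (hs : IsStable C B.dist G) :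
    IsStable C B.dist (HNNOfInclusions i₁ i₂ h₁ h₂) := by
  intro k φ hφ
  obtain ⟨F, hF⟩ := Group.fg_def.1 (inferInstance : Group.FG G)
  let ofG : G →* HNNOfInclusions i₁ i₂ h₁ h₂ := HNNExtension.of
  let τ : HNNOfInclusions i₁ i₂ h₁ h₂ := HNNExtension.t
  obtain ⟨ψ, hψ⟩ := hs k (fun n g => φ n (ofG g)) (fun a b => by
    simpa using hφ (ofG a) (ofG b))
  have hψ' : ∀ g, B.Near (fun n => φ n (ofG g)) (fun n => ψ n g) := hψ
  have hφ' : ∀ a b, B.Near (fun n => φ n a * φ n b) (fun n => φ n (a * b)) := hφ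
  have hrel : ∀ h, τ * ofG (i₂ h) * τ⁻¹ = ofG (i₁ h) := by
    intro h
    have := HNNExtension.t_mul_of (φ := (MonoidHom.ofInjective h₂).symm.trans
      (MonoidHom.ofInjective h₁)) (MonoidHom.ofInjective h₂ h)
    have e : τ * ofG (i₂ h) = ofG (i₁ h) * τ := by
      simpa [MonoidHom.ofInjective_apply] using this
    rw [e, mul_inv_cancel_right]
  have hT : ∀ h, B.Near (fun n => ψ n (i₁ h)) (fun n => φ n τ * ψ n (i₂ h) * (φ n τ)⁻¹) := by
    intro h
    have e1 := (hφ' (τ * ofG (i₂ h)) τ⁻¹).symm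
    rw [hrel] at e1
    refine (hψ' (i₁ h)).symm.trans (e1.trans (Near.mul ?_ (near_inv hφ' τ)))
    exact (hφ' _ _).symm.trans ((Near.refl _).mul (hψ' (i₂ h)))
  -- `X n` encodes the homomorphisms of the HNN extension as pairs; `v` measures their distance to
  -- the data on the generators of `G` and on the stable letter.
  let X : ℕ → Type _ := fun n => {p : (G →* C (k n)) × C (k n) //
    ∀ h, p.1 (i₁ h) = p.2 * p.1 (i₂ h) * p.2⁻¹}
  have : ∀ n, Nonempty (X n) := fun n => ⟨⟨(1, 1), by simp⟩⟩
  let v : ∀ n, X n → ℝ := fun n p =>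
    ∑ g ∈ F, B.dist (k n) (ψ n g) (p.1.1 g) + B.dist (k n) (φ n τ) p.1.2
  have hterm : ∀ n (p : X n), ∀ g, 0 ≤ B.dist (k n) (ψ n g) (p.1.1 g) :=
    fun n p g => B.dist_nonneg _ _
  have hsum : ∀ n (p : X n), 0 ≤ ∑ g ∈ F, B.dist (k n) (ψ n g) (p.1.1 g) :=
    fun n p => Finset.sum_nonneg fun g _ => hterm n p g
  obtain ⟨p, hp⟩ := exists_seq_tendsto_zero v
    (fun n p => add_nonneg (hsum n p) (B.dist_nonneg _ _)) (fun ε hε => by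
      obtain ⟨δ, hδ, hcon⟩ := Types.exists_conjugating t s i₁ i₂ hB hs hnear hK hK₁ hK₂ F
        (show 0 < ε / (F.card + 1) by positivity)
      have hev : ∀ᶠ n in atTop, ∀ h, B.dist (k n) (ψ n (i₁ h))
          (φ n τ * ψ n (i₂ h) * (φ n τ)⁻¹) < δ :=
        eventually_all.2 fun h => (hT h).eventually_lt_const hδ
      filter_upwards [hev] with n hn
      obtain ⟨χ, T', h1, h2, h3⟩ := hcon (ψ n) (φ n τ) fun h =>
        (B.dist_le_iff _ _ hδ.le).1 (hn h).le
      refine ⟨⟨(χ, T'), h1⟩, ?_⟩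
      have e1 : ∑ g ∈ F, B.dist (k n) (ψ n g) (χ g) ≤ F.card * (ε / (F.card + 1)) := by
        rw [← nsmul_eq_mul]
        exact Finset.sum_le_card_nsmul _ _ _ fun g hg =>
          (B.dist_le_iff _ _ (by positivity)).2 (h2 g hg)
      have e2 : B.dist (k n) (φ n τ) T' ≤ ε / (F.card + 1) :=
        (B.dist_le_iff _ _ (by positivity)).2 h3
      have e3 : F.card * (ε / (F.card + 1)) + ε / (F.card + 1) = ε := by
        have : (F.card : ℝ) + 1 ≠ 0 := by positivity
        field_simp
      show ∑ g ∈ F, B.dist (k n) (ψ n g) (χ g) + B.dist (k n) (φ n τ) T' ≤ ε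
      linarith)
  have hpg : ∀ g ∈ F, B.Near (fun n => ψ n g) (fun n => (p n).1.1 g) := fun g hg =>
    squeeze_zero (fun n => B.dist_nonneg _ _) (fun n =>
      (Finset.single_le_sum (fun g _ => hterm n (p n) g) hg).trans
        (le_add_of_nonneg_right (B.dist_nonneg _ _))) hp
  have hpt : B.Near (fun n => φ n τ) (fun n => (p n).1.2) :=
    squeeze_zero (fun n => B.dist_nonneg _ _) (fun n =>
      le_add_of_nonneg_left (hsum n (p n))) hp
  let Ψ : ∀ n, HNNOfInclusions i₁ i₂ h₁ h₂ →* C (k n) := fun n =>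
    HNNExtension.lift (p n).1.1 (p n).1.2 (by
      rintro ⟨_, h, rfl⟩
      have e : (MonoidHom.ofInjective h₂).symm ⟨i₂ h, h, rfl⟩ = h :=
        (MonoidHom.ofInjective h₂).symm_apply_eq.2 (Subtype.ext rfl)
      simp [e, (p n).2 h, MonoidHom.ofInjective_apply])
  refine ⟨Ψ, ?_⟩
  -- The elements where `φ` and `Ψ` are asymptotically close form a subgroup, so generators suffice.
  have hmem : ∀ a, a ∈ nearSubgroup hφ' Ψ := by
    have hG : ∀ g, ofG g ∈ nearSubgroup hφ' Ψ := by
      intro g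
      have hle : Subgroup.closure (F : Set G) ≤ (nearSubgroup hφ' Ψ).comap ofG := by
        rw [Subgroup.closure_le]
        intro g hg
        show B.Near (fun n => φ n (ofG g)) (fun n => Ψ n (ofG g))
        simpa [Ψ, ofG] using (hψ' g).trans (hpg g hg)
      exact hle (by rw [hF]; trivial)
    have ht : τ ∈ nearSubgroup hφ' Ψ := by
      show B.Near (fun n => φ n τ) (fun n => Ψ n τ)
      simpa [Ψ, τ] using hpt
    intro a
    induction a using HNNExtension.induction_on with
    | of g => exact hG g
    | t => exact ht
    | mul x y hx hy => exact mul_mem hx hy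
    | inv x hx => exact inv_mem hx
  exact hmem

end BlockFamily

/-! ### The symmetric groups as a block family. -/

/-- The blocks of sizes `a j` fill an interval of length `∑ j, a j`. -/
noncomputable def blockEquiv {J : Type} [Fintype J] (a : J → ℕ) {k : ℕ} (h : ∑ j, a j = k) :
    (Σ j, Fin (a j)) ≃ Fin k :=
  Fintype.equivFinOfCardEq (by simp [h])

/-- The number of points where two permutations differ. -/
noncomputable def permCost {k : ℕ} (σ τ : Equiv.Perm (Fin k)) : ℝ :=
  ∑ x, if σ x = τ x then 0 else 1

/-- The permutation family of groups with block sums. -/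
noncomputable def permFamily : BlockFamily (fun k => Equiv.Perm (Fin k)) where
  cost := permCost
  cost_nonneg σ τ := Finset.sum_nonneg fun x _ => by positivity
  cost_self σ := by simp [permCost]
  cost_comm σ τ := by simp only [permCost, eq_comm]
  cost_triangle σ τ υ := by
    simp only [permCost]
    rw [← Finset.sum_add_distrib, Finset.mul_sum]
    refine Finset.sum_le_sum fun x _ => ?_
    by_cases h1 : σ x = τ x <;> by_cases h2 : τ x = υ x <;> by_cases h3 : σ x = υ x <;>
      (simp_all; try norm_num)
  cost_mul_left υ σ τ := by simp [permCost]
  cost_mul_right υ σ τ := by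
    simp only [permCost, Equiv.Perm.mul_apply]
    exact Equiv.sum_comp υ (fun x => if σ x = τ x then (0 : ℝ) else 1)
  cost_le {k} σ τ := by
    calc permCost σ τ ≤ ∑ _x : Fin k, (1 : ℝ) :=
          Finset.sum_le_sum fun x _ => by split_ifs <;> norm_num
      _ = k := by simp
      _ ≤ 4 * k := by linarith [Nat.cast_nonneg (α := ℝ) k]
  sum {_} _ a {_} h := ((blockEquiv a h).permCongrHom.toMonoidHom).comp
    (Equiv.Perm.sigmaCongrRightHom fun j => Fin (a j))
  cost_sum {_} _ a {_} h x y := by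
    simp only [permCost]
    rw [← Equiv.sum_comp (blockEquiv a h), Fintype.sum_sigma]
    refine Finset.sum_congr rfl fun j _ => Finset.sum_congr rfl fun z _ => ?_
    simp [Equiv.permCongrHom, Equiv.permCongr_apply]

namespace permFamily

open BlockFamily

theorem sum_apply {J : Type} [Fintype J] (a : J → ℕ) {k : ℕ} (h : ∑ j, a j = k)
    (σ : ∀ j, Equiv.Perm (Fin (a j))) (j : J) (x : Fin (a j)) :
    permFamily.sum a h σ (blockEquiv a h ⟨j, x⟩) = blockEquiv a h ⟨j, σ j x⟩ := by
  simp [permFamily, Equiv.permCongrHom, Equiv.permCongr_apply]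

theorem cost_def {k : ℕ} (σ τ : Equiv.Perm (Fin k)) :
    permFamily.cost σ τ = ∑ x, if σ x = τ x then (0 : ℝ) else 1 := rfl

theorem dist_eq (k : ℕ) (σ τ : Equiv.Perm (Fin k)) : permFamily.dist k σ τ = permDist k σ τ := by
  rw [BlockFamily.dist, permDist, cost_def, hammingDist]
  simp [Finset.sum_ite]

/-- The points of the first block that `σ` keeps in it define a partial injection, which extends to
a permutation of that block. Errors occur only at points sent into the second block, at most `n`,
and at the `n` points of the second block. -/
theorem approximable : permFamily.Approximable := by
  classical
  refine ⟨2, two_pos, fun {m n k} h σ => ?_⟩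
  set e := blockEquiv (pairSize m n) (sum_pairSize h) with he
  let p : Fin m → Prop := fun i => ∃ i' : Fin m, σ (e ⟨true, i⟩) = e ⟨true, i'⟩
  let q : Fin m → Prop := fun i' => ∃ i : Fin m, σ (e ⟨true, i⟩) = e ⟨true, i'⟩
  choose f hf using fun i : {i // p i} => i.2
  have hinj : ∀ {i i' : Fin m}, e ⟨true, i⟩ = e ⟨true, i'⟩ → i = i' := fun h =>
    eq_of_heq (Sigma.mk.inj_iff.1 (e.injective h)).2
  have hbij : Function.Bijective (fun i : {i // p i} => (⟨f i, ⟨i, hf i⟩⟩ : {i // q i})) := by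
    refine ⟨fun i i' hii => ?_, fun ⟨i', i, hi⟩ => ⟨⟨i, i', hi⟩, ?_⟩⟩
    · have h1 : f i = f i' := congrArg Subtype.val hii
      have h2 := (hf i).trans ((congrArg (fun z => e ⟨true, z⟩) h1).trans (hf i').symm)
      exact Subtype.ext (hinj (σ.injective h2))
    · exact Subtype.ext (hinj ((hf ⟨i, i', hi⟩).symm.trans hi))
  refine ⟨(Equiv.ofBijective _ hbij).extendSubtype, ?_⟩
  rw [cost_def, ← Equiv.sum_comp e, Fintype.sum_sigma, Fintype.sum_bool]
  have h1 : ∑ i : Fin (pairSize m n true),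
      (if σ (e ⟨true, i⟩) = permFamily.pair h (Equiv.ofBijective _ hbij).extendSubtype 1
        (e ⟨true, i⟩) then (0 : ℝ) else 1) ≤ n := by
    calc _ ≤ ∑ i : Fin (pairSize m n true), if (e.symm (σ (e ⟨true, i⟩))).1 then (0 : ℝ) else 1 := by
          refine Finset.sum_le_sum fun i _ => ?_
          by_cases hi : (e.symm (σ (e ⟨true, i⟩))).1
          · have hpi : p i := by
              obtain ⟨⟨b, i'⟩, hz⟩ := e.surjective (σ (e ⟨true, i⟩))
              rw [← hz] at hi
              simp only [Equiv.symm_apply_apply] at hi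
              subst hi
              exact ⟨i', hz.symm⟩
            have : σ (e ⟨true, i⟩) = permFamily.pair h (Equiv.ofBijective _ hbij).extendSubtype 1
                (e ⟨true, i⟩) := by
              have e1 := sum_apply (pairSize m n) (sum_pairSize h)
                (pairFun (D := fun k => Equiv.Perm (Fin k))
                  (Equiv.ofBijective _ hbij).extendSubtype 1) true i
              have e2 := (Equiv.ofBijective _ hbij).extendSubtype_apply_of_mem i hpi
              exact (hf ⟨i, hpi⟩).trans ((congrArg (fun z => e ⟨true, z⟩) e2.symm).trans e1.symm)
            rw [if_pos this, if_pos hi]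
          · rw [if_neg hi]
            split_ifs <;> norm_num
      _ ≤ ∑ z : Σ b, Fin (pairSize m n b), if (e.symm (σ (e z))).1 then (0 : ℝ) else 1 := by
          rw [Fintype.sum_sigma, Fintype.sum_bool]
          exact le_add_of_nonneg_right (Finset.sum_nonneg fun _ _ => by positivity)
      _ = ∑ z : Σ b, Fin (pairSize m n b), if z.1 then (0 : ℝ) else 1 :=
          Equiv.sum_comp ((e.trans σ).trans e.symm) (fun z => if z.1 then (0 : ℝ) else 1)
      _ = n := by
          rw [Fintype.sum_sigma, Fintype.sum_bool]
          simp only [if_true, Bool.false_eq_true, if_false, Finset.sum_const_zero, zero_add,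
            Finset.sum_const, Finset.card_univ, Fintype.card_fin, nsmul_one]
          rfl
  have h2 : ∑ i : Fin (pairSize m n false),
      (if σ (e ⟨false, i⟩) = permFamily.pair h (Equiv.ofBijective _ hbij).extendSubtype 1
        (e ⟨false, i⟩) then (0 : ℝ) else 1) ≤ n := by
    calc _ ≤ ∑ _i : Fin (pairSize m n false), (1 : ℝ) :=
          Finset.sum_le_sum fun _ _ => by split_ifs <;> norm_num
      _ = n := by
          rw [Finset.sum_const, Finset.card_univ, Fintype.card_fin, nsmul_one]
          rfl
  linarith

end permFamily

/-! ### Finite actions with equal stabilizer counts. -/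

section StabilizerCount

variable {K X : Type*} [Group K]

/-- The stabilizer of a point under an action given by permutations. -/
def pointStabilizer (ρ : K →* Equiv.Perm X) (x : X) : Subgroup K :=
  (MulAction.stabilizer (Equiv.Perm X) x).comap ρ

theorem mem_pointStabilizer {ρ : K →* Equiv.Perm X} {x : X} {g : K} :
    g ∈ pointStabilizer ρ x ↔ ρ g x = x := Iff.rfl

theorem pointStabilizer_map {Y : Type*} {ρ : K →* Equiv.Perm X} {σ : K →* Equiv.Perm Y}
    {A : Set X} {f : X → Y} (hf : Set.InjOn f A) (hA : ∀ g, ∀ x ∈ A, ρ g x ∈ A)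
    (hfe : ∀ g, ∀ x ∈ A, f (ρ g x) = σ g (f x)) {x : X} (hx : x ∈ A) :
    pointStabilizer σ (f x) = pointStabilizer ρ x := by
  ext g
  rw [mem_pointStabilizer, mem_pointStabilizer, ← hfe g x hx]
  exact ⟨fun h => hf (hA g x hx) hx h, fun h => by rw [h]⟩

variable [Fintype X]

-- Orbits are matched one at a time: a point `x` of `A` has a partner `y` in `B` with the same
-- stabilizer, their orbits are isomorphic, and removing both preserves the equality of counts.
open Classical in
theorem exists_equivariant_bijOn (ρ σ : K →* Equiv.Perm X) (A B : Finset X)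
    (hA : ∀ g, ∀ x ∈ A, ρ g x ∈ A) (hB : ∀ g, ∀ x ∈ B, σ g x ∈ B)
    (hcard : ∀ S, (A.filter fun x => pointStabilizer ρ x = S).card =
      (B.filter fun x => pointStabilizer σ x = S).card) :
    ∃ f : X → X, Set.BijOn f A B ∧ ∀ g, ∀ x ∈ A, f (ρ g x) = σ g (f x) := by
  induction hn : A.card using Nat.strong_induction_on generalizing A B with
  | _ n ih =>
    rcases A.eq_empty_or_nonempty with rfl | ⟨x, hx⟩
    · have hB0 : B = ∅ := by
        refine Finset.eq_empty_of_forall_notMem fun y hy => ?_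
        have := hcard (pointStabilizer σ y)
        simp only [Finset.filter_empty, Finset.card_empty] at this
        have h0 := Finset.card_eq_zero.1 this.symm
        exact Finset.notMem_empty y (h0 ▸ Finset.mem_filter.2 ⟨hy, rfl⟩)
      subst hB0
      exact ⟨id, by simp, by simp⟩
    obtain ⟨y, hy⟩ : (B.filter fun y => pointStabilizer σ y = pointStabilizer ρ x).Nonempty := by
      rw [← Finset.card_pos, ← hcard, Finset.card_pos]
      exact ⟨x, Finset.mem_filter.2 ⟨hx, rfl⟩⟩
    obtain ⟨hyB, hyx⟩ := Finset.mem_filter.1 hy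
    set P : Finset X := Finset.univ.filter fun z => ∃ g, ρ g x = z with hP
    set Q : Finset X := Finset.univ.filter fun z => ∃ g, σ g y = z with hQ
    have hPA : P ⊆ A := by
      intro z hz
      obtain ⟨g, rfl⟩ := (Finset.mem_filter.1 hz).2
      exact hA g x hx
    have hQB : Q ⊆ B := by
      intro z hz
      obtain ⟨g, rfl⟩ := (Finset.mem_filter.1 hz).2
      exact hB g y hyB
    have hPinv : ∀ g, ∀ z, ρ g z ∈ P ↔ z ∈ P := by
      intro g z
      simp only [hP, Finset.mem_filter, Finset.mem_univ, true_and]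
      refine ⟨fun ⟨g', h⟩ => ⟨g⁻¹ * g', ?_⟩, fun ⟨g', h⟩ => ⟨g * g', ?_⟩⟩
      · rw [map_mul, Equiv.Perm.mul_apply, h, ← Equiv.Perm.mul_apply, ← map_mul]
        simp
      · rw [map_mul, Equiv.Perm.mul_apply, h]
    have hQinv : ∀ g, ∀ z, σ g z ∈ Q ↔ z ∈ Q := by
      intro g z
      simp only [hQ, Finset.mem_filter, Finset.mem_univ, true_and]
      refine ⟨fun ⟨g', h⟩ => ⟨g⁻¹ * g', ?_⟩, fun ⟨g', h⟩ => ⟨g * g', ?_⟩⟩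
      · rw [map_mul, Equiv.Perm.mul_apply, h, ← Equiv.Perm.mul_apply, ← map_mul]
        simp
      · rw [map_mul, Equiv.Perm.mul_apply, h]
    -- Equality of the stabilizers makes `ρ g x ↦ σ g y` well defined and injective.
    have hxy : ∀ g g', ρ g x = ρ g' x ↔ σ g y = σ g' y := by
      intro g g'
      have e1 : ∀ (τ : K →* Equiv.Perm X) (z : X), τ g z = τ g' z ↔
          g'⁻¹ * g ∈ pointStabilizer τ z := by
        intro τ z
        rw [mem_pointStabilizer, map_mul, map_inv, Equiv.Perm.mul_apply, Equiv.Perm.inv_eq_iff_eq,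
          eq_comm]
      rw [e1, e1, hyx]
    have hmemP : ∀ g, ρ g x ∈ P := fun g => by simp [hP]
    let φ : X → X := fun z => if h : ∃ g, ρ g x = z then σ h.choose y else z
    have hφ : ∀ g, φ (ρ g x) = σ g y := by
      intro g
      have h : ∃ g', ρ g' x = ρ g x := ⟨g, rfl⟩
      simp only [φ, dif_pos h]
      exact (hxy _ _).1 h.choose_spec
    have hφe : ∀ g, ∀ z ∈ P, φ (ρ g z) = σ g (φ z) := by
      intro g z hz
      obtain ⟨g', rfl⟩ := (Finset.mem_filter.1 hz).2
      rw [← Equiv.Perm.mul_apply, ← map_mul, hφ, hφ, map_mul, Equiv.Perm.mul_apply]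
    have hφP : Set.BijOn φ P Q := by
      refine ⟨fun z hz => ?_, fun z hz z' hz' h => ?_, fun z hz => ?_⟩
      · obtain ⟨g, rfl⟩ := (Finset.mem_filter.1 hz).2
        simp [hφ, hQ]
      · obtain ⟨g, rfl⟩ := (Finset.mem_filter.1 hz).2
        obtain ⟨g', rfl⟩ := (Finset.mem_filter.1 hz').2
        rw [hφ, hφ] at h
        exact (hxy _ _).2 h
      · obtain ⟨g, rfl⟩ := (Finset.mem_filter.1 hz).2
        exact ⟨ρ g x, hmemP g, hφ g⟩
    have hPQ : ∀ S, (P.filter fun x => pointStabilizer ρ x = S).card =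
        (Q.filter fun x => pointStabilizer σ x = S).card := by
      intro S
      have hst : ∀ z ∈ P, pointStabilizer σ (φ z) = pointStabilizer ρ z := fun z hz =>
        pointStabilizer_map hφP.injOn (fun g z hz => (hPinv g z).2 hz) hφe hz
      refine Finset.card_nbij φ ?_ ?_ ?_
      · intro z hz
        obtain ⟨h1, h2⟩ := Finset.mem_filter.1 hz
        exact Finset.mem_filter.2 ⟨hφP.mapsTo h1, (hst z h1).trans h2⟩
      · exact hφP.injOn.mono fun z hz => (Finset.mem_filter.1 hz).1
      · intro z hz
        obtain ⟨h1, h2⟩ := Finset.mem_filter.1 hz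
        obtain ⟨w, hw, rfl⟩ := hφP.surjOn h1
        exact ⟨w, Finset.mem_coe.2 (Finset.mem_filter.2 ⟨hw, (hst w hw).symm.trans h2⟩), rfl⟩
    have hsplit : ∀ (τ : K →* Equiv.Perm X) (A P : Finset X) (S : Subgroup K), P ⊆ A →
        ((A \ P).filter fun x => pointStabilizer τ x = S).card =
          (A.filter fun x => pointStabilizer τ x = S).card -
            (P.filter fun x => pointStabilizer τ x = S).card := by
      intro τ A P S h
      rw [← Finset.card_sdiff_of_subset (Finset.filter_subset_filter _ h)]
      congr 1
      ext z
      simp only [Finset.mem_filter, Finset.mem_sdiff]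
      tauto
    obtain ⟨f, hf, hfe⟩ := ih (A \ P).card (by
        rw [← hn]
        refine Finset.card_lt_card (Finset.sdiff_ssubset hPA ⟨x, ?_⟩)
        simpa using hmemP 1) (A \ P) (B \ Q)
      (fun g z hz => by
        obtain ⟨h1, h2⟩ := Finset.mem_sdiff.1 hz
        exact Finset.mem_sdiff.2 ⟨hA g z h1, fun h => h2 ((hPinv g z).1 h)⟩)
      (fun g z hz => by
        obtain ⟨h1, h2⟩ := Finset.mem_sdiff.1 hz
        exact Finset.mem_sdiff.2 ⟨hB g z h1, fun h => h2 ((hQinv g z).1 h)⟩)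
      (fun S => by rw [hsplit _ _ _ _ hPA, hsplit _ _ _ _ hQB, hcard, hPQ]) rfl
    refine ⟨fun z => if z ∈ P then φ z else f z, ?_, fun g z hz => ?_⟩
    · refine ⟨fun z hz => ?_, fun z hz z' hz' h => ?_, fun z hz => ?_⟩
      · by_cases hzP : z ∈ P
        · simp only [hzP, if_true]
          exact hQB (hφP.mapsTo hzP)
        · simp only [hzP, if_false]
          exact (Finset.mem_sdiff.1 (hf.mapsTo (Finset.mem_sdiff.2 ⟨hz, hzP⟩))).1
      · by_cases hzP : z ∈ P <;> by_cases hzP' : z' ∈ P <;>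
          simp only [hzP, hzP', if_true, if_false] at h
        · exact hφP.injOn hzP hzP' h
        · have h1 := (Finset.mem_sdiff.1 (hf.mapsTo (Finset.mem_sdiff.2 ⟨hz', hzP'⟩))).2
          exact absurd (h ▸ hφP.mapsTo hzP) h1
        · have h1 := (Finset.mem_sdiff.1 (hf.mapsTo (Finset.mem_sdiff.2 ⟨hz, hzP⟩))).2
          exact absurd (h ▸ hφP.mapsTo hzP') h1
        · exact hf.injOn (Finset.mem_sdiff.2 ⟨hz, hzP⟩) (Finset.mem_sdiff.2 ⟨hz', hzP'⟩) h
      · by_cases hzQ : z ∈ Q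
        · obtain ⟨w, hw, rfl⟩ := hφP.surjOn hzQ
          have hw' : w ∈ P := hw
          exact ⟨w, hPA hw, by simp only [hw', if_true]⟩
        · obtain ⟨w, hw, rfl⟩ := hf.surjOn (Finset.mem_sdiff.2 ⟨hz, hzQ⟩)
          obtain ⟨h1, h2⟩ := Finset.mem_sdiff.1 hw
          exact ⟨w, h1, by simp only [h2, if_false]⟩
    · by_cases hzP : z ∈ P
      · simp only [(hPinv g z).2 hzP, hzP, if_true]
        exact hφe g z hzP
      · have h1 : ρ g z ∉ P := fun h => hzP ((hPinv g z).1 h)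
        simp only [h1, hzP, if_false]
        exact hfe g z (Finset.mem_sdiff.2 ⟨hz, hzP⟩)

end StabilizerCount

/-! ### Types of actions relative to a finite normal subgroup. -/

namespace permFamily

open BlockFamily

section Class

variable {G : Type*} [Group G] {K : Subgroup G} [K.Normal]

/-- The conjugates of a subgroup of a normal subgroup. -/
def conjClass (S : Subgroup K) : Set (Subgroup K) :=
  {S' | ∃ g : G, S' = S.map (MulAut.conjNormal g : K ≃* K).toMonoidHom}

theorem map_conjNormal_mul (S : Subgroup K) (g h : G) :
    (S.map (MulAut.conjNormal h : K ≃* K).toMonoidHom).map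
      (MulAut.conjNormal g : K ≃* K).toMonoidHom =
        S.map (MulAut.conjNormal (g * h) : K ≃* K).toMonoidHom := by
  rw [Subgroup.map_map, map_mul]
  rfl

theorem map_conjNormal_one (S : Subgroup K) :
    S.map (MulAut.conjNormal (1 : G) : K ≃* K).toMonoidHom = S := by
  rw [map_one]
  exact Subgroup.map_id S

theorem self_mem_conjClass (S : Subgroup K) : S ∈ conjClass S := ⟨1, (map_conjNormal_one S).symm⟩

theorem conjClass_map (S : Subgroup K) (g : G) :
    conjClass (S.map (MulAut.conjNormal g : K ≃* K).toMonoidHom) = conjClass S := by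
  ext S'
  refine ⟨fun ⟨h, hS⟩ => ⟨h * g, by rw [hS, map_conjNormal_mul]⟩,
    fun ⟨h, hS⟩ => ⟨h * g⁻¹, by rw [hS, map_conjNormal_mul, inv_mul_cancel_right]⟩⟩

variable {X : Type*}

/-- Moving a point by `g` conjugates its stabilizer in `K` by `g`. Hence only the `G`-conjugacy
class of the stabilizer is constant on `G`-orbits, and this class serves as the type. -/
theorem pointStabilizer_apply (ψ : G →* Equiv.Perm X) (g : G) (x : X) :
    pointStabilizer (ψ.comp K.subtype) (ψ g x) =
      (pointStabilizer (ψ.comp K.subtype) x).map (MulAut.conjNormal g : K ≃* K).toMonoidHom := by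
  ext y
  rw [mem_pointStabilizer]
  refine ⟨fun h => ?_, ?_⟩
  · refine ⟨MulAut.conjNormal g⁻¹ y, ?_, ?_⟩
    · show ψ ((MulAut.conjNormal g⁻¹ y : K) : G) x = x
      rw [MulAut.conjNormal_apply, inv_inv, map_mul, map_mul, Equiv.Perm.mul_apply,
        Equiv.Perm.mul_apply, map_inv, Equiv.Perm.inv_eq_iff_eq]
      exact h
    · ext
      simp
  · rintro ⟨z, hz, rfl⟩
    have hz' : ψ (z : G) x = x := hz
    show ψ ((MulAut.conjNormal g z : K) : G) (ψ g x) = ψ g x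
    rw [MulAut.conjNormal_apply, map_mul, map_mul, Equiv.Perm.mul_apply, Equiv.Perm.mul_apply,
      ← Equiv.Perm.mul_apply (ψ g⁻¹), ← map_mul, inv_mul_cancel, map_one, Equiv.Perm.one_apply,
      hz']

/-- The type of a point is the conjugacy class of its stabilizer. -/
def pointType (K : Subgroup G) [K.Normal] (ψ : G →* Equiv.Perm X) (x : X) : Set (Subgroup K) :=
  conjClass (pointStabilizer (ψ.comp K.subtype) x)

theorem pointType_apply (ψ : G →* Equiv.Perm X) (g : G) (x : X) :
    pointType K ψ (ψ g x) = pointType K ψ x := by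
  rw [pointType, pointStabilizer_apply, conjClass_map, pointType]

theorem pointType_map {Y : Type*} {ψ : G →* Equiv.Perm X} {χ : G →* Equiv.Perm Y} {f : X → Y}
    (hf : Function.Injective f) (hfe : ∀ g x, f (ψ g x) = χ g (f x)) (x : X) :
    pointType K χ (f x) = pointType K ψ x := by
  rw [pointType, pointType]
  congr 1
  exact pointStabilizer_map (A := Set.univ) (ρ := ψ.comp K.subtype) (σ := χ.comp K.subtype)
    hf.injOn (fun _ _ _ => trivial)
    (fun g x _ => hfe g x) trivial

-- `G` permutes the stabilizers in the class `T` transitively, so the points are equidistributed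
-- over the members of `T`.
open Classical in
theorem card_filter_mul [Fintype X] [Finite K] (ψ : G →* Equiv.Perm X) {T : Set (Subgroup K)}
    (hψ : ∀ x, pointType K ψ x = T) {S : Subgroup K} (hS : S ∈ T) :
    (Finset.univ.filter fun x => pointStabilizer (ψ.comp K.subtype) x = S).card * T.ncard =
      Fintype.card X := by
  have hmem : ∀ x, pointStabilizer (ψ.comp K.subtype) x ∈ T := fun x => by
    rw [← hψ x]
    exact self_mem_conjClass _
  have heq : ∀ S' ∈ T, (Finset.univ.filter fun x =>
      pointStabilizer (ψ.comp K.subtype) x = S').card ≤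
      (Finset.univ.filter fun x => pointStabilizer (ψ.comp K.subtype) x = S).card := by
    intro S' hS'
    rcases (Finset.univ.filter fun x =>
      pointStabilizer (ψ.comp K.subtype) x = S').eq_empty_or_nonempty with h | ⟨x, hx⟩
    · rw [h]
      simp
    have hx' := (Finset.mem_filter.1 hx).2
    have hS1 := hS
    rw [← hψ x, pointType, hx'] at hS1
    obtain ⟨g, rfl⟩ := hS1
    refine Finset.card_le_card_of_injOn (ψ g) (fun z hz => ?_) (ψ g).injective.injOn
    have hz' := (Finset.mem_filter.1 hz).2
    refine Finset.mem_filter.2 ⟨Finset.mem_univ _, ?_⟩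
    rw [pointStabilizer_apply, hz']
  have heq' : ∀ S' ∈ T, (Finset.univ.filter fun x =>
      pointStabilizer (ψ.comp K.subtype) x = S').card =
      (Finset.univ.filter fun x => pointStabilizer (ψ.comp K.subtype) x = S).card := by
    intro S' hS'
    refine (heq S' hS').antisymm ?_
    rcases (Finset.univ.filter fun x =>
      pointStabilizer (ψ.comp K.subtype) x = S).eq_empty_or_nonempty with h | ⟨x, hx⟩
    · rw [h]
      simp
    have hx' := (Finset.mem_filter.1 hx).2
    have hS1 := hS'
    rw [← hψ x, pointType, hx'] at hS1
    obtain ⟨g, rfl⟩ := hS1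
    refine Finset.card_le_card_of_injOn (ψ g) (fun z hz => ?_) (ψ g).injective.injOn
    have hz' := (Finset.mem_filter.1 hz).2
    refine Finset.mem_filter.2 ⟨Finset.mem_univ _, ?_⟩
    rw [pointStabilizer_apply, hz']
  have hT : T.Finite := Set.toFinite T
  rw [← Finset.card_univ, Finset.card_eq_sum_card_fiberwise (s := Finset.univ) (t := hT.toFinset)
    (f := fun x => pointStabilizer (ψ.comp K.subtype) x) (fun x _ => by simpa using hmem x),
    Finset.sum_congr rfl (fun S' hS' => heq' S' (by simpa using hS')), Finset.sum_const,
    smul_eq_mul, mul_comm, Set.ncard_eq_toFinset_card T hT]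

end Class

section

variable {G : Type*} [Group G] (K : Subgroup G) [K.Normal] [Finite K]

/-- The finitely many types are numbered. -/
noncomputable def typeIndex : Set (Subgroup K) ≃ Fin (Nat.card (Set (Subgroup K))) :=
  Finite.equivFin _

/-- The number of points of a given type. -/
noncomputable def typeDim {k : ℕ} (ψ : G →* Equiv.Perm (Fin k))
    (j : Fin (Nat.card (Set (Subgroup K)))) : ℕ :=
  ∑ x, if typeIndex K (pointType K ψ x) = j then 1 else 0

theorem typeDim_eq_self {k : ℕ} {ψ : G →* Equiv.Perm (Fin k)}
    {j : Fin (Nat.card (Set (Subgroup K)))} (h : typeDim K ψ j = k) (x : Fin k) :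
    pointType K ψ x = (typeIndex K).symm j := by
  rw [typeDim, Finset.sum_ite, Finset.sum_const, Finset.sum_const_zero, add_zero, smul_eq_mul,
    mul_one] at h
  have := (Finset.card_eq_iff_eq_univ _).1 (h.trans (Fintype.card_fin k).symm)
  have hx := this.symm ▸ Finset.mem_univ x
  rw [← (Finset.mem_filter.1 hx).2, Equiv.symm_apply_apply]

theorem typeDim_sumHom {J : Type} [Fintype J] (a : J → ℕ) {k : ℕ} (h : ∑ i, a i = k)
    (ψ : ∀ i, G →* Equiv.Perm (Fin (a i))) (j : Fin (Nat.card (Set (Subgroup K)))) :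
    typeDim K (permFamily.sumHom a h ψ) j = ∑ i, typeDim K (ψ i) j := by
  simp only [typeDim]
  rw [← Equiv.sum_comp (blockEquiv a h), Fintype.sum_sigma]
  refine Finset.sum_congr rfl fun i _ => Finset.sum_congr rfl fun x _ => ?_
  rw [pointType_map (f := fun x => blockEquiv a h ⟨i, x⟩) (ψ := ψ i) (fun x y hxy => by
    simpa using hxy) (fun g x => by rw [sumHom_apply, sum_apply])]

theorem typeDim_conjHom {k : ℕ} (u : Equiv.Perm (Fin k)) (ψ : G →* Equiv.Perm (Fin k)) :
    typeDim K (conjHom u ψ) = typeDim K ψ := by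
  funext j
  simp only [typeDim]
  rw [← Equiv.sum_comp u]
  refine Finset.sum_congr rfl fun x _ => ?_
  rw [pointType_map (f := u) (ψ := ψ) u.injective (fun g x => by simp)]

/-- The restriction of an action to an invariant subset, with numbered points. -/
noncomputable def restrictHom {k m : ℕ} (ψ : G →* Equiv.Perm (Fin k)) {p : Fin k → Prop}
    (hp : ∀ g x, p (ψ g x) ↔ p x) (e : {x // p x} ≃ Fin m) : G →* Equiv.Perm (Fin m) where
  toFun g := e.permCongr ((ψ g).subtypePerm (hp g))
  map_one' := by
    ext x
    simp [Equiv.permCongr_apply]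
  map_mul' g h := by
    ext x
    simp [Equiv.permCongr_apply]

theorem restrictHom_apply {k m : ℕ} (ψ : G →* Equiv.Perm (Fin k)) {p : Fin k → Prop}
    (hp : ∀ g x, p (ψ g x) ↔ p x) (e : {x // p x} ≃ Fin m) (g : G) (y : Fin m) :
    ((e.symm (restrictHom ψ hp e g y) : {x // p x}) : Fin k) = ψ g (e.symm y) := by
  simp [restrictHom, Equiv.permCongr_apply]

/-- The level sets of the type are `G`-invariant, so the action restricts to each of them; `u` only
renumbers the points. -/
theorem exists_decomp {J : Type} [Fintype J] [DecidableEq J]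
    (f : Fin (Nat.card (Set (Subgroup K))) → J) {k : ℕ} (ψ : G →* Equiv.Perm (Fin k)) :
    ∃ (a : J → ℕ) (h : ∑ b, a b = k) (χ : ∀ b, G →* Equiv.Perm (Fin (a b)))
      (u : Equiv.Perm (Fin k)), ψ = conjHom u (permFamily.sumHom a h χ) ∧
        ∀ b i, typeDim K (χ b) i = if f i = b then typeDim K ψ i else 0 := by
  classical
  let p : J → Fin k → Prop := fun b x => f (typeIndex K (pointType K ψ x)) = b
  have hp : ∀ b g x, p b (ψ g x) ↔ p b x := fun b g x => by
    simp only [p, pointType_apply]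
  let a : J → ℕ := fun b => Fintype.card {x // p b x}
  let e : ∀ b, {x // p b x} ≃ Fin (a b) := fun b => Fintype.equivFin _
  let E : (Σ b, {x // p b x}) ≃ Fin k :=
    Equiv.sigmaFiberEquiv fun x => f (typeIndex K (pointType K ψ x))
  have ha : ∑ b, a b = k := by
    have := Fintype.card_congr E
    rwa [Fintype.card_sigma, Fintype.card_fin] at this
  let u : Equiv.Perm (Fin k) :=
    ((blockEquiv a ha).symm.trans (Equiv.sigmaCongrRight fun b => (e b).symm)).trans E
  have hu : ∀ b y, u (blockEquiv a ha ⟨b, y⟩) = ((e b).symm y : {x // p b x}) := fun b y => by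
    simp only [u, Equiv.trans_apply, Equiv.symm_apply_apply]
    rfl
  refine ⟨a, ha, fun b => restrictHom ψ (hp b) (e b), u, ?_, fun b i => ?_⟩
  · ext g x : 2
    obtain ⟨z, rfl⟩ := u.surjective x
    obtain ⟨⟨b, y⟩, rfl⟩ := (blockEquiv a ha).surjective z
    rw [conjHom_apply, sumHom_apply, Equiv.Perm.mul_apply, Equiv.Perm.mul_apply,
      Equiv.Perm.inv_def, Equiv.symm_apply_apply, sum_apply, hu, hu, restrictHom_apply]
  · have h1 : ∀ y, pointType K (restrictHom ψ (hp b) (e b)) y =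
        pointType K ψ ((e b).symm y : {x // p b x}) := fun y =>
      (pointType_map (f := fun y => ((e b).symm y : {x // p b x}).1)
        (fun y y' h => (e b).symm.injective (Subtype.ext h))
        (fun g y => restrictHom_apply ψ (hp b) (e b) g y) y).symm
    simp only [typeDim, h1]
    rw [Equiv.sum_comp (e b).symm
      (fun z : {x // p b x} => if typeIndex K (pointType K ψ z.1) = i then 1 else 0)]
    rw [← Finset.sum_subtype (Finset.univ.filter (p b)) (by simp)
      (fun x => if typeIndex K (pointType K ψ x) = i then 1 else 0), Finset.sum_filter]
    split_ifs with hfi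
    · refine Finset.sum_congr rfl fun x _ => ?_
      by_cases hx : typeIndex K (pointType K ψ x) = i
      · simp [hx, hfi]
      · simp [hx]
    · refine Finset.sum_eq_zero fun x _ => ?_
      by_cases hx : typeIndex K (pointType K ψ x) = i
      · simp [hx, hfi]
      · simp [hx]

/-- The actions of a group on finite sets, relative to a finite normal subgroup. -/
noncomputable def types : permFamily.Types G K where
  num := Nat.card (Set (Subgroup K))
  dim ψ := typeDim K ψ
  sum_dim {k} ψ := by
    simp only [typeDim]
    rw [Finset.sum_comm]
    simp
  dim_sumHom := typeDim_sumHom K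
  dim_conjHom := typeDim_conjHom K
  decomp := exists_decomp K
  conj_of_pure {k} j ψ χ hψ hχ := by
    classical
    have h1 := typeDim_eq_self K hψ
    have h2 := typeDim_eq_self K hχ
    set T := (typeIndex K).symm j
    obtain ⟨f, hf, hfe⟩ := exists_equivariant_bijOn (ψ.comp K.subtype) (χ.comp K.subtype)
      Finset.univ Finset.univ (by simp) (by simp) (fun S => by
        by_cases hS : S ∈ T
        · have e1 := card_filter_mul ψ h1 hS
          have e2 := card_filter_mul χ h2 hS
          have hT : 0 < T.ncard := (Set.ncard_pos (Set.toFinite T)).2 ⟨S, hS⟩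
          exact Nat.eq_of_mul_eq_mul_right hT (e1.trans e2.symm)
        · have h0 : ∀ (ψ : G →* Equiv.Perm (Fin k)), (∀ x, pointType K ψ x = T) →
              (Finset.univ.filter fun x => pointStabilizer (ψ.comp K.subtype) x = S) = ∅ := by
            intro ψ hψ
            refine Finset.filter_eq_empty_iff.2 fun x _ hx => hS ?_
            rw [← hψ x, ← hx]
            exact self_mem_conjClass _
          rw [h0 ψ h1, h0 χ h2])
    have hbij : Function.Bijective f := by
      rw [← Set.bijOn_univ]
      simpa using hf
    refine ⟨Equiv.ofBijective f hbij, fun x hx => ?_⟩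
    rw [conjHom_apply, eq_mul_inv_iff_mul_eq]
    ext z
    simpa using congrArg Fin.val (hfe ⟨x, hx⟩ z (Finset.mem_univ z)).symm
  lipschitz ε hε := by
    classical
    have := Fintype.ofFinite K
    have hpos : (0 : ℝ) < Fintype.card K := by exact_mod_cast Fintype.card_pos
    refine ⟨ε / Fintype.card K, by positivity, fun {k} ψ χ h j => ?_⟩
    simp only [typeDim]
    push_cast
    rw [← Finset.sum_sub_distrib]
    calc |∑ x, ((if typeIndex K (pointType K ψ x) = j then (1 : ℝ) else 0) -
          if typeIndex K (pointType K χ x) = j then (1 : ℝ) else 0)|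
        ≤ ∑ x, |(if typeIndex K (pointType K ψ x) = j then (1 : ℝ) else 0) -
          if typeIndex K (pointType K χ x) = j then (1 : ℝ) else 0| :=
        Finset.abs_sum_le_sum_abs _ _
      -- A point whose type changes has different stabilizers under the two actions, so some `y` in
      -- `K` moves it differently.
      _ ≤ ∑ x, ∑ y : K, if ψ y x = χ y x then (0 : ℝ) else 1 := by
        refine Finset.sum_le_sum fun x _ => ?_
        by_cases hx : ∀ y : K, ψ y x = χ y x
        · have : pointStabilizer (ψ.comp K.subtype) x = pointStabilizer (χ.comp K.subtype) x := by
            ext y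
            rw [mem_pointStabilizer, mem_pointStabilizer]
            show ψ y x = x ↔ χ y x = x
            rw [hx]
          rw [pointType, pointType, this]
          simpa using Finset.sum_nonneg fun y _ => by positivity
        · push Not at hx
          obtain ⟨y, hy⟩ := hx
          have h1 := Finset.single_le_sum
            (f := fun y : K => if ψ y x = χ y x then (0 : ℝ) else 1)
            (fun y _ => by positivity) (Finset.mem_univ y)
          simp only [hy, if_false] at h1
          refine le_trans ?_ h1
          split_ifs <;> norm_num
      _ = ∑ y : K, permFamily.cost (ψ y) (χ y) := by
        rw [Finset.sum_comm]
        rfl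
      _ ≤ ∑ _y : K, ε / Fintype.card K * k := Finset.sum_le_sum fun y _ => h y y.2
      _ = ε * k := by
        rw [Finset.sum_const, Finset.card_univ, nsmul_eq_mul]
        field_simp

end

/-- The set `W` where `ρ` and `σ` agree for all of `H` is invariant under both. Conjugacy gives
equal stabilizer counts overall, hence on the complement of `W` as well; so one can take the
identity on `W` and an equivariant bijection off it. The complement is small because each of its
points is counted in the cost at some `g`. -/
theorem nearConj (H : Type*) [Group H] [Finite H] : permFamily.NearConj H := by
  classical
  have := Fintype.ofFinite H
  have hpos : (0 : ℝ) < Fintype.card H := by exact_mod_cast Fintype.card_pos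
  intro ε hε
  refine ⟨ε / Fintype.card H, by positivity, fun {k} ρ u h => ?_⟩
  let σ : H →* Equiv.Perm (Fin k) := conjHom u ρ
  have hcost : ∀ g, permFamily.cost (ρ g) (σ g) ≤ ε / Fintype.card H * k := h
  let W : Finset (Fin k) := Finset.univ.filter fun x => ∀ g, ρ g x = σ g x
  have hW : ∀ {x}, x ∈ W ↔ ∀ g, ρ g x = σ g x := by simp [W]
  have hWρ : ∀ g x, x ∈ W → ρ g x ∈ W := fun g x hx => hW.2 fun g' => by
    rw [← Equiv.Perm.mul_apply, ← map_mul, hW.1 hx, hW.1 hx g, map_mul, Equiv.Perm.mul_apply]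
  have hWσ : ∀ g x, x ∈ W → σ g x ∈ W := fun g x hx => by
    rw [← hW.1 hx]
    exact hWρ g x hx
  have hinv : ∀ τ : H →* Equiv.Perm (Fin k), (∀ g x, x ∈ W → τ g x ∈ W) →
      ∀ g, ∀ x ∈ Wᶜ, τ g x ∈ Wᶜ := by
    intro τ hτ g x hx
    rw [Finset.mem_compl] at hx ⊢
    intro h
    refine hx ?_
    have := hτ g⁻¹ _ h
    rwa [← Equiv.Perm.mul_apply, ← map_mul, inv_mul_cancel, map_one, Equiv.Perm.one_apply] at this
  have hsplit : ∀ (τ : H →* Equiv.Perm (Fin k)) (S : Subgroup H),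
      (W.filter fun x => pointStabilizer τ x = S).card +
        (Wᶜ.filter fun x => pointStabilizer τ x = S).card =
          (Finset.univ.filter fun x => pointStabilizer τ x = S).card := by
    intro τ S
    rw [← Finset.card_union_of_disjoint (Finset.disjoint_filter_filter disjoint_compl_right),
      ← Finset.filter_union, Finset.union_compl]
  have hcount : ∀ S, (Wᶜ.filter fun x => pointStabilizer ρ x = S).card =
      (Wᶜ.filter fun x => pointStabilizer σ x = S).card := by
    intro S
    have e1 : (W.filter fun x => pointStabilizer ρ x = S).card =
        (W.filter fun x => pointStabilizer σ x = S).card := by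
      congr 1
      refine Finset.filter_congr fun x hx => ?_
      have : pointStabilizer ρ x = pointStabilizer σ x := by
        ext g
        rw [mem_pointStabilizer, mem_pointStabilizer, hW.1 hx]
      rw [this]
    have e2 : (Finset.univ.filter fun x => pointStabilizer ρ x = S).card =
        (Finset.univ.filter fun x => pointStabilizer σ x = S).card := by
      have hst : ∀ x, pointStabilizer σ (u x) = pointStabilizer ρ x := fun x =>
        pointStabilizer_map (A := Set.univ) u.injective.injOn (fun _ _ _ => trivial)
          (fun g x _ => by simp [σ]) trivial
      refine Finset.card_bijective u u.bijective fun x => ?_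
      simp [hst]
    have e3 := hsplit ρ S
    have e4 := hsplit σ S
    omega
  obtain ⟨f, hf, hfe⟩ := exists_equivariant_bijOn ρ σ Wᶜ Wᶜ (hinv ρ hWρ) (hinv σ hWσ) hcount
  let v : Fin k → Fin k := fun x => if x ∈ W then x else f x
  have hfW : ∀ {x}, x ∉ W → f x ∉ W := fun {x} hx => by
    have h1 : f x ∈ Wᶜ := hf.mapsTo (Finset.mem_coe.2 (Finset.mem_compl.2 hx))
    exact Finset.mem_compl.1 h1
  have hv : Function.Injective v := by
    intro x y hxy
    simp only [v] at hxy
    split_ifs at hxy with hx hy hy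
    · exact hxy
    · exact absurd (hxy ▸ hx) (hfW hy)
    · exact absurd (hxy.symm ▸ hy) (hfW hx)
    · exact hf.injOn (Finset.mem_coe.2 (Finset.mem_compl.2 hx))
        (Finset.mem_coe.2 (Finset.mem_compl.2 hy)) hxy
  refine ⟨Equiv.ofBijective v (Finite.injective_iff_bijective.1 hv), ?_, ?_⟩
  · ext g : 1
    rw [conjHom_apply, mul_inv_eq_iff_eq_mul]
    ext x : 1
    show v (ρ g x) = σ g (v x)
    by_cases hx : x ∈ W
    · simp only [v, hx, hWρ g x hx, if_true]
      exact hW.1 hx g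
    · have h1 := Finset.mem_compl.1 (hinv ρ hWρ g x (Finset.mem_compl.2 hx))
      simp only [v, hx, h1, if_false]
      exact hfe g x (Finset.mem_compl.2 hx)
  · calc permFamily.cost (Equiv.ofBijective v (Finite.injective_iff_bijective.1 hv)) 1
        ≤ ∑ x, ∑ g : H, if ρ g x = σ g x then (0 : ℝ) else 1 := by
            rw [cost_def]
            refine Finset.sum_le_sum fun x _ => ?_
            have h0 : (0 : ℝ) ≤ ∑ g : H, if ρ g x = σ g x then (0 : ℝ) else 1 :=
              Finset.sum_nonneg fun g _ => by positivity
            by_cases hx : x ∈ W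
            · simpa [v, hx] using h0
            · have hx' := hx
              rw [hW] at hx'
              push Not at hx'
              obtain ⟨g, hg⟩ := hx'
              have h1 := Finset.single_le_sum
                (f := fun g : H => if ρ g x = σ g x then (0 : ℝ) else 1)
                (fun y _ => by positivity) (Finset.mem_univ g)
              simp only [hg, if_false] at h1
              refine le_trans ?_ h1
              split_ifs <;> norm_num
      _ = ∑ g : H, permFamily.cost (ρ g) (σ g) := by
        rw [Finset.sum_comm]
        rfl
      _ ≤ ∑ _g : H, ε / Fintype.card H * k := Finset.sum_le_sum fun g _ => hcost g
      _ = ε * k := by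
        rw [Finset.sum_const, Finset.card_univ, nsmul_eq_mul]
        field_simp

end permFamily

/-! ### The Frobenius norm and the unitary groups as a block family. -/

section

open scoped Matrix

section Frobenius

variable {m n l : Type*} [Fintype m] [Fintype n] [Fintype l]

/-- The squared Frobenius norm of a complex matrix. -/
noncomputable def frobSq (A : Matrix m n ℂ) : ℝ := ∑ i, ∑ j, ‖A i j‖ ^ 2

theorem frobSq_nonneg (A : Matrix m n ℂ) : 0 ≤ frobSq A :=
  Finset.sum_nonneg fun _ _ => Finset.sum_nonneg fun _ _ => by positivity

theorem trace_conjTranspose_mul (A : Matrix m n ℂ) : (Aᴴ * A).trace = (frobSq A : ℂ) := by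
  simp only [Matrix.trace, Matrix.diag_apply, Matrix.mul_apply, Matrix.conjTranspose_apply, frobSq]
  rw [Finset.sum_comm]
  push_cast
  refine Finset.sum_congr rfl fun i _ => Finset.sum_congr rfl fun j _ => ?_
  exact Complex.conj_mul' (A i j)

theorem frobSq_eq_re_trace (A : Matrix m n ℂ) : frobSq A = (Aᴴ * A).trace.re := by
  rw [trace_conjTranspose_mul, Complex.ofReal_re]

theorem frobSq_eq_zero {A : Matrix m n ℂ} (h : frobSq A = 0) : A = 0 := by
  ext i j
  have h1 := (Finset.sum_eq_zero_iff_of_nonneg fun i _ =>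
    Finset.sum_nonneg fun j _ => sq_nonneg ‖A i j‖).1 h i (Finset.mem_univ i)
  have h2 := (Finset.sum_eq_zero_iff_of_nonneg fun j _ => sq_nonneg ‖A i j‖).1 h1 j
    (Finset.mem_univ j)
  simpa using h2

theorem frobSq_conjTranspose (A : Matrix m n ℂ) : frobSq Aᴴ = frobSq A := by
  simp only [frobSq, Matrix.conjTranspose_apply, norm_star]
  rw [Finset.sum_comm]

theorem frobSq_neg (A : Matrix m n ℂ) : frobSq (-A) = frobSq A := by
  simp [frobSq]

theorem frobSq_sub_comm (A B : Matrix m n ℂ) : frobSq (A - B) = frobSq (B - A) := by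
  rw [← frobSq_neg, neg_sub]

theorem frobSq_add_le (A B : Matrix m n ℂ) : frobSq (A + B) ≤ 2 * (frobSq A + frobSq B) := by
  simp only [frobSq]
  rw [← Finset.sum_add_distrib, Finset.mul_sum]
  refine Finset.sum_le_sum fun i _ => ?_
  rw [← Finset.sum_add_distrib, Finset.mul_sum]
  refine Finset.sum_le_sum fun j _ => ?_
  have h1 := norm_add_le (A i j) (B i j)
  rw [Matrix.add_apply]
  nlinarith [norm_nonneg (A i j + B i j), sq_nonneg (‖A i j‖ - ‖B i j‖)]

theorem frobSq_sub_le (A B : Matrix m n ℂ) : frobSq (A - B) ≤ 2 * (frobSq A + frobSq B) := by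
  rw [sub_eq_add_neg, ← frobSq_neg B]
  exact frobSq_add_le A (-B)

theorem frobSq_smul (c : ℂ) (A : Matrix m n ℂ) : frobSq (c • A) = ‖c‖ ^ 2 * frobSq A := by
  simp only [frobSq, Finset.mul_sum, Matrix.smul_apply, smul_eq_mul, norm_mul, mul_pow]

theorem frobSq_sum_le {ι : Type*} [Fintype ι] (A : ι → Matrix m n ℂ) :
    frobSq (∑ x, A x) ≤ Fintype.card ι * ∑ x, frobSq (A x) := by
  simp only [frobSq, Matrix.sum_apply]
  rw [Finset.sum_comm (s := (Finset.univ : Finset ι)), Finset.mul_sum]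
  refine Finset.sum_le_sum fun i _ => ?_
  rw [Finset.sum_comm (s := (Finset.univ : Finset ι)), Finset.mul_sum]
  refine Finset.sum_le_sum fun j _ => ?_
  calc ‖∑ x, A x i j‖ ^ 2 ≤ (∑ x, ‖A x i j‖) ^ 2 := by
        gcongr
        exact norm_sum_le _ _
    _ ≤ _ := sq_sum_le_card_mul_sum_sq

theorem frobSq_isometry_mul [DecidableEq m] {W : Matrix l m ℂ} (hW : Wᴴ * W = 1)
    (A : Matrix m n ℂ) : frobSq (W * A) = frobSq A := by
  rw [frobSq_eq_re_trace, frobSq_eq_re_trace, Matrix.conjTranspose_mul, Matrix.mul_assoc,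
    ← Matrix.mul_assoc Wᴴ, hW, Matrix.one_mul]

theorem frobSq_mul_coisometry [DecidableEq n] {W : Matrix n l ℂ} (hW : W * Wᴴ = 1)
    (A : Matrix m n ℂ) : frobSq (A * W) = frobSq A := by
  rw [← frobSq_conjTranspose, Matrix.conjTranspose_mul, frobSq_isometry_mul (by simpa using hW),
    frobSq_conjTranspose]

/-- Pythagoras: `A` splits orthogonally into its projection `W * (Wᴴ * A)` and the rest. -/
theorem frobSq_conjTranspose_isometry_mul_le [DecidableEq m] {W : Matrix l m ℂ}
    (hW : Wᴴ * W = 1) (A : Matrix l n ℂ) : frobSq (Wᴴ * A) ≤ frobSq A := by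
  have h : frobSq A = frobSq (Wᴴ * A) + frobSq (A - W * (Wᴴ * A)) := by
    rw [frobSq_eq_re_trace, frobSq_eq_re_trace, frobSq_eq_re_trace, ← Complex.add_re,
      ← Matrix.trace_add]
    congr 2
    have e : Wᴴ * (W * (Wᴴ * A)) = Wᴴ * A := by
      rw [← Matrix.mul_assoc, hW, Matrix.one_mul]
    simp only [Matrix.conjTranspose_mul, Matrix.conjTranspose_sub, Matrix.conjTranspose_conjTranspose,
      Matrix.sub_mul, Matrix.mul_sub, Matrix.mul_assoc, e]
    abel
  rw [h]
  exact le_add_of_nonneg_right (frobSq_nonneg _)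

theorem frobSq_mul_isometry_le [DecidableEq n] {W : Matrix l n ℂ}
    (hW : Wᴴ * W = 1) (A : Matrix m l ℂ) : frobSq (A * W) ≤ frobSq A := by
  rw [← frobSq_conjTranspose, Matrix.conjTranspose_mul, ← frobSq_conjTranspose A]
  exact frobSq_conjTranspose_isometry_mul_le hW Aᴴ

theorem norm_trace_sq_le (A : Matrix n n ℂ) : ‖A.trace‖ ^ 2 ≤ Fintype.card n * frobSq A := by
  calc ‖A.trace‖ ^ 2 ≤ (∑ i, ‖A i i‖) ^ 2 := by
        gcongr
        exact norm_sum_le _ _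
    _ ≤ Fintype.card n * ∑ i, ‖A i i‖ ^ 2 := sq_sum_le_card_mul_sum_sq
    _ ≤ _ := by
        gcongr
        exact Finset.sum_le_sum fun i _ => Finset.single_le_sum
          (f := fun j => ‖A i j‖ ^ 2) (fun j _ => sq_nonneg _) (Finset.mem_univ i)

theorem frobSq_one [DecidableEq n] : frobSq (1 : Matrix n n ℂ) = Fintype.card n := by
  rw [frobSq_eq_re_trace]
  simp

end Frobenius

section BlockInclusion

variable {J : Type} [Fintype J] (a : J → ℕ) {k : ℕ} (h : ∑ j, a j = k)

/-- The inclusion of a block. -/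
noncomputable def blockInc (j : J) : Matrix (Fin k) (Fin (a j)) ℂ :=
  (1 : Matrix (Fin k) (Fin k) ℂ).submatrix id fun y => blockEquiv a h ⟨j, y⟩

theorem blockInc_conjTranspose_mul (i j : J) :
    (blockInc a h i)ᴴ * blockInc a h j = (1 : Matrix (Fin k) (Fin k) ℂ).submatrix
      (fun y => blockEquiv a h ⟨i, y⟩) (fun y => blockEquiv a h ⟨j, y⟩) := by
  rw [blockInc, blockInc, Matrix.conjTranspose_submatrix, Matrix.conjTranspose_one]
  exact (Matrix.submatrix_mul 1 1 _ id _ Function.bijective_id).symm.trans (by rw [Matrix.mul_one])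

theorem blockInc_isometry (j : J) : (blockInc a h j)ᴴ * blockInc a h j = 1 := by
  rw [blockInc_conjTranspose_mul]
  exact Matrix.submatrix_one _ fun y y' hy => by simpa using hy

theorem blockInc_orthogonal {i j : J} (hij : i ≠ j) :
    (blockInc a h i)ᴴ * blockInc a h j = 0 := by
  rw [blockInc_conjTranspose_mul]
  ext y y'
  rw [Matrix.submatrix_apply, Matrix.one_apply_ne, Matrix.zero_apply]
  intro he
  exact hij (congrArg Sigma.fst ((blockEquiv a h).injective he))

theorem sum_blockInc : ∑ j, blockInc a h j * (blockInc a h j)ᴴ = 1 := by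
  ext x x'
  let f : Fin k → ℂ := fun z =>
    (1 : Matrix (Fin k) (Fin k) ℂ) x z * star ((1 : Matrix (Fin k) (Fin k) ℂ) x' z)
  have e : ∑ z, f (blockEquiv a h z) = ∑ z, f z := Equiv.sum_comp _ _
  rw [Fintype.sum_sigma] at e
  rw [Matrix.sum_apply]
  refine Eq.trans ?_ (e.trans ?_)
  · exact Finset.sum_congr rfl fun j _ => Matrix.mul_apply
  · simp [f, Matrix.one_apply]

/-- The block sum of square matrices. -/
noncomputable def blockSum (A : ∀ j, Matrix (Fin (a j)) (Fin (a j)) ℂ) :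
    Matrix (Fin k) (Fin k) ℂ :=
  ∑ j, blockInc a h j * A j * (blockInc a h j)ᴴ

theorem blockSum_one : blockSum a h (fun _ => 1) = 1 := by
  simp only [blockSum, Matrix.mul_one, sum_blockInc]

theorem blockSum_mul_blockInc (A : ∀ j, Matrix (Fin (a j)) (Fin (a j)) ℂ) (j : J) :
    blockSum a h A * blockInc a h j = blockInc a h j * A j := by
  rw [blockSum, Matrix.sum_mul, Finset.sum_eq_single j]
  · rw [Matrix.mul_assoc, blockInc_isometry, Matrix.mul_one]
  · intro i _ hij
    rw [Matrix.mul_assoc, blockInc_orthogonal a h hij, Matrix.mul_zero]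
  · simp

theorem blockSum_mul (A B : ∀ j, Matrix (Fin (a j)) (Fin (a j)) ℂ) :
    blockSum a h (fun j => A j * B j) = blockSum a h A * blockSum a h B := by
  conv_rhs => rw [blockSum.eq_1 a h B]
  rw [Matrix.mul_sum]
  refine Finset.sum_congr rfl fun j _ => ?_
  simp only [← Matrix.mul_assoc, blockSum_mul_blockInc]

theorem blockSum_conjTranspose (A : ∀ j, Matrix (Fin (a j)) (Fin (a j)) ℂ) :
    (blockSum a h A)ᴴ = blockSum a h (fun j => (A j)ᴴ) := by
  simp [blockSum, Matrix.conjTranspose_sum, Matrix.mul_assoc]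

theorem blockSum_sub (A B : ∀ j, Matrix (Fin (a j)) (Fin (a j)) ℂ) :
    blockSum a h (fun j => A j - B j) = blockSum a h A - blockSum a h B := by
  simp [blockSum, Matrix.mul_sub, Matrix.sub_mul]

theorem trace_blockSum (A : ∀ j, Matrix (Fin (a j)) (Fin (a j)) ℂ) :
    (blockSum a h A).trace = ∑ j, (A j).trace := by
  rw [blockSum, Matrix.trace_sum]
  refine Finset.sum_congr rfl fun j _ => ?_
  rw [Matrix.trace_mul_comm, ← Matrix.mul_assoc, blockInc_isometry, Matrix.one_mul]

theorem frobSq_blockSum (A : ∀ j, Matrix (Fin (a j)) (Fin (a j)) ℂ) :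
    frobSq (blockSum a h A) = ∑ j, frobSq (A j) := by
  rw [frobSq_eq_re_trace, blockSum_conjTranspose, ← blockSum_mul, trace_blockSum, Complex.re_sum]
  exact Finset.sum_congr rfl fun j _ => (frobSq_eq_re_trace _).symm

end BlockInclusion

theorem unitaryGroup_conjTranspose_mul {k : ℕ} (U : Matrix.unitaryGroup (Fin k) ℂ) :
    U.1ᴴ * U.1 = 1 :=
  Matrix.mem_unitaryGroup_iff'.1 U.2

theorem unitaryGroup_mul_conjTranspose {k : ℕ} (U : Matrix.unitaryGroup (Fin k) ℂ) :
    U.1 * U.1ᴴ = 1 :=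
  Matrix.mem_unitaryGroup_iff.1 U.2

theorem unitaryGroup_coe_inv {k : ℕ} (U : Matrix.unitaryGroup (Fin k) ℂ) :
    (U⁻¹).1 =
      U.1ᴴ := rfl

/-- The unitary family of groups with block sums. -/
noncomputable def unitaryFamily : BlockFamily (fun k => Matrix.unitaryGroup (Fin k) ℂ) where
  cost U V := frobSq (U.1 - V.1)
  cost_nonneg U V := frobSq_nonneg _
  cost_self U := by simp [frobSq]
  cost_comm U V := frobSq_sub_comm _ _
  cost_triangle {k} U V X := by
    rw [← sub_add_sub_cancel U.1 V.1 X.1]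
    exact frobSq_add_le _ _
  cost_mul_left X U V := by
    show frobSq (X.1 * U.1 - X.1 * V.1) = _
    rw [← Matrix.mul_sub, frobSq_isometry_mul (unitaryGroup_conjTranspose_mul X)]
  cost_mul_right X U V := by
    show frobSq (U.1 * X.1 - V.1 * X.1) = _
    rw [← Matrix.sub_mul, frobSq_mul_coisometry (unitaryGroup_mul_conjTranspose X)]
  cost_le {k} U V := by
    have h : ∀ U : Matrix.unitaryGroup (Fin k) ℂ, frobSq U.1 = k := by
      intro U
      rw [← Matrix.mul_one U.1,
        frobSq_isometry_mul (unitaryGroup_conjTranspose_mul U), frobSq_one, Fintype.card_fin]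
    have := frobSq_sub_le U.1 V.1
    rw [h, h] at this
    linarith
  sum {_} _ a {k} h :=
    { toFun := fun U => ⟨blockSum a h fun j => (U j).1, by
        rw [Matrix.mem_unitaryGroup_iff', Matrix.star_eq_conjTranspose, blockSum_conjTranspose,
          ← blockSum_mul]
        simp only [unitaryGroup_conjTranspose_mul, blockSum_one]⟩
      map_one' := Subtype.ext (blockSum_one a h)
      map_mul' := fun U V => Subtype.ext (blockSum_mul a h _ _) }
  cost_sum {_} _ a {k} h U V := by
    show frobSq (blockSum a h (fun j => (U j).1) -
      blockSum a h (fun j => (V j).1)) = _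
    rw [← blockSum_sub, frobSq_blockSum]

namespace unitaryFamily

open BlockFamily

theorem cost_def {k : ℕ} (U V : Matrix.unitaryGroup (Fin k) ℂ) :
    unitaryFamily.cost U V = frobSq (U.1 - V.1) := rfl

theorem coe_sum {J : Type} [Fintype J] (a : J → ℕ) {k : ℕ} (h : ∑ j, a j = k)
    (U : ∀ j, Matrix.unitaryGroup (Fin (a j)) ℂ) :
    (unitaryFamily.sum a h U).1 =
      blockSum a h fun j => (U j).1 := rfl

theorem hsDist_eq_sqrt (k : ℕ) (U V : Matrix.unitaryGroup (Fin k) ℂ) :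
    hsDist k U V = Real.sqrt (unitaryFamily.dist k U V) := by
  rw [hsDist, hsNorm, ← frobSq_eq_re_trace]
  rfl

end unitaryFamily

end

/-! ### Polar decomposition and projections. -/

section

open scoped Matrix ComplexOrder

section PartialIsometry

variable {n : Type*} [Fintype n] [DecidableEq n]

theorem trace_cfc {N : Matrix n n ℂ} (hN : N.IsHermitian) (f : ℝ → ℝ) :
    (cfc f N).trace = ((∑ i, f (hN.eigenvalues i) : ℝ) : ℂ) := by
  rw [hN.cfc_eq, Matrix.IsHermitian.cfc, Unitary.conjStarAlgAut_apply, Matrix.trace_mul_comm,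
    ← Matrix.mul_assoc, Unitary.coe_star_mul_self, Matrix.one_mul, Matrix.trace_diagonal]
  simp

/-- The partial isometry of the polar decomposition. -/
theorem exists_partial_isometry (M : Matrix n n ℂ) :
    ∃ V : Matrix n n ℂ, V * (Vᴴ * V) = V ∧ M * (Vᴴ * V) = M ∧
      frobSq (V - M) ≤ frobSq (1 - Mᴴ * M) ∧
      ∀ X Y, X * M = M * Y → Y * (Mᴴ * M) = Mᴴ * M * Y → X * V = V * Y := by
  set N := Mᴴ * M with hNdef
  have hpsd : N.PosSemidef := Matrix.posSemidef_conjTranspose_mul_self M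
  have hN : N.IsHermitian := hpsd.isHermitian
  have hsa : IsSelfAdjoint N := hN
  -- The spectrum is finite, so the functional calculus accepts arbitrary functions.
  have hc : ∀ f : ℝ → ℝ, ContinuousOn f (spectrum ℝ N) := fun f =>
    (Matrix.finite_real_spectrum (A := N)).continuousOn f
  have hmul : ∀ f g : ℝ → ℝ, cfc f N * cfc g N = cfc (fun x => f x * g x) N := fun f g =>
    (cfc_mul f g N (hc f) (hc g)).symm
  have hid : cfc (fun x : ℝ => x) N = N := cfc_id' ℝ N
  have hone : cfc (fun _ : ℝ => (1 : ℝ)) N = 1 := cfc_const_one ℝ N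
  have hsub : ∀ f g : ℝ → ℝ, cfc f N - cfc g N = cfc (fun x => f x - g x) N := fun f g =>
    (cfc_sub f g N (hc f) (hc g)).symm
  have hherm : ∀ f : ℝ → ℝ, (cfc f N)ᴴ = cfc f N := fun f => cfc_predicate f N
  have hpos : ∀ x ∈ spectrum ℝ N, 0 ≤ x := by
    intro x hx
    rw [hN.spectrum_real_eq_range_eigenvalues] at hx
    obtain ⟨i, rfl⟩ := hx
    exact hpsd.eigenvalues_nonneg i
  -- `r` is the inverse square root, set to 0 at 0, so that `M * cfc r N` is the polar part of `M`
  -- and `cfc e N` is its support projection.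
  let r : ℝ → ℝ := fun x => if x = 0 then 0 else (Real.sqrt x)⁻¹
  let e : ℝ → ℝ := fun x => if x = 0 then 0 else 1
  have hre : ∀ x ∈ spectrum ℝ N, r x * (x * r x) = e x := by
    intro x hx
    by_cases h0 : x = 0
    · simp [r, e, h0]
    · have h1 : 0 < x := lt_of_le_of_ne (hpos x hx) (Ne.symm h0)
      simp only [r, e, h0, if_false]
      have h2 := Real.mul_self_sqrt h1.le
      have h3 : Real.sqrt x ≠ 0 := (Real.sqrt_pos.2 h1).ne'
      field_simp
      nlinarith
  have hMf : ∀ f g : ℝ → ℝ, (M * cfc f N)ᴴ * (M * cfc g N) =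
      cfc (fun x => f x * (x * g x)) N := by
    intro f g
    rw [Matrix.conjTranspose_mul, hherm, Matrix.mul_assoc, ← Matrix.mul_assoc Mᴴ, ← hNdef]
    have h1 := hmul (fun x => x) g
    rw [hid] at h1
    rw [h1, hmul]
  have hVV : (M * cfc r N)ᴴ * (M * cfc r N) = cfc e N := by
    rw [hMf]
    exact cfc_congr fun x hx => hre x hx
  refine ⟨M * cfc r N, ?_, ?_, ?_, ?_⟩
  · rw [hVV, Matrix.mul_assoc, hmul]
    congr 2
    funext x
    by_cases h0 : x = 0 <;> simp [r, e, h0]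
  · rw [hVV]
    have h1 : M - M * cfc e N = M * cfc (fun x => 1 - e x) N := by
      rw [← hsub, hone, Matrix.mul_sub, Matrix.mul_one]
    have h2 : M - M * cfc e N = 0 := by
      apply frobSq_eq_zero
      rw [frobSq_eq_re_trace, h1, hMf, trace_cfc hN, Complex.ofReal_re]
      refine Finset.sum_eq_zero fun i _ => ?_
      by_cases h0 : hN.eigenvalues i = 0 <;> simp [e, h0]
    exact (sub_eq_zero.1 h2).symm
  · have h1 : M * cfc r N - M = M * cfc (fun x => r x - 1) N := by
      rw [← hsub, hone, Matrix.mul_sub, Matrix.mul_one]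
    have h2 : 1 - N = cfc (fun x : ℝ => 1 - x) N := by
      rw [← hsub, hone, hid]
    rw [frobSq_eq_re_trace, frobSq_eq_re_trace, h1, hMf, h2, hherm, hmul, trace_cfc hN,
      trace_cfc hN, Complex.ofReal_re, Complex.ofReal_re]
    refine Finset.sum_le_sum fun i _ => ?_
    have hx := hpsd.eigenvalues_nonneg i
    by_cases h0 : hN.eigenvalues i = 0
    · simp [r, h0]
    · have h1 : 0 < hN.eigenvalues i := lt_of_le_of_ne hx (Ne.symm h0)
      simp only [r, h0, if_false]
      obtain ⟨s, hs, hss⟩ : ∃ s : ℝ, 0 < s ∧ hN.eigenvalues i = s ^ 2 :=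
        ⟨_, Real.sqrt_pos.2 h1, (Real.sq_sqrt hx).symm⟩
      rw [hss, Real.sqrt_sq hs.le]
      have h3 : (s⁻¹ - 1) * (s ^ 2 * (s⁻¹ - 1)) = (1 - s) ^ 2 := by
        field_simp
      rw [h3]
      -- With singular value `s`, this is (1 - s)² ≤ (1 - s²)², as 1 + s ≥ 1.
      nlinarith [mul_nonneg hs.le (sq_nonneg (1 - s)), mul_nonneg (sq_nonneg s) (sq_nonneg (1 - s))]
  · intro X Y hXY hYN
    have h1 : Y * cfc r N = cfc r N * Y :=
      (Commute.cfc_real (show Commute N Y from hYN.symm) r).eq.symm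
    rw [← Matrix.mul_assoc, hXY, Matrix.mul_assoc, h1, Matrix.mul_assoc]

/-- A matrix is close to a unitary matrix in terms of its defect of unitarity. -/
theorem exists_unitary_near (M : Matrix n n ℂ) {η : ℝ} (hη : 0 < η) :
    ∃ w : Matrix n n ℂ, wᴴ * w = 1 ∧ frobSq (w - M) ≤ 2 * frobSq (1 - Mᴴ * M) + η ∧
      ∀ X, X * M = M * X → X * Mᴴ = Mᴴ * X → X * w = w * X := by
  -- The matrix is shifted by a small `t > 0` avoiding the eigenvalues of `-M`. The shifted matrix
  -- is invertible, so its polar part is unitary; the shift is scalar, so commutation relations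
  -- persist, and its cost goes into `η`.
  have hcont : Continuous fun t : ℝ => 2 * (frobSq (1 - (M + (t : ℂ) • 1)ᴴ * (M + (t : ℂ) • 1)) +
      frobSq ((t : ℂ) • (1 : Matrix n n ℂ))) := by
    unfold frobSq
    fun_prop
  have hlim := (hcont.tendsto 0).mono_left (nhdsWithin_le_nhds (s := Set.Ioi 0))
  simp only [Complex.ofReal_zero, zero_smul, add_zero] at hlim
  rw [show frobSq (0 : Matrix n n ℂ) = 0 by simp [frobSq], add_zero] at hlim
  have hev := hlim.eventually_lt_const (lt_add_of_pos_right _ hη)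
  have hinv : ∀ᶠ t : ℝ in 𝓝[>] 0, ∀ z ∈ spectrum ℂ (-M), (t : ℂ) ≠ z := by
    rw [Filter.eventually_all_finite (Matrix.finite_spectrum (-M))]
    intro z _
    by_cases hz : z = 0
    · filter_upwards [self_mem_nhdsWithin] with t ht
      rw [hz]
      exact_mod_cast (Set.mem_Ioi.1 ht).ne'
    · have h1 : Tendsto (fun t : ℝ => (t : ℂ)) (𝓝[>] 0) (𝓝 0) :=
        (Complex.continuous_ofReal.tendsto' 0 0 (by simp)).mono_left nhdsWithin_le_nhds
      exact h1.eventually_ne (Ne.symm hz)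
  obtain ⟨t, ht, htz⟩ := (hev.and hinv).exists
  have hunit : IsUnit (M + (t : ℂ) • (1 : Matrix n n ℂ)) := by
    have : (t : ℂ) ∉ spectrum ℂ (-M) := fun h => htz _ h rfl
    rw [spectrum.notMem_iff, Algebra.algebraMap_eq_smul_one, sub_neg_eq_add, add_comm] at this
    exact this
  obtain ⟨V, -, h2, h3, h4⟩ := exists_partial_isometry (M + (t : ℂ) • (1 : Matrix n n ℂ))
  refine ⟨V, ?_, ?_, fun X hX hX' => ?_⟩
  · exact hunit.mul_left_cancel (h2.trans (Matrix.mul_one _).symm)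
  · have h5 : V - M = (V - (M + (t : ℂ) • 1)) + (t : ℂ) • 1 := by abel
    rw [h5]
    refine (frobSq_add_le _ _).trans (le_trans ?_ ht.le)
    gcongr
  · have hB : X * (M + (t : ℂ) • 1) = (M + (t : ℂ) • 1) * X := by
      simp [Matrix.mul_add, Matrix.add_mul, hX]
    have hB' : X * (M + (t : ℂ) • 1)ᴴ = (M + (t : ℂ) • 1)ᴴ * X := by
      simp [Matrix.mul_add, Matrix.add_mul, hX']
    refine h4 X X hB ?_
    rw [← Matrix.mul_assoc, hB', Matrix.mul_assoc, hB, Matrix.mul_assoc]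

/-- An orthogonal projection is the range projection of an isometry. -/
theorem exists_isometry_of_projection {P : Matrix n n ℂ} (hP : P.IsHermitian) (hPP : P * P = P) :
    ∃ (a : ℕ) (W : Matrix n (Fin a) ℂ), Wᴴ * W = 1 ∧ W * Wᴴ = P := by
  classical
  have hev : ∀ i, hP.eigenvalues i = 0 ∨ hP.eigenvalues i = 1 := by
    intro i
    have h1 := hP.mulVec_eigenvectorBasis i
    have h2 : P *ᵥ (P *ᵥ (hP.eigenvectorBasis i).ofLp) = P *ᵥ (hP.eigenvectorBasis i).ofLp := by
      rw [Matrix.mulVec_mulVec, hPP]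
    rw [h1, Matrix.mulVec_smul, h1, smul_smul] at h2
    have h3 : (hP.eigenvectorBasis i).ofLp ≠ 0 := fun h =>
      (hP.eigenvectorBasis.orthonormal.ne_zero i) (by
        ext j
        simpa using congrFun h j)
    have h4 : hP.eigenvalues i * hP.eigenvalues i = hP.eigenvalues i :=
      smul_left_injective ℝ h3 h2
    rcases eq_or_ne (hP.eigenvalues i) 0 with h | h
    · exact Or.inl h
    · exact Or.inr (mul_left_cancel₀ h (h4.trans (mul_one _).symm))
  let U : Matrix n n ℂ := hP.eigenvectorUnitary
  have hUU : Uᴴ * U = 1 := Matrix.mem_unitaryGroup_iff'.1 hP.eigenvectorUnitary.2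
  have hspec : P = U * Matrix.diagonal (fun i => (hP.eigenvalues i : ℂ)) * Uᴴ := by
    have := hP.spectral_theorem
    rw [Unitary.conjStarAlgAut_apply] at this
    exact this
  -- The columns of the isometry are the eigenvectors with eigenvalue 1.
  let e := Fintype.equivFin {i // hP.eigenvalues i = 1}
  refine ⟨_, U.submatrix id fun y => ((e.symm y : {i // hP.eigenvalues i = 1}) : n), ?_, ?_⟩
  · rw [Matrix.conjTranspose_submatrix, ← Matrix.submatrix_mul _ _ _ _ _ Function.bijective_id, hUU]
    exact Matrix.submatrix_one _ fun y y' h => e.symm.injective (Subtype.ext h)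
  · ext x x'
    conv_rhs => rw [hspec]
    let f : n → ℂ := fun i => U x i * star (U x' i)
    have h1 : (U.submatrix id (fun y => ((e.symm y : {i // hP.eigenvalues i = 1}) : n)) *
        (U.submatrix id (fun y => ((e.symm y : {i // hP.eigenvalues i = 1}) : n)))ᴴ) x x' =
        ∑ y, f (e.symm y : {i // hP.eigenvalues i = 1}) := Matrix.mul_apply
    rw [h1, Equiv.sum_comp e.symm (fun z : {i // hP.eigenvalues i = 1} => f z),
      ← Finset.sum_subtype (Finset.univ.filter fun i => hP.eigenvalues i = 1) (by simp) f,
      Finset.sum_filter, Matrix.mul_apply]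
    refine Finset.sum_congr rfl fun i _ => ?_
    rw [Matrix.mul_diagonal, Matrix.conjTranspose_apply]
    rcases hev i with h | h <;> simp [h, f]

end PartialIsometry

end

/-! ### Unitary representations of finite groups: characters and near conjugacy. -/

section

open scoped Matrix

namespace unitaryFamily

open BlockFamily

section Compress

variable {G : Type*} [Group G] {k a : ℕ}

/-- The compression of a unitary representation to an invariant subspace. -/
noncomputable def compressHom (ψ : G →* Matrix.unitaryGroup (Fin k) ℂ)
    {W : Matrix (Fin k) (Fin a) ℂ} (hW : Wᴴ * W = 1)
    (hc : ∀ g, (ψ g).1 * (W * Wᴴ) = W * Wᴴ * (ψ g).1) : G →* Matrix.unitaryGroup (Fin a) ℂ :=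
  have key : ∀ g h, Wᴴ * (ψ g).1 * W * (Wᴴ * (ψ h).1 * W) = Wᴴ * (ψ (g * h)).1 * W := by
    intro g h
    calc Wᴴ * (ψ g).1 * W * (Wᴴ * (ψ h).1 * W) = Wᴴ * ((ψ g).1 * (W * Wᴴ)) * ((ψ h).1 * W) := by
          simp only [Matrix.mul_assoc]
      _ = (Wᴴ * W) * Wᴴ * (ψ g).1 * ((ψ h).1 * W) := by
          rw [hc]
          simp only [Matrix.mul_assoc]
      _ = Wᴴ * ((ψ g).1 * (ψ h).1) * W := by
          rw [hW, Matrix.one_mul]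
          simp only [Matrix.mul_assoc]
      _ = _ := by
          rw [map_mul]
          rfl
  have key1 : Wᴴ * (ψ 1).1 * W = 1 := by
    rw [map_one]
    show Wᴴ * (1 : Matrix (Fin k) (Fin k) ℂ) * W = 1
    rw [Matrix.mul_one, hW]
  { toFun := fun g => ⟨Wᴴ * (ψ g).1 * W, by
      have h1 : star (Wᴴ * (ψ g).1 * W) = Wᴴ * (ψ g⁻¹).1 * W := by
        rw [map_inv, unitaryGroup_coe_inv, Matrix.star_eq_conjTranspose,
          Matrix.conjTranspose_mul, Matrix.conjTranspose_mul, Matrix.conjTranspose_conjTranspose,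
          Matrix.mul_assoc]
      rw [Matrix.mem_unitaryGroup_iff', h1, key, inv_mul_cancel, key1]⟩
    map_one' := Subtype.ext key1
    map_mul' := fun g h => Subtype.ext (key g h).symm }

theorem coe_compressHom (ψ : G →* Matrix.unitaryGroup (Fin k) ℂ)
    {W : Matrix (Fin k) (Fin a) ℂ} (hW : Wᴴ * W = 1)
    (hc : ∀ g, (ψ g).1 * (W * Wᴴ) = W * Wᴴ * (ψ g).1) (g : G) :
    (compressHom ψ hW hc g).1 = Wᴴ * (ψ g).1 * W := rfl

theorem trace_compressHom (ψ : G →* Matrix.unitaryGroup (Fin k) ℂ)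
    {W : Matrix (Fin k) (Fin a) ℂ} (hW : Wᴴ * W = 1)
    (hc : ∀ g, (ψ g).1 * (W * Wᴴ) = W * Wᴴ * (ψ g).1) (g : G) :
    (compressHom ψ hW hc g).1.trace = ((ψ g).1 * (W * Wᴴ)).trace := by
  rw [coe_compressHom, Matrix.mul_assoc, Matrix.trace_mul_comm, Matrix.mul_assoc]

end Compress

theorem coe_inv_of_hom {G : Type*} [Group G] {k : ℕ} (ψ : G →* Matrix.unitaryGroup (Fin k) ℂ)
    (g : G) : (ψ g⁻¹).1 = (ψ g).1ᴴ := by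
  rw [map_inv, unitaryGroup_coe_inv]

theorem coe_map_mul {G : Type*} [Group G] {k : ℕ} (ψ : G →* Matrix.unitaryGroup (Fin k) ℂ)
    (g h : G) : (ψ (g * h)).1 = (ψ g).1 * (ψ h).1 := by
  rw [map_mul]
  rfl

theorem coe_map_one {G : Type*} [Group G] {k : ℕ} (ψ : G →* Matrix.unitaryGroup (Fin k) ℂ) :
    (ψ 1).1 = 1 := by
  rw [map_one]
  rfl

section Character

variable {H : Type*} [Group H] [Fintype H] {k : ℕ}

/-- The sum of the translates of a matrix under a pair of unitary representations. -/
noncomputable def twistedSum (ρ σ : H →* Matrix.unitaryGroup (Fin k) ℂ)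
    (E : Matrix (Fin k) (Fin k) ℂ) : Matrix (Fin k) (Fin k) ℂ :=
  ∑ h, (σ h).1 * E * (ρ h).1ᴴ

theorem mul_twistedSum (ρ σ : H →* Matrix.unitaryGroup (Fin k) ℂ)
    (E : Matrix (Fin k) (Fin k) ℂ) (g : H) :
    (σ g).1 * twistedSum ρ σ E = twistedSum ρ σ E * (ρ g).1 := by
  rw [twistedSum, Matrix.mul_sum, Matrix.sum_mul, ← Equiv.sum_comp (Equiv.mulLeft g)
    (fun h => (σ h).1 * E * (ρ h).1ᴴ * (ρ g).1)]
  refine Finset.sum_congr rfl fun h _ => ?_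
  rw [Equiv.coe_mulLeft, coe_map_mul, coe_map_mul, Matrix.conjTranspose_mul]
  simp only [Matrix.mul_assoc]
  rw [unitaryGroup_conjTranspose_mul, Matrix.mul_one]

/-- If all twisted sums of matrix units vanished, adding suitable entries of them would give `∑ h,
‖(ρ h).1.trace‖ ^ 2 = 0`, whereas the term at 1 is `k ^ 2`. -/
theorem exists_intertwiner_ne_zero (hk : 0 < k) (ρ σ : H →* Matrix.unitaryGroup (Fin k) ℂ)
    (htr : ∀ h, (ρ h).1.trace = (σ h).1.trace) :
    ∃ M : Matrix (Fin k) (Fin k) ℂ, M ≠ 0 ∧ ∀ h, (σ h).1 * M = M * (ρ h).1 := by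
  by_contra! hcon
  have h0 : ∀ E, twistedSum ρ σ E = 0 := fun E => by
    by_contra hE
    obtain ⟨h, hh⟩ := hcon _ hE
    exact hh (mul_twistedSum ρ σ E h)
  have h1 : ∑ i, ∑ j, twistedSum ρ σ (Matrix.single i j 1) i j =
      ∑ h, (σ h).1.trace * star (ρ h).1.trace := by
    simp only [twistedSum, Matrix.sum_apply]
    have h2 : ∀ (i j : Fin k) (h : H),
        ((σ h).1 * (Matrix.single i j 1 : Matrix (Fin k) (Fin k) ℂ) * (ρ h).1ᴴ :
          Matrix (Fin k) (Fin k) ℂ) i j =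
        (σ h).1 i i * star ((ρ h).1 j j) := by
      intro i j h
      rw [Matrix.mul_apply, Finset.sum_eq_single j]
      · rw [Matrix.mul_single_apply_same, mul_one, Matrix.conjTranspose_apply]
      · intro l _ hl
        rw [Matrix.mul_single_apply_of_ne _ _ _ _ _ hl, zero_mul]
      · simp
    simp only [h2]
    calc _ = ∑ i, ∑ h, ∑ j, (σ h).1 i i * star ((ρ h).1 j j) :=
          Finset.sum_congr rfl fun i _ => Finset.sum_comm
      _ = ∑ h, ∑ i, ∑ j, (σ h).1 i i * star ((ρ h).1 j j) := Finset.sum_comm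
      _ = _ := by
          refine Finset.sum_congr rfl fun h _ => ?_
          rw [Matrix.trace, Matrix.trace, star_sum, Finset.sum_mul_sum]
          rfl
  have h3 : ∑ h, (σ h).1.trace * star (ρ h).1.trace = ((∑ h, ‖(ρ h).1.trace‖ ^ 2 : ℝ) : ℂ) := by
    push_cast
    refine Finset.sum_congr rfl fun h _ => ?_
    rw [htr]
    exact Complex.mul_conj' _
  rw [h3] at h1
  simp only [h0, Matrix.zero_apply, Finset.sum_const_zero] at h1
  have h4 : ∑ h, ‖(ρ h).1.trace‖ ^ 2 = 0 := by exact_mod_cast h1.symm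
  have h5 := (Finset.sum_eq_zero_iff_of_nonneg fun h _ => sq_nonneg ‖(ρ h).1.trace‖).1 h4 1
    (Finset.mem_univ 1)
  rw [coe_map_one, Matrix.trace_one] at h5
  simp at h5
  omega

omit [Fintype H] in
theorem conjTranspose_intertwines {ρ σ : H →* Matrix.unitaryGroup (Fin k) ℂ}
    {M : Matrix (Fin k) (Fin k) ℂ} (hM : ∀ h, (σ h).1 * M = M * (ρ h).1) (h : H) :
    (ρ h).1 * Mᴴ = Mᴴ * (σ h).1 := by
  have := congrArg Matrix.conjTranspose (hM h⁻¹)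
  rw [Matrix.conjTranspose_mul, Matrix.conjTranspose_mul, coe_inv_of_hom, coe_inv_of_hom,
    Matrix.conjTranspose_conjTranspose, Matrix.conjTranspose_conjTranspose] at this
  exact this.symm

/-- Unitary representations of a finite group with equal characters are unitarily equivalent. -/
theorem exists_conj_of_trace_eq (ρ σ : H →* Matrix.unitaryGroup (Fin k) ℂ)
    (htr : ∀ h, (ρ h).1.trace = (σ h).1.trace) :
    ∃ u : Matrix.unitaryGroup (Fin k) ℂ, σ = conjHom u ρ := by
  suffices hsuff : ∃ T : Matrix (Fin k) (Fin k) ℂ, Tᴴ * T = 1 ∧ ∀ h, (σ h).1 * T = T * (ρ h).1 by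
    obtain ⟨T, hT, hTh⟩ := hsuff
    refine ⟨⟨T, Matrix.mem_unitaryGroup_iff'.2 hT⟩, MonoidHom.ext fun h => ?_⟩
    rw [conjHom_apply, eq_mul_inv_iff_mul_eq]
    exact Subtype.ext (hTh h)
  induction k using Nat.strong_induction_on with
  | _ k ih =>
    rcases Nat.eq_zero_or_pos k with rfl | hk
    · exact ⟨0, Subsingleton.elim _ _, fun h => Subsingleton.elim _ _⟩
    obtain ⟨M, hM0, hM⟩ := exists_intertwiner_ne_zero hk ρ σ htr
    have hM' := conjTranspose_intertwines hM
    -- The polar part of a nonzero intertwiner is an intertwining partial isometry. It matches a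
    -- nonzero subrepresentation of `ρ` with one of `σ`; the orthogonal complements have equal
    -- dimension and equal characters, so induction applies to them.
    obtain ⟨V, hV1, hV2, -, hV3⟩ := exists_partial_isometry M
    have hV : ∀ h, (σ h).1 * V = V * (ρ h).1 := fun h => hV3 _ _ (hM h) (by
      rw [← Matrix.mul_assoc, hM', Matrix.mul_assoc, hM, Matrix.mul_assoc])
    have hV' := conjTranspose_intertwines hV
    have hV1' : Vᴴ * V * Vᴴ = Vᴴ := by
      simpa [Matrix.mul_assoc] using congrArg Matrix.conjTranspose hV1
    have hVV : ∀ h, (ρ h).1 * (Vᴴ * V) = Vᴴ * V * (ρ h).1 := fun h => by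
      rw [← Matrix.mul_assoc, hV', Matrix.mul_assoc, hV, Matrix.mul_assoc]
    have hVV' : ∀ h, (σ h).1 * (V * Vᴴ) = V * Vᴴ * (σ h).1 := fun h => by
      rw [← Matrix.mul_assoc, hV, Matrix.mul_assoc, hV', Matrix.mul_assoc]
    have hPi : Vᴴ * V * (Vᴴ * V) = Vᴴ * V := by rw [Matrix.mul_assoc, hV1]
    have hQi : V * Vᴴ * (V * Vᴴ) = V * Vᴴ := by
      rw [Matrix.mul_assoc, ← Matrix.mul_assoc Vᴴ, hV1']
    have hPh : (1 - Vᴴ * V).IsHermitian :=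
      Matrix.isHermitian_one.sub (Matrix.isHermitian_conjTranspose_mul_self V)
    have hQh : (1 - V * Vᴴ).IsHermitian :=
      Matrix.isHermitian_one.sub (Matrix.isHermitian_mul_conjTranspose_self V)
    obtain ⟨a, W, hW, hWP⟩ := exists_isometry_of_projection hPh (by
      rw [Matrix.mul_sub, Matrix.sub_mul, Matrix.sub_mul, hPi]
      simp)
    obtain ⟨a', W', hW', hWQ⟩ := exists_isometry_of_projection hQh (by
      rw [Matrix.mul_sub, Matrix.sub_mul, Matrix.sub_mul, hQi]
      simp)
    have htrVV : (Vᴴ * V).trace = (V * Vᴴ).trace := Matrix.trace_mul_comm _ _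
    have hta : (a : ℂ) = k - (Vᴴ * V).trace := by
      have h1 : (Wᴴ * W).trace = (W * Wᴴ).trace := Matrix.trace_mul_comm _ _
      rw [hW, hWP, Matrix.trace_sub, Matrix.trace_one, Matrix.trace_one, Fintype.card_fin,
        Fintype.card_fin] at h1
      exact h1
    have hta' : (a' : ℂ) = k - (V * Vᴴ).trace := by
      have h1 : (W'ᴴ * W').trace = (W' * W'ᴴ).trace := Matrix.trace_mul_comm _ _
      rw [hW', hWQ, Matrix.trace_sub, Matrix.trace_one, Matrix.trace_one, Fintype.card_fin,
        Fintype.card_fin] at h1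
      exact h1
    have haa : a' = a := by
      have : (a' : ℂ) = a := by rw [hta, hta', htrVV]
      exact_mod_cast this
    subst haa
    have hak : a' < k := by
      have h1 : (a' : ℝ) = k - frobSq V := by
        rw [trace_conjTranspose_mul] at hta
        exact_mod_cast hta
      have h2 : 0 < frobSq V := by
        refine lt_of_le_of_ne (frobSq_nonneg V) fun h => hM0 ?_
        rw [← hV2, frobSq_eq_zero h.symm]
        simp
      have : (a' : ℝ) < k := by linarith
      exact_mod_cast this
    have hcρ : ∀ h, (ρ h).1 * (W * Wᴴ) = W * Wᴴ * (ρ h).1 := fun h => by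
      rw [hWP, Matrix.mul_sub, Matrix.sub_mul, hVV, Matrix.mul_one, Matrix.one_mul]
    have hcσ : ∀ h, (σ h).1 * (W' * W'ᴴ) = W' * W'ᴴ * (σ h).1 := fun h => by
      rw [hWQ, Matrix.mul_sub, Matrix.sub_mul, hVV', Matrix.mul_one, Matrix.one_mul]
    obtain ⟨X, hX, hXh⟩ := ih a' hak (compressHom ρ hW hcρ) (compressHom σ hW' hcσ) (fun h => by
      rw [trace_compressHom, trace_compressHom, hWP, hWQ, Matrix.mul_sub, Matrix.mul_sub,
        Matrix.trace_sub, Matrix.trace_sub, Matrix.mul_one, Matrix.mul_one, htr]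
      congr 1
      rw [← Matrix.mul_assoc, hV', Matrix.mul_assoc, Matrix.trace_mul_comm, Matrix.mul_assoc])
    have hVW : Vᴴ * W' = 0 := by
      have h1 : Vᴴ * (W' * W'ᴴ) = 0 := by
        rw [hWQ, Matrix.mul_sub, Matrix.mul_one, ← Matrix.mul_assoc, hV1', sub_self]
      calc Vᴴ * W' = Vᴴ * (W' * W'ᴴ) * W' := by
            rw [Matrix.mul_assoc, Matrix.mul_assoc, hW', Matrix.mul_one]
        _ = 0 := by rw [h1, Matrix.zero_mul]
    have hWV : W'ᴴ * V = 0 := by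
      simpa using congrArg Matrix.conjTranspose hVW
    refine ⟨V + W' * X * Wᴴ, ?_, fun h => ?_⟩
    · have e1 : (V + W' * X * Wᴴ)ᴴ = Vᴴ + W * Xᴴ * W'ᴴ := by
        simp [Matrix.mul_assoc]
      rw [e1, Matrix.add_mul, Matrix.mul_add, Matrix.mul_add]
      have e2 : Vᴴ * (W' * X * Wᴴ) = 0 := by
        rw [← Matrix.mul_assoc, ← Matrix.mul_assoc, hVW]
        simp
      have e3 : W * Xᴴ * W'ᴴ * V = 0 := by
        rw [Matrix.mul_assoc, hWV, Matrix.mul_zero]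
      have e4 : W * Xᴴ * W'ᴴ * (W' * X * Wᴴ) = 1 - Vᴴ * V := by
        calc W * Xᴴ * W'ᴴ * (W' * X * Wᴴ) = W * (Xᴴ * ((W'ᴴ * W') * X)) * Wᴴ := by
              simp only [Matrix.mul_assoc]
          _ = _ := by rw [hW', Matrix.one_mul, hX, Matrix.mul_one, hWP]
      rw [e2, e3, e4]
      abel
    · have e1 := hXh h
      rw [coe_compressHom, coe_compressHom] at e1
      rw [Matrix.mul_add, Matrix.add_mul, hV]
      congr 1
      calc (σ h).1 * (W' * X * Wᴴ) = (σ h).1 * ((W' * (W'ᴴ * W')) * X * Wᴴ) := by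
            rw [hW', Matrix.mul_one]
        _ = ((σ h).1 * (W' * W'ᴴ)) * W' * X * Wᴴ := by simp only [Matrix.mul_assoc]
        _ = W' * ((W'ᴴ * (σ h).1 * W') * X) * Wᴴ := by
            rw [hcσ]
            simp only [Matrix.mul_assoc]
        _ = W' * X * Wᴴ * ((ρ h).1 * (W * Wᴴ)) := by
            rw [e1]
            simp only [Matrix.mul_assoc]
        _ = W' * X * (Wᴴ * W) * Wᴴ * (ρ h).1 := by
            rw [hcρ]
            simp only [Matrix.mul_assoc]
        _ = _ := by rw [hW, Matrix.mul_one]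

end Character

/-- The average `M` of `σ(h) ρ(h)*` intertwines `ρ` and `σ` and is close to 1. Then `u.1ᴴ * M`
commutes with `ρ`, and so does a nearby unitary `w`; the answer is `u * w`. Passing from `M` to
`u.1ᴴ * M` matters: the scalar shift in `exists_unitary_near` preserves commutation, but not
intertwining of two different representations. -/
theorem nearConj (H : Type*) [Group H] [Finite H] : unitaryFamily.NearConj H := by
  classical
  have := Fintype.ofFinite H
  intro ε hε
  -- The unitarity defect of `M` is at most 4δ, so `w` is within 2·4δ + δ = 9δ, and 2(9δ + δ) = 20δ.
  refine ⟨ε / 20, by positivity, fun {k} ρ u hρ => ?_⟩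
  rcases Nat.eq_zero_or_pos k with rfl | hk
  · refine ⟨u, rfl, (unitaryFamily.cost_le u 1).trans ?_⟩
    simp
  set δ : ℝ := ε / 20 * k with hδ
  have hδpos : 0 < δ := by positivity
  set σ := conjHom u ρ with hσ
  set c : ℂ := (Fintype.card H : ℂ)⁻¹ with hc
  have hcard : (0 : ℝ) < Fintype.card H := by exact_mod_cast Fintype.card_pos
  have hc1 : ‖c‖ = (Fintype.card H : ℝ)⁻¹ := by simp [hc]
  have havg : ∀ (A : H → Matrix (Fin k) (Fin k) ℂ) (t : ℝ), (∀ h, frobSq (A h) ≤ t) →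
      frobSq (c • ∑ h, A h) ≤ t := by
    intro A t hA
    rw [frobSq_smul, hc1]
    have h1 := frobSq_sum_le A
    have h2 : ∑ h, frobSq (A h) ≤ Fintype.card H * t := by
      rw [← nsmul_eq_mul, ← Finset.card_univ]
      exact Finset.sum_le_card_nsmul _ _ _ fun h _ => hA h
    calc _ ≤ (Fintype.card H : ℝ)⁻¹ ^ 2 * (Fintype.card H * (Fintype.card H * t)) := by
          gcongr
          exact h1.trans (by gcongr)
      _ = t := by field_simp
  have hconst : ∀ A : Matrix (Fin k) (Fin k) ℂ, c • ∑ _h : H, A = A := by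
    intro A
    rw [Finset.sum_const, Finset.card_univ, ← Nat.cast_smul_eq_nsmul ℂ, smul_smul, hc,
      inv_mul_cancel₀ (by exact_mod_cast hcard.ne'), one_smul]
  set M : Matrix (Fin k) (Fin k) ℂ := c • twistedSum ρ σ 1 with hM
  have hMh : ∀ h, (σ h).1 * M = M * (ρ h).1 := fun h => by
    rw [hM, Matrix.mul_smul, mul_twistedSum, Matrix.smul_mul]
  have hMsum : M = c • ∑ h, (σ h).1 * (ρ h).1ᴴ := by simp [hM, twistedSum]
  have hM1 : frobSq (1 - M) ≤ δ := by
    have e1 : 1 - M = c • ∑ h, (1 - (σ h).1 * (ρ h).1ᴴ) := by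
      rw [Finset.sum_sub_distrib, smul_sub, hconst, hMsum]
    rw [e1]
    refine havg _ _ fun h => ?_
    have e2 : 1 - (σ h).1 * (ρ h).1ᴴ = ((ρ h).1 - (σ h).1) * (ρ h).1ᴴ := by
      rw [Matrix.sub_mul, unitaryGroup_mul_conjTranspose]
    rw [e2, frobSq_mul_coisometry (by
      rw [Matrix.conjTranspose_conjTranspose, unitaryGroup_conjTranspose_mul])]
    exact hρ h
  have hMc : ∀ A : Matrix (Fin k) (Fin k) ℂ, frobSq (Mᴴ * A) ≤ frobSq A := by
    intro A
    have e1 : Mᴴ * A = c • ∑ h, (ρ h).1 * ((σ h).1ᴴ * A) := by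
      rw [hMsum, Matrix.conjTranspose_smul, Matrix.conjTranspose_sum, Matrix.smul_mul,
        Matrix.sum_mul]
      congr 1
      · simp [hc]
      · refine Finset.sum_congr rfl fun h _ => ?_
        rw [Matrix.conjTranspose_mul, Matrix.conjTranspose_conjTranspose, Matrix.mul_assoc]
    rw [e1]
    refine havg _ _ fun h => ?_
    rw [frobSq_isometry_mul (unitaryGroup_conjTranspose_mul _), frobSq_isometry_mul (by
      rw [Matrix.conjTranspose_conjTranspose, unitaryGroup_mul_conjTranspose])]
  have hMM : frobSq (1 - Mᴴ * M) ≤ 4 * δ := by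
    have e1 : 1 - Mᴴ * M = (1 - M)ᴴ + Mᴴ * (1 - M) := by
      rw [Matrix.conjTranspose_sub, Matrix.conjTranspose_one, Matrix.mul_sub, Matrix.mul_one]
      abel
    rw [e1]
    have e2 := frobSq_add_le (1 - M)ᴴ (Mᴴ * (1 - M))
    rw [frobSq_conjTranspose] at e2
    linarith [hMc (1 - M)]
  have huu := unitaryGroup_conjTranspose_mul u
  have huu' := unitaryGroup_mul_conjTranspose u
  have hB : ∀ h, (ρ h).1 * (u.1ᴴ * M) = u.1ᴴ * M * (ρ h).1 := by
    intro h
    have e1 : (σ h).1 = u.1 * (ρ h).1 * u.1ᴴ := rfl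
    have e2 := hMh h
    rw [e1] at e2
    rw [Matrix.mul_assoc, ← e2]
    simp only [← Matrix.mul_assoc, huu, Matrix.one_mul]
  obtain ⟨w, hw1, hw2, hw3⟩ := exists_unitary_near (u.1ᴴ * M) hδpos
  have hBB : (u.1ᴴ * M)ᴴ * (u.1ᴴ * M) = Mᴴ * M := by
    rw [Matrix.conjTranspose_mul, Matrix.conjTranspose_conjTranspose, Matrix.mul_assoc,
      ← Matrix.mul_assoc u.1, huu', Matrix.one_mul]
  rw [hBB] at hw2
  have hwρ : ∀ h, (ρ h).1 * w = w * (ρ h).1 := fun h =>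
    hw3 _ (hB h) (conjTranspose_intertwines hB h)
  let w' : Matrix.unitaryGroup (Fin k) ℂ := ⟨w, Matrix.mem_unitaryGroup_iff'.2 hw1⟩
  have hw' : ∀ h, w' * ρ h * w'⁻¹ = ρ h := fun h => by
    rw [mul_inv_eq_iff_eq_mul]
    exact Subtype.ext (hwρ h).symm
  refine ⟨u * w', MonoidHom.ext fun h => ?_, ?_⟩
  · rw [hσ, conjHom_apply, conjHom_apply]
    calc u * w' * ρ h * (u * w')⁻¹ = u * (w' * ρ h * w'⁻¹) * u⁻¹ := by group
      _ = _ := by rw [hw' h]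
  · rw [cost_def]
    show frobSq (u.1 * w - 1) ≤ ε * k
    have e1 : u.1 * w - 1 = u.1 * (w - u.1ᴴ * M) + (M - 1) := by
      rw [Matrix.mul_sub, ← Matrix.mul_assoc, huu', Matrix.one_mul]
      abel
    have e2 := frobSq_add_le (u.1 * (w - u.1ᴴ * M)) (M - 1)
    rw [frobSq_isometry_mul huu, frobSq_sub_comm M] at e2
    rw [e1]
    have e3 : ε * k = 20 * δ := by rw [hδ]; ring
    linarith

/-- The corner `Wᴴ * x.1 * W` fails to be unitary only through the complementary projection, of
squared norm `n`, so a unitary lies within `2 * n + 1` of it. The rest of `x` and the identity block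
also cost a multiple of `n`. -/
theorem approximable : unitaryFamily.Approximable := by
  refine ⟨40, by norm_num, fun {m n k} h x => ?_⟩
  have hsum : ∑ b, pairSize m n b = k := sum_pairSize h
  let W : Matrix (Fin k) (Fin m) ℂ := blockInc (pairSize m n) hsum true
  let W' : Matrix (Fin k) (Fin n) ℂ := blockInc (pairSize m n) hsum false
  have hW : Wᴴ * W = 1 := blockInc_isometry (pairSize m n) hsum true
  have hW' : W'ᴴ * W' = 1 := blockInc_isometry (pairSize m n) hsum false
  have hWW : W * Wᴴ + W' * W'ᴴ = 1 := by
    have := sum_blockInc (pairSize m n) hsum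
    rwa [Fintype.sum_bool] at this
  have hP' : frobSq (W' * W'ᴴ) = n := by
    rw [frobSq_isometry_mul hW', frobSq_conjTranspose, ← Matrix.mul_one W',
      frobSq_isometry_mul hW', frobSq_one, Fintype.card_fin]
  obtain ⟨y, hy1, hy2, -⟩ := exists_unitary_near (Wᴴ * x.1 * W) one_pos
  let y' : Matrix.unitaryGroup (Fin m) ℂ := ⟨y, Matrix.mem_unitaryGroup_iff'.2 hy1⟩
  refine ⟨y', ?_⟩
  have hpair : (unitaryFamily.pair h y' 1).1 = W * y * Wᴴ + W' * W'ᴴ := by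
    have : (unitaryFamily.pair h y' 1).1 = blockSum (pairSize m n) hsum (fun b =>
      (pairFun (D := fun k => Matrix.unitaryGroup (Fin k) ℂ) y' 1 b).1) := rfl
    rw [this, blockSum, Fintype.sum_bool]
    congr 1
    show W' * (1 : Matrix (Fin n) (Fin n) ℂ) * W'ᴴ = _
    rw [Matrix.mul_one]
  have hxP : frobSq (x.1 * (W' * W'ᴴ)) = n := by
    rw [frobSq_isometry_mul (unitaryGroup_conjTranspose_mul x), hP']
  have hPx : frobSq (W' * W'ᴴ * x.1) = n := by
    rw [frobSq_mul_coisometry (unitaryGroup_mul_conjTranspose x), hP']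
  have hyA : frobSq (Wᴴ * x.1 * W - y) ≤ 2 * n + 1 := by
    rw [frobSq_sub_comm]
    refine hy2.trans ?_
    have e1 : 1 - (Wᴴ * x.1 * W)ᴴ * (Wᴴ * x.1 * W) = Wᴴ * (x.1ᴴ * (W' * W'ᴴ * x.1)) * W := by
      have e2 : W' * W'ᴴ = 1 - W * Wᴴ := eq_sub_of_add_eq' hWW
      rw [e2, Matrix.sub_mul, Matrix.one_mul, Matrix.mul_sub, Matrix.mul_sub, Matrix.sub_mul,
        unitaryGroup_conjTranspose_mul, Matrix.mul_one, hW]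
      simp [Matrix.mul_assoc]
    have e3 : frobSq (1 - (Wᴴ * x.1 * W)ᴴ * (Wᴴ * x.1 * W)) ≤ n := by
      rw [e1]
      refine (frobSq_mul_isometry_le hW _).trans ?_
      refine (frobSq_conjTranspose_isometry_mul_le hW _).trans ?_
      rw [frobSq_isometry_mul (by
        rw [Matrix.conjTranspose_conjTranspose, unitaryGroup_mul_conjTranspose]), hPx]
    linarith
  rw [cost_def, hpair]
  have hdec : x.1 - (W * y * Wᴴ + W' * W'ᴴ) = W * (Wᴴ * x.1 * W - y) * Wᴴ +
      (W' * W'ᴴ * x.1 * W * Wᴴ + (x.1 * (W' * W'ᴴ) - W' * W'ᴴ)) := by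
    have e1 : x.1 = W * Wᴴ * x.1 * (W * Wᴴ) + W' * W'ᴴ * x.1 * (W * Wᴴ) + x.1 * (W' * W'ᴴ) := by
      rw [← Matrix.add_mul, ← Matrix.add_mul, hWW, Matrix.one_mul, ← Matrix.mul_add, hWW,
        Matrix.mul_one]
    conv_lhs => rw [e1]
    simp only [Matrix.mul_sub, Matrix.sub_mul, Matrix.mul_assoc]
    abel
  rw [hdec]
  have e1 := frobSq_add_le (W * (Wᴴ * x.1 * W - y) * Wᴴ)
    (W' * W'ᴴ * x.1 * W * Wᴴ + (x.1 * (W' * W'ᴴ) - W' * W'ᴴ))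
  have e2 := frobSq_add_le (W' * W'ᴴ * x.1 * W * Wᴴ) (x.1 * (W' * W'ᴴ) - W' * W'ᴴ)
  have e3 := frobSq_sub_le (x.1 * (W' * W'ᴴ)) (W' * W'ᴴ)
  have e4 : frobSq (W * (Wᴴ * x.1 * W - y) * Wᴴ) ≤ 2 * n + 1 := by
    rw [Matrix.mul_assoc, frobSq_isometry_mul hW, ← frobSq_conjTranspose,
      Matrix.conjTranspose_mul, Matrix.conjTranspose_conjTranspose, frobSq_isometry_mul hW,
      frobSq_conjTranspose]
    exact hyA
  have e5 : frobSq (W' * W'ᴴ * x.1 * W * Wᴴ) ≤ n := by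
    rw [← frobSq_conjTranspose, Matrix.conjTranspose_mul, Matrix.conjTranspose_conjTranspose,
      frobSq_isometry_mul hW, frobSq_conjTranspose]
    exact (frobSq_mul_isometry_le hW _).trans hPx.le
  rw [hP', hxP] at e3
  have hn : (0 : ℝ) ≤ n := Nat.cast_nonneg n
  linarith

end unitaryFamily

end

/-! ### Invariants in the group algebra. -/

theorem exists_smul_eq_mul_idempotents (R : Type*) [CommRing R] [Algebra ℂ R]
    [FiniteDimensional ℂ R] [IsReduced R] :
    ∃ (n : ℕ) (p : Fin n → R), CompleteOrthogonalIdempotents p ∧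
      ∀ a j, ∃ c : ℂ, a * p j = c • p j := by
  classical
  -- A reduced Artinian ring is the product of its residue fields, and each of these is finite over
  -- ℂ, hence equal to ℂ.
  have : IsArtinianRing R := IsArtinianRing.of_finite ℂ R
  let e := (IsArtinianRing.equivPi R).toRingEquiv
  let I := MaximalSpectrum R
  have : Fintype I := Fintype.ofFinite I
  let q : I → R := fun m => e.symm (Pi.single m 1)
  have hq : CompleteOrthogonalIdempotents q :=
    (CompleteOrthogonalIdempotents.single fun m : I => R ⧸ m.asIdeal).map
      (e.symm : (∀ m : I, R ⧸ m.asIdeal) →+* R)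
  let f := (Fintype.equivFin I).symm
  refine ⟨Fintype.card I, q ∘ f, (CompleteOrthogonalIdempotents.equiv f).2 hq, fun a j => ?_⟩
  set m := f j
  have : m.asIdeal.IsMaximal := m.isMaximal
  let _ : Field (R ⧸ m.asIdeal) := Ideal.Quotient.field _
  obtain ⟨c, hc⟩ := (IsAlgClosed.algebraMap_bijective_of_isIntegral
    (k := ℂ) (K := R ⧸ m.asIdeal)).2 (Ideal.Quotient.mk m.asIdeal a)
  refine ⟨c, e.injective ?_⟩
  show e (a * q m) = e (c • q m)
  rw [Algebra.smul_def, map_mul, map_mul, e.apply_symm_apply]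
  funext l
  rw [Pi.mul_apply, Pi.mul_apply]
  by_cases hl : l = m
  · subst hl
    rw [Pi.single_eq_same, mul_one, mul_one]
    exact hc.symm
  · rw [Pi.single_eq_of_ne hl, mul_zero, mul_zero]

/-- All multiples of a central nilpotent are nilpotent, so it lies in the Jacobson radical, which is
zero. -/
theorem eq_zero_of_mem_center_of_isNilpotent {R : Type*} [Ring R] [IsSemisimpleRing R] {a : R}
    (ha : a ∈ Subring.center R) (hn : IsNilpotent a) : a = 0 := by
  have h1 : a ∈ Ideal.jacobson (⊥ : Ideal R) := by
    rw [Ideal.mem_jacobson_iff]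
    intro y
    have h2 : IsNilpotent (y * a) :=
      Commute.isNilpotent_mul_left (Subring.mem_center_iff.1 ha y) hn
    obtain ⟨u, hu⟩ := h2.isUnit_add_one
    refine ⟨(u⁻¹ : Rˣ), ?_⟩
    have h3 : (u⁻¹ : Rˣ).1 * (y * a + 1) = 1 := by rw [← hu, Units.inv_mul]
    rw [mul_add, mul_one, ← mul_assoc] at h3
    rw [h3, sub_self]
    exact Submodule.zero_mem _
  rw [Ideal.jacobson_bot, IsSemisimpleRing.jacobson_eq_bot] at h1
  exact h1

section Invariants

variable {G : Type*} [Group G] (K : Subgroup G) [K.Normal]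

/-- The conjugation invariant elements of the group algebra of a normal subgroup. -/
noncomputable def conjInvariants : Subalgebra ℂ (MonoidAlgebra ℂ K) :=
  ⨅ g : G, AlgHom.equalizer
    (MonoidAlgebra.domCongr ℂ ℂ (MulAut.conjNormal g : K ≃* K) : MonoidAlgebra ℂ K →ₐ[ℂ] _)
    (AlgHom.id ℂ _)

variable {K}

theorem mem_conjInvariants {a : MonoidAlgebra ℂ K} : a ∈ conjInvariants K ↔
    ∀ g : G, MonoidAlgebra.domCongr ℂ ℂ (MulAut.conjNormal g : K ≃* K) a = a := by
  simp [conjInvariants, Algebra.mem_iInf, AlgHom.mem_equalizer]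

/-- Invariance under the elements of `K` itself already gives centrality. -/
theorem mem_center_of_mem_conjInvariants {a : MonoidAlgebra ℂ K} (ha : a ∈ conjInvariants K) :
    a ∈ Subalgebra.center ℂ (MonoidAlgebra ℂ K) := by
  have h1 : ∀ (x : K) (b : MonoidAlgebra ℂ K), MonoidAlgebra.single x 1 * b =
      MonoidAlgebra.domCongr ℂ ℂ (MulAut.conjNormal (x : G) : K ≃* K) b *
        MonoidAlgebra.single x (1 : ℂ) := by
    intro x b
    induction b using MonoidAlgebra.induction_linear with
    | zero => simp
    | add b c hb hc => rw [mul_add, map_add, add_mul, hb, hc]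
    | single y r =>
      rw [MonoidAlgebra.domCongr_single, MonoidAlgebra.single_mul_single,
        MonoidAlgebra.single_mul_single, mul_comm]
      congr 1
      exact Subtype.ext (by simp)
  rw [Subalgebra.mem_center_iff]
  intro b
  induction b using MonoidAlgebra.induction_on with
  | of x =>
    have h2 := h1 x a
    rw [mem_conjInvariants.1 ha x] at h2
    exact h2
  | add b c hb hc => rw [add_mul, mul_add, hb, hc]
  | smul r b hb => rw [smul_mul_assoc, mul_smul_comm, hb]

-- The invariants form a commutative finite-dimensional algebra without nilpotents, since they are
-- central in a semisimple algebra; so they form a product of copies of ℂ. Its minimal idempotents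
-- play the role of the `G`-orbits of irreducible characters of `K`.
variable (K) in
theorem exists_conjInvariant_idempotents [Finite K] :
    ∃ (n : ℕ) (p : Fin n → MonoidAlgebra ℂ K), CompleteOrthogonalIdempotents p ∧
      (∀ j, p j ∈ conjInvariants K) ∧
      ∀ a ∈ conjInvariants K, ∀ j, ∃ c : ℂ, a * p j = c • p j := by
  let Z := Subalgebra.center ℂ (MonoidAlgebra ℂ K)
  let R : Subalgebra ℂ Z := (conjInvariants K).comap Z.val
  have : IsReduced R := ⟨fun a ha => by
    have h1 : a.1.1 = 0 := eq_zero_of_mem_center_of_isNilpotent a.1.2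
      (ha.map (Z.val.comp R.val : R →ₐ[ℂ] MonoidAlgebra ℂ K))
    exact Subtype.ext (Subtype.ext h1)⟩
  have : FiniteDimensional ℂ (MonoidAlgebra ℂ K) := inferInstance
  have : FiniteDimensional ℂ R := inferInstance
  obtain ⟨n, p, hp, hp'⟩ := exists_smul_eq_mul_idempotents R
  refine ⟨n, fun j => (p j).1.1, hp.map (Z.val.comp R.val : R →ₐ[ℂ] MonoidAlgebra ℂ K).toRingHom,
    fun j => (p j).2, fun a ha j => ?_⟩
  obtain ⟨c, hc⟩ := hp' ⟨⟨a, mem_center_of_mem_conjInvariants ha⟩, ha⟩ j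
  exact ⟨c, congrArg (Z.val.comp R.val) hc⟩

end Invariants

/-! ### Isotypic theory of unitary representations. -/

section

open scoped Matrix

namespace unitaryFamily

open BlockFamily

section Isotypic

variable {G : Type*} [Group G] {K : Subgroup G} {k : ℕ}

/-- The extension of a unitary representation to the group algebra of a subgroup. -/
noncomputable def evalHom (ψ : G →* Matrix.unitaryGroup (Fin k) ℂ) :
    MonoidAlgebra ℂ K →ₐ[ℂ] Matrix (Fin k) (Fin k) ℂ :=
  MonoidAlgebra.lift ℂ (Matrix (Fin k) (Fin k) ℂ) K
    ((Matrix.unitaryGroup (Fin k) ℂ).subtype.comp (ψ.comp K.subtype))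

theorem evalHom_single (ψ : G →* Matrix.unitaryGroup (Fin k) ℂ) (x : K) (c : ℂ) :
    evalHom ψ (MonoidAlgebra.single x c) = c • (ψ x).1 :=
  MonoidAlgebra.lift_single _ _ _

theorem trace_evalHom [Fintype K] (ψ : G →* Matrix.unitaryGroup (Fin k) ℂ)
    (a : MonoidAlgebra ℂ K) :
    (evalHom ψ a).trace = ∑ x : K, a.coeff x * (ψ x).1.trace := by
  rw [evalHom, MonoidAlgebra.lift_apply, Finsupp.sum_fintype _ _ (by simp), Matrix.trace_sum]
  refine Finset.sum_congr rfl fun x _ => ?_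
  rw [Matrix.trace_smul]
  rfl

theorem mul_evalHom [K.Normal] (ψ : G →* Matrix.unitaryGroup (Fin k) ℂ) (g : G)
    (a : MonoidAlgebra ℂ K) : (ψ g).1 * evalHom ψ a =
      evalHom ψ (MonoidAlgebra.domCongr ℂ ℂ (MulAut.conjNormal g : K ≃* K) a) * (ψ g).1 := by
  induction a using MonoidAlgebra.induction_linear with
  | zero => simp
  | add a b ha hb => rw [map_add, map_add, map_add, mul_add, add_mul, ha, hb]
  | single x c =>
    rw [MonoidAlgebra.domCongr_single, evalHom_single, evalHom_single, Matrix.mul_smul,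
      Matrix.smul_mul, ← coe_map_mul, ← coe_map_mul]
    rw [MulAut.conjNormal_apply, inv_mul_cancel_right]

theorem mul_evalHom_of_mem [K.Normal] (ψ : G →* Matrix.unitaryGroup (Fin k) ℂ)
    {a : MonoidAlgebra ℂ K} (ha : a ∈ conjInvariants K) (g : G) :
    (ψ g).1 * evalHom ψ a = evalHom ψ a * (ψ g).1 := by
  rw [mul_evalHom, mem_conjInvariants.1 ha]

/-- The image `E` commutes with all `ψ g`, hence so does `Eᴴ`. As `E` lies in the span of the `ψ x`,
it commutes with `Eᴴ`, and a normal idempotent is self-adjoint. -/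
theorem evalHom_isHermitian [K.Normal] (ψ : G →* Matrix.unitaryGroup (Fin k) ℂ)
    {a : MonoidAlgebra ℂ K} (ha : a ∈ conjInvariants K) (haa : a * a = a) :
    (evalHom ψ a).IsHermitian := by
  set E := evalHom ψ a with hE
  have h1 : ∀ g, (ψ g).1 * Eᴴ = Eᴴ * (ψ g).1 := fun g =>
    conjTranspose_intertwines (mul_evalHom_of_mem ψ ha) g
  have h2 : ∀ b : MonoidAlgebra ℂ K, evalHom ψ b * Eᴴ = Eᴴ * evalHom ψ b := by
    intro b
    induction b using MonoidAlgebra.induction_linear with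
    | zero => simp
    | add b c hb hc => rw [map_add, add_mul, mul_add, hb, hc]
    | single x c => rw [evalHom_single, Matrix.smul_mul, Matrix.mul_smul, h1]
  have h3 : E * E = E := by rw [hE, ← map_mul, haa]
  have h4 : Eᴴ * Eᴴ = Eᴴ := by rw [← Matrix.conjTranspose_mul, h3]
  have h5 : E * Eᴴ = Eᴴ * E := h2 a
  have h6 : Eᴴ * E * (Eᴴ * E) = Eᴴ * E := by
    rw [Matrix.mul_assoc, ← Matrix.mul_assoc E, h5, Matrix.mul_assoc, h3, ← Matrix.mul_assoc, h4]
  have h7 : (E - Eᴴ * E)ᴴ * (E - Eᴴ * E) = 0 := by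
    rw [Matrix.conjTranspose_sub, Matrix.conjTranspose_mul, Matrix.conjTranspose_conjTranspose,
      Matrix.sub_mul, Matrix.mul_sub, Matrix.mul_sub, h6, Matrix.mul_assoc Eᴴ E E, h3,
      ← Matrix.mul_assoc, h4]
    simp
  have h8 : E = Eᴴ * E := by
    refine sub_eq_zero.1 (frobSq_eq_zero ?_)
    rw [frobSq_eq_re_trace, h7]
    simp
  rw [h8]
  exact Matrix.isHermitian_conjTranspose_mul_self E

theorem exists_isometry_evalHom [K.Normal] (ψ : G →* Matrix.unitaryGroup (Fin k) ℂ)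
    {a : MonoidAlgebra ℂ K} (ha : a ∈ conjInvariants K) (haa : a * a = a) :
    ∃ (m : ℕ) (W : Matrix (Fin k) (Fin m) ℂ), Wᴴ * W = 1 ∧ W * Wᴴ = evalHom ψ a ∧
      (evalHom ψ a).trace = m := by
  obtain ⟨m, W, h1, h2⟩ := exists_isometry_of_projection (evalHom_isHermitian ψ ha haa)
    (by rw [← map_mul, haa])
  refine ⟨m, W, h1, h2, ?_⟩
  rw [← h2, Matrix.trace_mul_comm, h1, Matrix.trace_one, Fintype.card_fin]

theorem trace_evalHom_compressHom (ψ : G →* Matrix.unitaryGroup (Fin k) ℂ) {m : ℕ}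
    {W : Matrix (Fin k) (Fin m) ℂ} (hW : Wᴴ * W = 1)
    (hc : ∀ g, (ψ g).1 * (W * Wᴴ) = W * Wᴴ * (ψ g).1) (a : MonoidAlgebra ℂ K) :
    (evalHom (compressHom ψ hW hc) a).trace = (evalHom ψ a * (W * Wᴴ)).trace := by
  induction a using MonoidAlgebra.induction_linear with
  | zero => simp
  | add a b ha hb => rw [map_add, map_add, add_mul, Matrix.trace_add, Matrix.trace_add, ha, hb]
  | single x c =>
    rw [evalHom_single, evalHom_single, Matrix.smul_mul, Matrix.trace_smul, Matrix.trace_smul,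
      trace_compressHom]

/-- The dimensions of the images of a family of projections. -/
noncomputable def imageDim {n : ℕ} (p : Fin n → MonoidAlgebra ℂ K)
    (ψ : G →* Matrix.unitaryGroup (Fin k) ℂ) (j : Fin n) : ℕ :=
  ⌊(evalHom ψ (p j)).trace.re⌋₊

variable {n : ℕ} {p : Fin n → MonoidAlgebra ℂ K}

/-- The trace of an orthogonal projection is its rank, so the floor in `imageDim` loses nothing. -/
theorem coe_imageDim [K.Normal] (hp : CompleteOrthogonalIdempotents p)
    (hpi : ∀ j, p j ∈ conjInvariants K) (ψ : G →* Matrix.unitaryGroup (Fin k) ℂ) (j : Fin n) :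
    (imageDim p ψ j : ℂ) = (evalHom ψ (p j)).trace := by
  obtain ⟨m, -, -, -, h⟩ := exists_isometry_evalHom ψ (hpi j) (hp.idem j)
  rw [imageDim, h, Complex.natCast_re, Nat.floor_natCast]

theorem sum_imageDim [K.Normal] (hp : CompleteOrthogonalIdempotents p)
    (hpi : ∀ j, p j ∈ conjInvariants K) (ψ : G →* Matrix.unitaryGroup (Fin k) ℂ) :
    ∑ j, imageDim p ψ j = k := by
  have h : ((∑ j, imageDim p ψ j : ℕ) : ℂ) = k := by
    push_cast
    simp only [coe_imageDim hp hpi]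
    rw [← Matrix.trace_sum, ← map_sum, hp.complete, map_one, Matrix.trace_one, Fintype.card_fin]
  exact_mod_cast h

theorem imageDim_sumHom [K.Normal] [Finite K] (hp : CompleteOrthogonalIdempotents p)
    (hpi : ∀ j, p j ∈ conjInvariants K) {J : Type} [Fintype J] (a : J → ℕ)
    (h : ∑ i, a i = k) (ψ : ∀ i, G →* Matrix.unitaryGroup (Fin (a i)) ℂ) (j : Fin n) :
    imageDim p (unitaryFamily.sumHom a h ψ) j = ∑ i, imageDim p (ψ i) j := by
  have := Fintype.ofFinite K
  have h : (imageDim p (unitaryFamily.sumHom a h ψ) j : ℂ) =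
      ((∑ i, imageDim p (ψ i) j : ℕ) : ℂ) := by
    push_cast
    simp only [coe_imageDim hp hpi, trace_evalHom]
    rw [Finset.sum_comm]
    refine Finset.sum_congr rfl fun x _ => ?_
    rw [← Finset.mul_sum, sumHom_apply, coe_sum, trace_blockSum]
  exact_mod_cast h

theorem imageDim_conjHom [Finite K] (u : Matrix.unitaryGroup (Fin k) ℂ)
    (ψ : G →* Matrix.unitaryGroup (Fin k) ℂ) : imageDim p (conjHom u ψ) = imageDim p ψ := by
  have := Fintype.ofFinite K
  funext j
  rw [imageDim, imageDim, trace_evalHom, trace_evalHom]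
  congr 3
  funext x
  congr 1
  show (u.1 * (ψ x).1 * u.1ᴴ).trace = _
  rw [Matrix.trace_mul_comm, ← Matrix.mul_assoc, unitaryGroup_conjTranspose_mul, Matrix.one_mul]

/-- Summing the idempotents over the fibres of `f` gives orthogonal projections commuting with `G`
and adding up to 1; the summands are the compressions to their ranges. -/
theorem exists_decomposition [K.Normal] (hp : CompleteOrthogonalIdempotents p)
    (hpi : ∀ j, p j ∈ conjInvariants K) {J : Type} [Fintype J] [DecidableEq J] (f : Fin n → J)
    (ψ : G →* Matrix.unitaryGroup (Fin k) ℂ) :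
    ∃ (a : J → ℕ) (h : ∑ b, a b = k) (χ : ∀ b, G →* Matrix.unitaryGroup (Fin (a b)) ℂ)
      (u : Matrix.unitaryGroup (Fin k) ℂ), ψ = conjHom u (unitaryFamily.sumHom a h χ) ∧
        ∀ b i, imageDim p (χ b) i = if f i = b then imageDim p ψ i else 0 := by
  let q : J → MonoidAlgebra ℂ K := fun b => ∑ i with f i = b, p i
  have hpq : ∀ i b, p i * q b = if f i = b then p i else 0 := by
    intro i b
    simp only [q, Finset.mul_sum, hp.mul_eq, Finset.sum_ite_eq, Finset.mem_filter,
      Finset.mem_univ, true_and]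
  have hqq : ∀ b b', q b * q b' = if b = b' then q b else 0 := by
    intro b b'
    calc q b * q b' = ∑ i with f i = b, if f i = b' then p i else 0 := by
          rw [show q b = ∑ i with f i = b, p i from rfl, Finset.sum_mul]
          exact Finset.sum_congr rfl fun i _ => hpq i b'
      _ = ∑ i with f i = b, if b = b' then p i else 0 :=
          Finset.sum_congr rfl fun i hi => by rw [(Finset.mem_filter.1 hi).2]
      _ = _ := by split_ifs <;> simp [q]
  have hqi : ∀ b, q b ∈ conjInvariants K := fun b => Subalgebra.sum_mem _ fun i _ => hpi i
  have hq1 : ∑ b, q b = 1 := by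
    rw [← hp.complete]
    exact Finset.sum_fiberwise _ _ _
  choose a V hV hVP htr using fun b => exists_isometry_evalHom ψ (hqi b)
    (by rw [hqq, if_pos rfl] : q b * q b = q b)
  have h : ∑ b, a b = k := by
    have h' : ((∑ b, a b : ℕ) : ℂ) = k := by
      push_cast
      simp only [← htr]
      rw [← Matrix.trace_sum, ← map_sum, hq1, map_one, Matrix.trace_one, Fintype.card_fin]
    exact_mod_cast h'
  have hc : ∀ b g, (ψ g).1 * (V b * (V b)ᴴ) = V b * (V b)ᴴ * (ψ g).1 := fun b g => by
    rw [hVP, mul_evalHom_of_mem ψ (hqi b)]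
  have hVV : ∀ b b', b ≠ b' → (V b)ᴴ * V b' = 0 := by
    intro b b' hb
    have h1 : V b * (V b)ᴴ * (V b' * (V b')ᴴ) = 0 := by
      rw [hVP, hVP, ← map_mul, hqq, if_neg hb, map_zero]
    calc (V b)ᴴ * V b' = ((V b)ᴴ * V b) * (V b)ᴴ * (V b' * ((V b')ᴴ * V b')) := by
          rw [hV, hV, Matrix.one_mul, Matrix.mul_one]
      _ = (V b)ᴴ * (V b * (V b)ᴴ * (V b' * (V b')ᴴ)) * V b' := by
          simp only [Matrix.mul_assoc]
      _ = 0 := by rw [h1, Matrix.mul_zero, Matrix.zero_mul]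
  let u : Matrix (Fin k) (Fin k) ℂ := ∑ b, V b * (blockInc a h b)ᴴ
  have hu : uᴴ * u = 1 := by
    simp only [u, Matrix.conjTranspose_sum, Matrix.conjTranspose_mul,
      Matrix.conjTranspose_conjTranspose, Matrix.sum_mul]
    rw [← sum_blockInc a h]
    refine Finset.sum_congr rfl fun b _ => ?_
    rw [Matrix.mul_sum, Finset.sum_eq_single b]
    · rw [Matrix.mul_assoc, ← Matrix.mul_assoc (V b)ᴴ, hV, Matrix.one_mul]
    · intro b' _ hb
      rw [Matrix.mul_assoc, ← Matrix.mul_assoc (V b)ᴴ, hVV b b' hb.symm, Matrix.zero_mul,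
        Matrix.mul_zero]
    · simp
  let χ := fun b => compressHom ψ (hV b) (hc b)
  refine ⟨a, h, χ, ⟨u, Matrix.mem_unitaryGroup_iff'.2 hu⟩, MonoidHom.ext fun g => ?_,
    fun b i => ?_⟩
  · rw [conjHom_apply, eq_mul_inv_iff_mul_eq]
    refine Subtype.ext ?_
    show (ψ g).1 * u = u * (unitaryFamily.sum a h fun b => χ b g).1
    rw [coe_sum, Matrix.mul_sum, Matrix.sum_mul]
    refine Finset.sum_congr rfl fun b _ => ?_
    have h1 : (blockInc a h b)ᴴ * blockSum a h (fun b => (χ b g).1) =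
        (χ b g).1 * (blockInc a h b)ᴴ := by
      have h2 := congrArg Matrix.conjTranspose
        (blockSum_mul_blockInc a h (fun b => ((χ b g).1)ᴴ) b)
      rw [Matrix.conjTranspose_mul, Matrix.conjTranspose_mul, blockSum_conjTranspose] at h2
      simpa only [Matrix.conjTranspose_conjTranspose] using h2
    rw [Matrix.mul_assoc, h1, coe_compressHom]
    calc (ψ g).1 * (V b * (blockInc a h b)ᴴ) =
          (ψ g).1 * (V b * ((V b)ᴴ * V b) * (blockInc a h b)ᴴ) := by rw [hV, Matrix.mul_one]
      _ = (ψ g).1 * (V b * (V b)ᴴ) * (V b * (blockInc a h b)ᴴ) := by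
          simp only [Matrix.mul_assoc]
      _ = _ := by
          rw [hc]
          simp only [Matrix.mul_assoc]
  · have h1 : (imageDim p (χ b) i : ℂ) = ((if f i = b then imageDim p ψ i else 0 : ℕ) : ℂ) := by
      rw [coe_imageDim hp hpi, trace_evalHom_compressHom, hVP, ← map_mul, hpq]
      split_ifs
      · rw [coe_imageDim hp hpi]
      · simp
    exact_mod_cast h1

/-- The squared norm of `1 - E` for a projection `E` is `k` minus its trace. -/
theorem evalHom_eq_one [K.Normal] (hp : CompleteOrthogonalIdempotents p)
    (hpi : ∀ j, p j ∈ conjInvariants K) (ψ : G →* Matrix.unitaryGroup (Fin k) ℂ) {j : Fin n}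
    (hj : imageDim p ψ j = k) : evalHom ψ (p j) = 1 := by
  have h1 := coe_imageDim hp hpi ψ j
  have h2 := evalHom_isHermitian ψ (hpi j) (hp.idem j)
  have h3 : evalHom ψ (p j) * evalHom ψ (p j) = evalHom ψ (p j) := by
    rw [← map_mul, hp.idem j]
  refine (sub_eq_zero.1 (frobSq_eq_zero ?_)).symm
  rw [frobSq_eq_re_trace, Matrix.conjTranspose_sub, h2, Matrix.conjTranspose_one, Matrix.sub_mul,
    Matrix.mul_sub, Matrix.mul_sub, h3, Matrix.mul_one, Matrix.mul_one, Matrix.one_mul, sub_self, sub_zero, Matrix.trace_sub, ← h1,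
    hj, Matrix.trace_one, Fintype.card_fin, sub_self, Complex.zero_re]

open Classical in
/-- The sum of the conjugates of an element of a normal subgroup. -/
noncomputable def conjSum [K.Normal] [Fintype K] (x : K) : MonoidAlgebra ℂ K :=
  ∑ y ∈ {y | ∃ g : G, MulAut.conjNormal g x = y}, MonoidAlgebra.single y 1

theorem conjSum_mem [K.Normal] [Fintype K] (x : K) : conjSum x ∈ conjInvariants K := by
  classical
  refine mem_conjInvariants.2 fun g => ?_
  simp only [conjSum, map_sum, MonoidAlgebra.domCongr_single]
  refine Finset.sum_bij (fun y _ => MulAut.conjNormal g y) ?_ ?_ ?_ ?_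
  · intro y hy
    obtain ⟨g', hg'⟩ := (Finset.mem_filter.1 hy).2
    refine Finset.mem_filter.2 ⟨Finset.mem_univ _, g * g', ?_⟩
    rw [map_mul, MulAut.mul_apply, hg']
  · intro y _ z _ hyz
    exact (MulAut.conjNormal g).injective hyz
  · intro y hy
    obtain ⟨g', hg'⟩ := (Finset.mem_filter.1 hy).2
    refine ⟨MulAut.conjNormal (g⁻¹ * g') x,
      Finset.mem_filter.2 ⟨Finset.mem_univ _, g⁻¹ * g', rfl⟩, ?_⟩
    rw [← MulAut.mul_apply, ← map_mul, mul_inv_cancel_left, hg']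
  · intro y _
    rfl

theorem trace_conj (ψ : G →* Matrix.unitaryGroup (Fin k) ℂ) (g x : G) :
    (ψ (g * x * g⁻¹)).1.trace = (ψ x).1.trace := by
  rw [coe_map_mul, Matrix.trace_mul_comm, ← coe_map_mul]
  group

theorem trace_evalHom_conjSum [K.Normal] [Fintype K] (x : K) :
    ∃ N : ℕ, N ≠ 0 ∧ ∀ {k : ℕ} (ψ : G →* Matrix.unitaryGroup (Fin k) ℂ),
      (evalHom ψ (conjSum x)).trace = N * (ψ x).1.trace := by
  classical
  refine ⟨Finset.card {y | ∃ g : G, MulAut.conjNormal g x = y},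
    Finset.card_ne_zero.2 ⟨x, Finset.mem_filter.2 ⟨Finset.mem_univ _, 1, by simp⟩⟩, fun ψ => ?_⟩
  rw [conjSum, map_sum, Matrix.trace_sum, ← nsmul_eq_mul, ← Finset.sum_const]
  refine Finset.sum_congr (by congr) fun y hy => ?_
  obtain ⟨g, rfl⟩ := (Finset.mem_filter.1 hy).2
  rw [evalHom_single, one_smul, MulAut.conjNormal_apply, trace_conj]

/-- In a pure representation `p j` acts as 1, so each sum of `G`-conjugates of `x` acts as a scalar
depending only on `j`. Its trace is a multiple of the character at `x`, so the character on `K` is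
determined by the size. -/
theorem exists_conj_of_imageDim_eq [K.Normal] [Finite K] (hp : CompleteOrthogonalIdempotents p)
    (hpi : ∀ j, p j ∈ conjInvariants K)
    (hpc : ∀ a ∈ conjInvariants K, ∀ j, ∃ c : ℂ, a * p j = c • p j) (j : Fin n)
    (ψ χ : G →* Matrix.unitaryGroup (Fin k) ℂ) (hψ : imageDim p ψ j = k)
    (hχ : imageDim p χ j = k) :
    ∃ u : Matrix.unitaryGroup (Fin k) ℂ, ∀ x ∈ K, χ x = conjHom u ψ x := by
  have := Fintype.ofFinite K
  obtain ⟨u, hu⟩ := exists_conj_of_trace_eq (ψ.comp K.subtype) (χ.comp K.subtype) (fun x => by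
    obtain ⟨N, hN, hNψ⟩ := trace_evalHom_conjSum x
    obtain ⟨c, hc⟩ := hpc _ (conjSum_mem x) j
    have h1 : ∀ φ : G →* Matrix.unitaryGroup (Fin k) ℂ, imageDim p φ j = k →
        (N : ℂ) * (φ x).1.trace = (c • (1 : Matrix (Fin k) (Fin k) ℂ)).trace := by
      intro φ hφ
      have h2 := congrArg (evalHom φ) hc
      rw [map_mul, map_smul, evalHom_eq_one hp hpi φ hφ, mul_one] at h2
      rw [← hNψ, h2]
    exact mul_left_cancel₀ (Nat.cast_ne_zero.2 hN) ((h1 ψ hψ).trans (h1 χ hχ).symm))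
  exact ⟨u, fun x hx => DFunLike.congr_fun hu ⟨x, hx⟩⟩

/-- The multiplicities are fixed linear combinations of characters, and by Cauchy-Schwarz a cost of
`η ^ 2 * k` changes a trace by at most `η * k`. -/
theorem imageDim_lipschitz [K.Normal] [Finite K] (hp : CompleteOrthogonalIdempotents p)
    (hpi : ∀ j, p j ∈ conjInvariants K) (ε : ℝ) (hε : 0 < ε) :
    ∃ δ : ℝ, 0 < δ ∧ ∀ {k : ℕ} (ψ χ : G →* Matrix.unitaryGroup (Fin k) ℂ),
      (∀ x ∈ K, unitaryFamily.cost (ψ x) (χ x) ≤ δ * k) →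
        ∀ j, |(imageDim p ψ j : ℝ) - imageDim p χ j| ≤ ε * k := by
  have := Fintype.ofFinite K
  set c : ℝ := ∑ j, ∑ x, ‖(p j).coeff x‖ with hc
  have hc0 : 0 ≤ c := by positivity
  set η := ε / (c + 1) with hη
  have hη0 : 0 < η := by positivity
  refine ⟨η ^ 2, by positivity, fun {k} ψ χ hψχ j => ?_⟩
  have h1 : ∀ x : K, ‖(ψ x).1.trace - (χ x).1.trace‖ ≤ η * k := by
    intro x
    have h2 := norm_trace_sq_le ((ψ x).1 - (χ x).1)
    rw [Matrix.trace_sub, Fintype.card_fin] at h2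
    have h3 := hψχ x x.2
    rw [cost_def] at h3
    refine abs_le_of_sq_le_sq' ?_ (by positivity) |>.2
    calc _ ≤ (k : ℝ) * frobSq ((ψ x).1 - (χ x).1) := h2
      _ ≤ k * (η ^ 2 * k) := by gcongr
      _ = _ := by ring
  have h2 : |(imageDim p ψ j : ℝ) - imageDim p χ j| =
      ‖(imageDim p ψ j : ℂ) - imageDim p χ j‖ := by
    rw [← Real.norm_eq_abs, ← Complex.norm_real]
    push_cast
    rfl
  rw [h2, coe_imageDim hp hpi, coe_imageDim hp hpi, trace_evalHom, trace_evalHom,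
    ← Finset.sum_sub_distrib]
  calc _ ≤ ∑ x : K, ‖(p j).coeff x‖ * (η * k) := by
        refine (norm_sum_le _ _).trans (Finset.sum_le_sum fun x _ => ?_)
        rw [← mul_sub, norm_mul]
        gcongr
        exact h1 x
    _ = (∑ x : K, ‖(p j).coeff x‖) * (η * k) := (Finset.sum_mul _ _ _).symm
    _ ≤ c * (η * k) := by
        gcongr
        exact Finset.single_le_sum (f := fun j => ∑ x, ‖(p j).coeff x‖)
          (fun j _ => by positivity) (Finset.mem_univ j)
    _ ≤ (c + 1) * (η * k) := by
        gcongr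
        linarith
    _ = _ := by
        rw [hη]
        field_simp

end Isotypic

/-- The isotypic theory of unitary representations, relative to a finite normal subgroup. -/
noncomputable def types {G : Type*} [Group G] (K : Subgroup G) [K.Normal] [Finite K] :
    unitaryFamily.Types G K :=
  have h := (exists_conjInvariant_idempotents K).choose_spec.choose_spec
  { num := (exists_conjInvariant_idempotents K).choose
    dim := imageDim (exists_conjInvariant_idempotents K).choose_spec.choose
    sum_dim := sum_imageDim h.1 h.2.1
    dim_sumHom := fun {_} _ a {_} e ψ => imageDim_sumHom h.1 h.2.1 a e ψ
    dim_conjHom := imageDim_conjHom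
    decomp := fun {_} _ _ f {_} ψ => exists_decomposition h.1 h.2.1 f ψ
    conj_of_pure := exists_conj_of_imageDim_eq h.1 h.2.1 h.2.2
    lipschitz := imageDim_lipschitz h.1 h.2.1 }

end unitaryFamily

end

/-! ### Translation to the original metrics and conclusion. -/

theorem isHSStable_iff {G : Type*} [Group G] : IsHSStable G ↔
    IsStable (fun k : ℕ => Matrix.unitaryGroup (Fin k) ℂ) unitaryFamily.dist G := by
  -- The cost is a squared norm; squares and square roots preserve convergence to 0.
  have h : ∀ (k : ℕ → ℕ) (U V : ∀ n, Matrix.unitaryGroup (Fin (k n)) ℂ),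
      Tendsto (fun n => hsDist (k n) (U n) (V n)) atTop (𝓝 0) ↔
        Tendsto (fun n => unitaryFamily.dist (k n) (U n) (V n)) atTop (𝓝 0) := by
    intro k U V
    simp only [unitaryFamily.hsDist_eq_sqrt]
    constructor
    · intro h
      have h1 := h.pow 2
      simpa only [Real.sq_sqrt (unitaryFamily.dist_nonneg _ _), zero_pow two_ne_zero] using h1
    · intro h
      simpa using h.sqrt
  simp only [IsHSStable, IsStable, h]

theorem isPStable_iff {G : Type*} [Group G] : IsPStable G ↔
    IsStable (fun k : ℕ => Equiv.Perm (Fin k)) permFamily.dist G := by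
  simp only [IsPStable, IsStable, permFamily.dist_eq]

theorem mainTheorem9 {G H : Type*} [Group G] [Group.FG G] [Group H] [Finite H]
    (i₁ i₂ : H →* G) (h₁ : Function.Injective i₁) (h₂ : Function.Injective i₂)
    (hn₁ : i₁.range.Normal) (hn₂ : i₂.range.Normal) :
    (IsHSStable G → IsHSStable (HNNOfInclusions i₁ i₂ h₁ h₂)) ∧
      (IsPStable G → IsPStable (HNNOfInclusions i₁ i₂ h₁ h₂)) := by
  -- Normality makes the join of the two images equal to their product set, hence finite; it is
  -- again normal. This is the subgroup `K` of the argument.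
  have hK : ((i₁.range ⊔ i₂.range : Subgroup G) : Set G).Finite := by
    rw [Subgroup.mul_normal]
    exact (Set.finite_range i₁).mul (Set.finite_range i₂)
  have : Finite (i₁.range ⊔ i₂.range : Subgroup G) := hK
  rw [isHSStable_iff, isHSStable_iff, isPStable_iff, isPStable_iff]
  exact ⟨unitaryFamily.isStable_hnnOfInclusions unitaryFamily.approximable i₁ i₂ h₁ h₂ hK
      le_sup_left le_sup_right (unitaryFamily.types _) (unitaryFamily.types _)
      (unitaryFamily.nearConj H),
    permFamily.isStable_hnnOfInclusions permFamily.approximable i₁ i₂ h₁ h₂ hK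
      le_sup_left le_sup_right (permFamily.types _) (permFamily.types _)
      (permFamily.nearConj H)⟩
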